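/- Let $\mathbb K\in\{\mathbb R,\mathbb C\}$, let $M$ be a smooth manifold, $R=C^\infty(M,\mathbb K)$, and let $(L,A)$ be a Lie pair over $M$: $L$ is a Lie $\mathbb K$-algebroid over $M$ with bracket $[\cdot,\cdot]$ and anchor $\rho$, and $A\subset L$ is a Lie subalgebroid over $M$. Fix a decomposition $L\cong A\oplus B$ of vector bundles, with projections $\mathrm{pr}_A,\mathrm{pr}_B$. For $a\in\Gamma(A)$, $b,b'\in\Gamma(B)$ put $\nabla_ab=\mathrm{pr}_B[a,b]$, $\eth_ba=\mathrm{pr}_A[b,a]$, $[b,b']_B=\mathrm{pr}_B[b,b']$, $\beta(b,b')=\mathrm{pr}_A[b,b']$. Let $\Omega_A^k=\Gamma(\Lambda^kA^\vee)$ and $\Omega_A^k(B)=\Gamma(\Lambda^kA^\vee\otimes B)$ be the spaces of alternating $R$-multilinear maps $\Gamma(A)^k\to R$, resp. $\Gamma(A)^k\to\Gamma(B)$. $\mathrm{Sh}$ denotes sets of shuffles; a sum over shuffles with a block of size $-1$ is zero. **Brackets.** On $\mathfrak g=\Omega_A^\bullet(B)$ consider, for $X\in\Omega^p_A(B)$,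 $Y\in\Omega^q_A(B)$, $Z\in\Omega^r_A(B)$, $$(dX)(a_1,\dots,a_{p+1})=\sum_i(-1)^{i+1}\nabla_{a_i}X(\dots,\hat a_i,\dots)+\sum_{i<j}(-1)^{i+j}X([a_i,a_j],\dots,\hat a_i,\dots,\hat a_j,\dots),$$ $$\begin{aligned}{}[X,Y]_2(a_1,\dots,a_{p+q})=\sum_{\sigma\in\mathrm{Sh}(p,q)}\mathrm{sgn}(\sigma)\Big(&\sum_{i=1}^pX(a_{\sigma(1)},\dots,\eth_{Y(a_{\sigma(p+1)},\dots)}a_{\sigma(i)},\dots,a_{\sigma(p)})\\&-\sum_{j=1}^qY(a_{\sigma(p+1)},\dots,\eth_{X(a_{\sigma(1)},\dots)}a_{\sigma(p+j)},\dots,a_{\sigma(p+q)})\\&+[X(a_{\sigma(1)},\dots),Y(a_{\sigma(p+1)},\dots)]_B\Big),\end{aligned}$$ $$\begin{aligned}{}[X,Y,Z]_3(a_1,\dots,a_{p+q+r-1})=\ &(-1)^{p+q+1}\sum_{\sigma\in\mathrm{Sh}(p,q,r-1)}\mathrm{sgn}(\sigma)\,Z\big(\beta(X(a_{\sigma(1)},\dots),Y(a_{\sigma(p+1)},\dots)),a_{\sigma(p+q+1)},\dots\big)\\&+(-1)^p\sum_{\sigma\in\mathrm{Sh}(p,q-1,r)}\mathrm{sgn}(\sigma)\,Y\big(\beta(X(a_{\sigma(1)},\dots),Z(a_{\sigma(p+q)},\dots)),a_{\sigma(p+1)},\dots\big)\\&-\sum_{\sigma\in\mathrm{Sh}(p-1,q,r)}\mathrm{sgn}(\sigma)\,X\big(\beta(Y(a_{\sigma(p)},\dots),Z(a_{\sigma(p+q)},\dots)),a_{\sigma(1)},\dots\big).\end{aligned}$$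 Let $S(\mathfrak g[1])$ be the graded symmetric coalgebra with the unshuffle comultiplication, and let $\mathrm{pr}_1$ be its projection onto $\mathfrak g[1]$; write $\tilde x=x[1]$. **Derivations.** A derivative endomorphism of $\Gamma(L)$ is a $\mathbb K$-linear operator $\delta$ on $\Gamma(L)$ together with a symbol $s\in\mathfrak X(M)\otimes\mathbb K$ such that $\delta(fu)=s(f)u+f\delta(u)$. These form an $R$-module $\mathcal D(L)$. $\mathrm{Der}(L)\subset\mathcal D(L)$ is the Lie algebra, under commutators, of those with $[s,\rho(u)]=\rho(\delta u)$ and $\delta[u,v]=[\delta u,v]+[u,\delta v]$ (Lie algebroid derivations). **Theorem.** (a) The maps above are well defined and make $\mathfrak g$ an $L_{\leqslant3}$ algebra: there is a degree $1$ coderivation $Q$ of $S(\mathfrak g[1])$ with $Q(1)=0$, $Q^2=0$ and $$\mathrm{pr}_1Q(\tilde x_1\odot\cdots\odot\tilde x_n)=(-1)^{\frac{n(n+1)}2+\sum_i(n-i)|x_i|}\,[x_1,\dots,x_n]_n[1]\qquad(n\ge1),$$ where $[\cdot]_1=d$ and $[\cdots]_n=0$ for $n\ge4$. (b) $\mathrm{Der}(L)$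 acts on it: there is a morphism of dg Lie algebras $\psi:\mathrm{Der}(L)\to(\mathrm{Coder}(S(\mathfrak g[1])),[Q,\cdot])$ (where $\mathrm{Der}(L)$ sits in degree $0$ with zero differential), whose action maps $\mu_n(\delta,x_1,\dots,x_n)=\delta\triangleright(x_1,\dots,x_n)$, defined by $$\mathrm{pr}_1\psi(\delta)(\tilde x_1\odot\cdots\odot\tilde x_n)=(-1)^{\frac{n(n+3)}2+\sum_i(n-i)|x_i|}\,\mu_n(\delta,x_1,\dots,x_n)[1]\qquad(n\ge0),$$ are the following: 1. $\mu_0=\kappa$, $\ \kappa(\delta)(a)=-\mathrm{pr}_B\,\delta(a)$; 2. for $X\in\Omega_A^k(B)$, $k\ge0$: $\ (\delta\triangleright X)(a_1,\dots,a_k)=-\sum_jX(a_1,\dots,\mathrm{pr}_A\delta(a_j),\dots,a_k)+\mathrm{pr}_B\,\delta\big(X(a_1,\dots,a_k)\big)$; 3. for $X\in\Omega_A^i(B)$, $Y\in\Omega_A^j(B)$: $\ \delta\triangleright(X,Y)\in\Omega_A^{i+j-1}(B)$ is $$\begin{aligned}(\delta\triangleright(X,Y))(a_1,\dots,a_{i+j-1})=\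 &(-1)^{i+1}\sum_{\sigma\in\mathrm{Sh}(i,j-1)}\mathrm{sgn}(\sigma)\,Y\big(\mathrm{pr}_A\delta(X(a_{\sigma(1)},\dots)),a_{\sigma(i+1)},\dots\big)\\&+\sum_{\sigma\in\mathrm{Sh}(i-1,j)}\mathrm{sgn}(\sigma)\,X\big(\mathrm{pr}_A\delta(Y(a_{\sigma(i)},\dots)),a_{\sigma(1)},\dots\big)\end{aligned}$$ (in particular $\delta\triangleright(b,b')=0$, $\ \delta\triangleright(X,b)=X(\mathrm{pr}_A\delta(b),\cdots)$, $\ \delta\triangleright(b,X)=-X(\mathrm{pr}_A\delta(b),\cdots)$ for $b,b'\in\Gamma(B)$ and $X$ of positive degree); 4. $\mu_n=0$ for $n\ge3$. (c) Formulas 1–3 define such maps for every $\delta\in\mathcal D(L)$, with symbol $s$, and so do $$(\varrho_1(\delta)\omega)(a_1,\dots,a_k)=s\big(\omega(a_1,\dots,a_k)\big)-\sum_j\omega(a_1,\dots,\mathrm{pr}_A\delta(a_j),\dots,a_k),$$ $$(\varrho_2(\delta,X)\omega)(a_1,\dots,a_{i+k-1})=(-1)^{i+1}\sum_{\sigma\in\mathrm{Sh}(i,k-1)}\mathrm{sgn}(\sigma)\,\omega\big(\mathrm{pr}_A\delta(X(a_{\sigma(1)},\dots)),a_{\sigma(i+1)},\dots\big)$$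 for $\omega\in\Omega_A^k$, $X\in\Omega_A^i(B)$; $\varrho_1(\delta)$ and $\varrho_2(\delta,X)$ are derivations of the algebra $\Omega_A^\bullet$ of degrees $0$ and $|X|-1$. For all $\delta\in\mathcal D(L)$ (in particular all $\delta\in\mathrm{Der}(L)$), $f\in R$, $\omega\in\Omega_A^\bullet$ and $X,Y\in\Omega_A^\bullet(B)$: (i) $\kappa(f\delta)=f\kappa(\delta)$; (ii) $(f\delta)\triangleright X=f(\delta\triangleright X)$ and $\delta\triangleright(\omega\cdot X)=(\varrho_1(\delta)\omega)\cdot X+\omega\cdot(\delta\triangleright X)$; (iii) $(f\delta)\triangleright(X,Y)=f(\delta\triangleright(X,Y))$ and $\delta\triangleright(X,\omega\cdot Y)=(\varrho_2(\delta,X)\omega)\cdot Y+(-1)^{|\omega|(1+|X|)}\omega\cdot(\delta\triangleright(X,Y))$. -/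

import Mathlib

open scoped Manifold ContDiff TensorProduct DirectSum Bundle

noncomputable section

/-! ### The symmetric coalgebra of a graded vector space -/

namespace GradedSym

section

variable (𝕂 : Type*) [Field 𝕂] {ι : Type*} [DecidableEq ι]
  (V : ι → Type*) [∀ i, AddCommGroup (V i)] [∀ i, Module 𝕂 (V i)] (deg : ι → ℤ)

/-- The relations `v ⊙ w = (-1)^{|v||w|} w ⊙ v` (`v`, `w` homogeneous) on the tensor algebra of the
graded vector space `⨁ i, V i`, whose piece `V i` sits in degree `deg i`. -/
inductive Rel : TensorAlgebra 𝕂 (⨁ i, V i) → TensorAlgebra 𝕂 (⨁ i, V i) → Prop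
  | comm (i j : ι) (v : V i) (w : V j) :
      Rel (TensorAlgebra.ι 𝕂 (DirectSum.lof 𝕂 ι V i v) *
            TensorAlgebra.ι 𝕂 (DirectSum.lof 𝕂 ι V j w))
          (((-1 : 𝕂) ^ (deg i * deg j)) •
            (TensorAlgebra.ι 𝕂 (DirectSum.lof 𝕂 ι V j w) *
              TensorAlgebra.ι 𝕂 (DirectSum.lof 𝕂 ι V i v)))

/-- The (graded) symmetric algebra `S(V)` of the graded vector space `V = ⨁ i, V i`. -/
def Sym : Type _ := RingQuot (Rel 𝕂 V deg)

instance : Ring (Sym 𝕂 V deg) := inferInstanceAs (Ring (RingQuot (Rel 𝕂 V deg)))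

instance : Algebra 𝕂 (Sym 𝕂 V deg) := inferInstanceAs (Algebra 𝕂 (RingQuot (Rel 𝕂 V deg)))

/-- The inclusion of the homogeneous piece `V i` in `S(V)`. -/
def gen (i : ι) : V i →ₗ[𝕂] Sym 𝕂 V deg :=
  (RingQuot.mkAlgHom 𝕂 (Rel 𝕂 V deg)).toLinearMap ∘ₗ
    TensorAlgebra.ι 𝕂 ∘ₗ DirectSum.lof 𝕂 ι V i

variable {V deg}

theorem gen_mul_gen (i j : ι) (v : V i) (w : V j) :
    gen 𝕂 V deg i v * gen 𝕂 V deg j w =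
      ((-1 : 𝕂) ^ (deg i * deg j)) • (gen 𝕂 V deg j w * gen 𝕂 V deg i v) := by
  have h := RingQuot.mkAlgHom_rel 𝕂 (Rel.comm (𝕂 := 𝕂) (V := V) (deg := deg) i j v w)
  rw [map_smul, map_mul, map_mul] at h
  exact h

variable {𝕂}

/-- The universal property of `S(V)`. -/
def lift {R : Type*} [Ring R] [Algebra 𝕂 R] (f : ∀ i, V i →ₗ[𝕂] R)
    (hf : ∀ i j v w, f i v * f j w = ((-1 : 𝕂) ^ (deg i * deg j)) • (f j w * f i v)) :
    Sym 𝕂 V deg →ₐ[𝕂] R :=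
  RingQuot.liftAlgHom 𝕂 ⟨TensorAlgebra.lift 𝕂 (DirectSum.toModule 𝕂 ι R f), by
    rintro _ _ ⟨i, j, v, w⟩
    simp only [map_mul, map_smul, TensorAlgebra.lift_ι_apply, DirectSum.toModule_lof]
    exact hf i j v w⟩

theorem lift_gen {R : Type*} [Ring R] [Algebra 𝕂 R] (f : ∀ i, V i →ₗ[𝕂] R)
    (hf : ∀ i j v w, f i v * f j w = ((-1 : 𝕂) ^ (deg i * deg j)) • (f j w * f i v))
    (i : ι) (v : V i) : lift f hf (gen 𝕂 V deg i v) = f i v := by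
  have h : lift f hf (gen 𝕂 V deg i v) =
      TensorAlgebra.lift 𝕂 (DirectSum.toModule 𝕂 ι R f)
        (TensorAlgebra.ι 𝕂 (DirectSum.lof 𝕂 ι V i v)) :=
    RingQuot.liftAlgHom_mkAlgHom_apply 𝕂 _ _ _
  rw [h, TensorAlgebra.lift_ι_apply, DirectSum.toModule_lof]

theorem algHom_ext {R : Type*} [Ring R] [Algebra 𝕂 R] {f g : Sym 𝕂 V deg →ₐ[𝕂] R}
    (h : ∀ i v, f (gen 𝕂 V deg i v) = g (gen 𝕂 V deg i v)) : f = g := by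
  refine RingQuot.ringQuot_ext' (S := 𝕂) (s := Rel 𝕂 V deg) f g ?_
  refine TensorAlgebra.hom_ext (DirectSum.linearMap_ext 𝕂 fun i => LinearMap.ext fun v => ?_)
  exact h i v

variable (𝕂 V deg)

/-- The Koszul sign operator `x ↦ (-1)^{m|x|} x` on `S(V)`. -/
def koszul (m : ℤ) : Sym 𝕂 V deg →ₐ[𝕂] Sym 𝕂 V deg :=
  lift (fun i => ((-1 : 𝕂) ^ (m * deg i)) • gen 𝕂 V deg i) (by
    intro i j v w
    simp only [LinearMap.smul_apply, smul_mul_smul_comm]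
    rw [gen_mul_gen, smul_smul, smul_smul]
    congr 1
    ring)

theorem koszul_gen (m : ℤ) (i : ι) (v : V i) :
    koszul 𝕂 V deg m (gen 𝕂 V deg i v) = ((-1 : 𝕂) ^ (m * deg i)) • gen 𝕂 V deg i v := by
  simp only [koszul, lift_gen, LinearMap.smul_apply]

theorem koszul_comm (m n : ℤ) (x : Sym 𝕂 V deg) :
    koszul 𝕂 V deg m (koszul 𝕂 V deg n x) = koszul 𝕂 V deg n (koszul 𝕂 V deg m x) := by
  have h : (koszul 𝕂 V deg m).comp (koszul 𝕂 V deg n) =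
      (koszul 𝕂 V deg n).comp (koszul 𝕂 V deg m) := by
    refine algHom_ext fun i v => ?_
    simp only [AlgHom.comp_apply, koszul_gen, map_smul, smul_smul]
    rw [mul_comm]
  exact DFunLike.congr_fun h x

/-- Left multiplication by `v ⊗ 1 + 1 ⊗ v` on the graded tensor product `S(V) ⊗ S(V)`, where
`(1 ⊗ v) (x ⊗ y) = (-1)^{|v||x|} x ⊗ (v ⊙ y)`. -/
def primMul (i : ι) : V i →ₗ[𝕂] Module.End 𝕂 (Sym 𝕂 V deg ⊗[𝕂] Sym 𝕂 V deg) :=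
  LinearMap.rTensorHom (Sym 𝕂 V deg) ∘ₗ LinearMap.mul 𝕂 (Sym 𝕂 V deg) ∘ₗ gen 𝕂 V deg i +
    TensorProduct.mapBilinear (RingHom.id 𝕂) (Sym 𝕂 V deg) (Sym 𝕂 V deg) (Sym 𝕂 V deg)
        (Sym 𝕂 V deg) (koszul 𝕂 V deg (deg i)).toLinearMap ∘ₗ
      LinearMap.mul 𝕂 (Sym 𝕂 V deg) ∘ₗ gen 𝕂 V deg i

theorem primMul_tmul (i : ι) (v : V i) (x y : Sym 𝕂 V deg) :
    primMul 𝕂 V deg i v (x ⊗ₜ y) =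
      (gen 𝕂 V deg i v * x) ⊗ₜ[𝕂] y + koszul 𝕂 V deg (deg i) x ⊗ₜ[𝕂] (gen 𝕂 V deg i v * y) :=
  rfl

theorem negOne_zpow_sq (n : ℤ) : ((-1 : 𝕂) ^ n) * ((-1 : 𝕂) ^ n) = 1 := by
  rw [← mul_zpow]; simp

theorem primMul_comm (i j : ι) (v : V i) (w : V j) :
    primMul 𝕂 V deg i v * primMul 𝕂 V deg j w =
      ((-1 : 𝕂) ^ (deg i * deg j)) • (primMul 𝕂 V deg j w * primMul 𝕂 V deg i v) := by
  refine TensorProduct.ext' fun x y => ?_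
  have hc : (-1 : 𝕂) ^ (deg j * deg i) = (-1 : 𝕂) ^ (deg i * deg j) := by rw [mul_comm]
  have e1 : gen 𝕂 V deg i v * (gen 𝕂 V deg j w * x) =
      ((-1 : 𝕂) ^ (deg i * deg j)) • (gen 𝕂 V deg j w * (gen 𝕂 V deg i v * x)) := by
    rw [← mul_assoc, gen_mul_gen, smul_mul_assoc, mul_assoc]
  have e2 : gen 𝕂 V deg i v * (gen 𝕂 V deg j w * y) =
      ((-1 : 𝕂) ^ (deg i * deg j)) • (gen 𝕂 V deg j w * (gen 𝕂 V deg i v * y)) := by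
    rw [← mul_assoc, gen_mul_gen, smul_mul_assoc, mul_assoc]
  simp only [Module.End.mul_apply, LinearMap.smul_apply, primMul_tmul, map_add, smul_add,
    map_mul, koszul_gen, smul_mul_assoc, TensorProduct.smul_tmul', hc]
  rw [e1, e2, koszul_comm 𝕂 V deg (deg i) (deg j)]
  simp only [TensorProduct.tmul_smul, ← TensorProduct.smul_tmul', smul_smul, negOne_zpow_sq,
    one_smul]
  abel

/-- The comultiplication of `S(V)`: the morphism of graded algebras `S(V) → S(V) ⊗ S(V)` with
`v ↦ v ⊗ 1 + 1 ⊗ v` for `v ∈ V`. On a product `v₁ ⊙ ⋯ ⊙ vₙ` of homogeneous elements it is the sum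
over unshuffles with Koszul signs. -/
def comul : Sym 𝕂 V deg →ₗ[𝕂] Sym 𝕂 V deg ⊗[𝕂] Sym 𝕂 V deg :=
  LinearMap.applyₗ (1 ⊗ₜ[𝕂] 1) ∘ₗ
    (lift (primMul 𝕂 V deg) (primMul_comm 𝕂 V deg)).toLinearMap

theorem comul_one : comul 𝕂 V deg 1 = 1 ⊗ₜ[𝕂] 1 := by
  simp [comul]

/-- `Δ(v ⊙ x) = (v ⊗ 1 + 1 ⊗ v) Δ(x)`; together with `comul_one` this determines `Δ`. -/
theorem comul_gen_mul (i : ι) (v : V i) (x : Sym 𝕂 V deg) :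
    comul 𝕂 V deg (gen 𝕂 V deg i v * x) = primMul 𝕂 V deg i v (comul 𝕂 V deg x) := by
  simp [comul, lift_gen]

theorem comul_gen (i : ι) (v : V i) :
    comul 𝕂 V deg (gen 𝕂 V deg i v) =
      gen 𝕂 V deg i v ⊗ₜ[𝕂] 1 + 1 ⊗ₜ[𝕂] gen 𝕂 V deg i v := by
  have h := comul_gen_mul 𝕂 V deg i v 1
  rw [mul_one, comul_one, primMul_tmul] at h
  simpa using h

/-- The canonical projection `pr₁ : S(V) → V` onto `S¹(V) = V`. -/
def pr1 : Sym 𝕂 V deg →ₗ[𝕂] ⨁ i, V i :=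
  letI : Module 𝕂ᵐᵒᵖ (⨁ i, V i) :=
    Module.compHom _ ((RingHom.id 𝕂).fromOpposite mul_comm)
  haveI : IsCentralScalar 𝕂 (⨁ i, V i) := ⟨fun _ _ => rfl⟩
  TrivSqZeroExt.sndHom 𝕂 (⨁ i, V i) ∘ₗ
    (lift (deg := deg)
      (fun i => TrivSqZeroExt.inrHom 𝕂 (⨁ i, V i) ∘ₗ DirectSum.lof 𝕂 ι V i)
      (by intro i j v w; simp)).toLinearMap

variable {𝕂 V}

/-- The product `x₁ ⊙ ⋯ ⊙ xₙ` of a list of homogeneous elements. -/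
def prodOf (l : List (Σ i, V i)) : Sym 𝕂 V deg :=
  (l.map fun v => gen 𝕂 V deg v.1 v.2).prod

theorem pr1_one : pr1 𝕂 V deg 1 = 0 := by
  let m' : Module 𝕂ᵐᵒᵖ (⨁ i, V i) :=
    Module.compHom _ ((RingHom.id 𝕂).fromOpposite mul_comm)
  have : IsCentralScalar 𝕂 (⨁ i, V i) := ⟨fun _ _ => rfl⟩
  change TrivSqZeroExt.snd (lift (deg := deg) _ _ 1) = 0
  rw [map_one, TrivSqZeroExt.snd_one]

theorem pr1_gen (i : ι) (v : V i) :
    pr1 𝕂 V deg (gen 𝕂 V deg i v) = DirectSum.lof 𝕂 ι V i v := by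
  simp [pr1, lift_gen]

theorem pr1_gen_mul_gen (i j : ι) (v : V i) (w : V j) (x : Sym 𝕂 V deg) :
    pr1 𝕂 V deg (gen 𝕂 V deg i v * (gen 𝕂 V deg j w * x)) = 0 := by
  simp [pr1, lift_gen]

variable (𝕂 V)

/-- The degree `d` part of `S(V)`. -/
def degPart (d : ℤ) : Submodule 𝕂 (Sym 𝕂 V deg) :=
  Submodule.span 𝕂 {x | ∃ l : List (Σ i, V i),
    x = prodOf deg l ∧ (l.map fun v => deg v.1).sum = d}

variable {𝕂 V deg}

/-- `D ∈ Coder^m(S(V))`: the linear map `D` has degree `m` and satisfies the coLeibniz rule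
`Δ D = (D ⊗ id + id ⊗ D) Δ`, where `(id ⊗ D) (x ⊗ y) = (-1)^{m|x|} x ⊗ D y`. -/
def IsCoderivation (m : ℤ) (D : Module.End 𝕂 (Sym 𝕂 V deg)) : Prop :=
  (∀ d, ∀ x ∈ degPart 𝕂 V deg d, D x ∈ degPart 𝕂 V deg (d + m)) ∧
  comul 𝕂 V deg ∘ₗ D =
    (TensorProduct.map D LinearMap.id +
      TensorProduct.map (koszul 𝕂 V deg m).toLinearMap D) ∘ₗ comul 𝕂 V deg

/-- The graded commutator `[F, G] = F G - (-1)^{mn} G F` of `F` of degree `m` and `G` of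
degree `n`. -/
def gradedBracket (m n : ℤ) (F G : Module.End 𝕂 (Sym 𝕂 V deg)) :
    Module.End 𝕂 (Sym 𝕂 V deg) :=
  F ∘ₗ G - ((-1 : 𝕂) ^ (m * n)) • (G ∘ₗ F)

/-- A codifferential of the (reduced) symmetric coalgebra: a degree 1 coderivation `Q` with
`Q ∘ Q = 0`, whose component on `S⁰(V) = 𝕂` is zero. -/
structure IsCodifferential (Q : Module.End 𝕂 (Sym 𝕂 V deg)) : Prop where
  coderivation : IsCoderivation 1 Q
  map_one : Q 1 = 0
  sq_zero : Q ∘ₗ Q = 0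

/-- A morphism of dg Lie algebras from the Lie algebra `𝔥` (in degree 0, with zero differential)
to `(Coder(S(V)), [·,·], [Q, ·])`. -/
structure IsDGLAHom {𝔥 : Type*} [LieRing 𝔥] [LieAlgebra 𝕂 𝔥] (Q : Module.End 𝕂 (Sym 𝕂 V deg))
    (ψ : 𝔥 →ₗ[𝕂] Module.End 𝕂 (Sym 𝕂 V deg)) : Prop where
  coderivation : ∀ h, IsCoderivation 0 (ψ h)
  map_lie : ∀ h h', ψ ⁅h, h'⁆ = gradedBracket 0 0 (ψ h) (ψ h')
  map_d : ∀ h, gradedBracket 1 0 Q (ψ h) = 0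

end

/-! ### `L_∞` algebras `𝔤` and Lie algebra actions on them, through `S(𝔤[1])`

The graded vector space is `𝔤 = ⨁ i, V i` with `V i` in degree `deg i`. The shifted space `𝔤[1]`
has the same pieces, with `V i` in degree `deg i - 1`. -/

section

variable (𝕂 : Type*) [Field 𝕂] {ι : Type*} [DecidableEq ι]
  (V : ι → Type*) [∀ i, AddCommGroup (V i)] [∀ i, Module 𝕂 (V i)] (deg : ι → ℤ)

/-- `S(𝔤[1])`. -/
abbrev SymShift : Type _ := Sym 𝕂 V (fun i => deg i - 1)

variable {𝕂 V}

/-- The exponent `∑ i, (n - i) |x_i|` of the décalage sign of `x₁, …, xₙ ∈ 𝔤`. -/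
def decalage : List (Σ i, V i) → ℤ
  | [] => 0
  | x :: l => l.length * deg x.1 + decalage l

variable {deg}

/-- The `n`-bracket `[x₁, …, xₙ]ₙ` on `𝔤` encoded by a codifferential `Q` of `S(𝔤[1])`:
`pr₁ Q (x̃₁ ⊙ ⋯ ⊙ x̃ₙ) = (-1)^{n(n+1)/2 + ∑ (n-i)|x_i|} [x₁, …, xₙ]ₙ [1]`. -/
def bracketOf (Q : Module.End 𝕂 (SymShift 𝕂 V deg)) (l : List (Σ i, V i)) : ⨁ i, V i :=
  ((-1 : 𝕂) ^ (((l.length * (l.length + 1) / 2 : ℕ) : ℤ) + decalage deg l)) •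
    pr1 𝕂 V _ (Q (prodOf _ l))

/-- The `n`-action `h ▷ (x₁, …, xₙ)` encoded by the coderivation `D = ψ(h)` of `S(𝔤[1])`:
`pr₁ D (x̃₁ ⊙ ⋯ ⊙ x̃ₙ) = (-1)^{n(n+3)/2 + ∑ (n-i)|x_i|} (h ▷ (x₁, …, xₙ)) [1]`. -/
def actionOf (D : Module.End 𝕂 (SymShift 𝕂 V deg)) (l : List (Σ i, V i)) : ⨁ i, V i :=
  ((-1 : 𝕂) ^ (((l.length * (l.length + 3) / 2 : ℕ) : ℤ) + decalage deg l)) •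
    pr1 𝕂 V _ (D (prodOf _ l))

end

end GradedSym

/-! ### Smooth `𝕂`-vector bundles over a smooth manifold -/

namespace LieAlgd

universe uM uF uE

section Bundles

variable (𝕂 : Type) [RCLike 𝕂] (m : ℕ) (M : Type uM) [TopologicalSpace M]
  [ChartedSpace (EuclideanSpace ℝ (Fin m)) M]

/-- `C^∞(M, 𝕂)`. -/
abbrev SmoothFn : Type _ := C^∞⟮𝓡 m, M; 𝓘(ℝ, 𝕂), 𝕂⟯

instance : ContMDiffRing 𝓘(ℝ, 𝕂) ∞ 𝕂 where
  __ := instNormedSpaceLieAddGroup (𝕜 := ℝ) (n := ∞) (E := 𝕂)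
  contMDiff_mul := by
    rw [contMDiff_iff]
    refine ⟨continuous_mul, fun x y => ?_⟩
    simp only [mfld_simps, chartAt_self_eq]
    rw [contDiffOn_univ]
    exact contDiff_mul

/-- `C^∞(M, 𝕂)` is a `𝕂`-algebra through the constant functions. -/
instance : Algebra 𝕂 (SmoothFn 𝕂 m M) where
  smul c f := ⟨fun x => c • f x, contMDiff_const.mul f.contMDiff⟩
  algebraMap :=
    { toFun := fun c => ⟨fun _ => c, contMDiff_const⟩
      map_one' := rfl
      map_mul' := fun _ _ => rfl
      map_zero' := rfl
      map_add' := fun _ _ => rfl }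
  commutes' c f := by ext x; exact mul_comm _ _
  smul_def' c f := by ext x; rfl

/-- A smooth `𝕂`-vector bundle of finite rank over `M`: a smooth real vector bundle with a
`𝕂`-linear structure for which the local trivializations are `𝕂`-linear on the fibres. -/
structure VBundle where
  /-- the model fibre -/
  F : Type uF
  /-- the fibres -/
  E : M → Type uE
  [normF : NormedAddCommGroup F]
  [realF : NormedSpace ℝ F]
  [scalF : NormedSpace 𝕂 F]
  [towerF : IsScalarTower ℝ 𝕂 F]
  [finF : FiniteDimensional 𝕂 F]
  [addE : ∀ x, AddCommGroup (E x)]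
  [realE : ∀ x, Module ℝ (E x)]
  [scalE : ∀ x, Module 𝕂 (E x)]
  [towerE : ∀ x, IsScalarTower ℝ 𝕂 (E x)]
  [topE : ∀ x, TopologicalSpace (E x)]
  [topTot : TopologicalSpace (Bundle.TotalSpace F E)]
  [fiber : FiberBundle F E]
  [vecR : VectorBundle ℝ F E]
  [vecK : VectorBundle 𝕂 F E]
  [smooth : ContMDiffVectorBundle ∞ F E (𝓡 m)]

attribute [instance] VBundle.normF VBundle.realF VBundle.scalF VBundle.towerF VBundle.finF
  VBundle.addE VBundle.realE VBundle.scalE VBundle.towerE VBundle.topE VBundle.topTot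
  VBundle.fiber VBundle.vecR VBundle.vecK VBundle.smooth

variable {𝕂 m M}

/-- The space `Γ(E)` of smooth sections. -/
def Sec (E : VBundle.{uM, uF, uE} 𝕂 m M) : Type _ := Cₛ^∞⟮𝓡 m; E.F, E.E⟯

instance (E : VBundle.{uM, uF, uE} 𝕂 m M) : AddCommGroup (Sec E) :=
  inferInstanceAs (AddCommGroup Cₛ^∞⟮𝓡 m; E.F, E.E⟯)

/-- The value of a section at a point. -/
def Sec.val {E : VBundle.{uM, uF, uE} 𝕂 m M} (s : Sec E) (x : M) : E.E x :=
  (show Cₛ^∞⟮𝓡 m; E.F, E.E⟯ from s) x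

theorem Sec.ext {E : VBundle.{uM, uF, uE} 𝕂 m M} {s t : Sec E} (h : ∀ x, s.val x = t.val x) :
    s = t :=
  ContMDiffSection.ext h

theorem Sec.smul_smooth {E : VBundle.{uM, uF, uE} 𝕂 m M} (f : SmoothFn 𝕂 m M) (s : Sec E) :
    ContMDiff (𝓡 m) ((𝓡 m).prod 𝓘(ℝ, E.F)) ∞
      (fun x => Bundle.TotalSpace.mk' E.F x (f x • s.val x)) := by
  intro x₀
  have hs : ContMDiffAt (𝓡 m) ((𝓡 m).prod 𝓘(ℝ, E.F)) ∞
      (fun x => Bundle.TotalSpace.mk' E.F x (s.val x)) x₀ :=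
    ContMDiffSection.contMDiff (show Cₛ^∞⟮𝓡 m; E.F, E.E⟯ from s) x₀
  rw [Bundle.contMDiffAt_section] at hs ⊢
  set e := trivializationAt E.F E.E x₀
  have hb : ContDiff ℝ ∞ (fun p : 𝕂 × E.F => p.1 • p.2) := contDiff_smul
  have hf : ContMDiffAt (𝓡 m) 𝓘(ℝ, 𝕂) ∞ f x₀ := f.contMDiff x₀
  have h := hb.contDiffAt.contMDiffAt.comp x₀ (hf.prodMk_space hs)
  refine h.congr_of_eventuallyEq ?_
  filter_upwards [e.open_baseSet.mem_nhds (FiberBundle.mem_baseSet_trivializationAt' x₀)]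
    with x hx
  exact (e.linear 𝕂 hx).2 _ _

instance (E : VBundle.{uM, uF, uE} 𝕂 m M) : SMul (SmoothFn 𝕂 m M) (Sec E) :=
  ⟨fun f s => (⟨fun x => f x • s.val x, Sec.smul_smooth f s⟩ : Cₛ^∞⟮𝓡 m; E.F, E.E⟯)⟩

@[simp] theorem Sec.smul_val {E : VBundle.{uM, uF, uE} 𝕂 m M} (f : SmoothFn 𝕂 m M) (s : Sec E)
    (x : M) : (f • s).val x = f x • s.val x := rfl

@[simp] theorem Sec.add_val {E : VBundle.{uM, uF, uE} 𝕂 m M} (s t : Sec E)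
    (x : M) : (s + t).val x = s.val x + t.val x := rfl

@[simp] theorem Sec.zero_val {E : VBundle.{uM, uF, uE} 𝕂 m M}
    (x : M) : (0 : Sec E).val x = 0 := rfl

/-- `Γ(E)` is a module over `C^∞(M, 𝕂)`, by pointwise multiplication. -/
instance (E : VBundle.{uM, uF, uE} 𝕂 m M) : Module (SmoothFn 𝕂 m M) (Sec E) where
  one_smul s := Sec.ext fun x => one_smul 𝕂 _
  mul_smul f g s := Sec.ext fun x => mul_smul (f x) (g x) _
  smul_zero f := Sec.ext fun x => smul_zero (f x)
  smul_add f s t := Sec.ext fun x => smul_add (f x) _ _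
  add_smul f g s := Sec.ext fun x => add_smul (f x) (g x) _
  zero_smul s := Sec.ext fun x => zero_smul 𝕂 _

instance (E : VBundle.{uM, uF, uE} 𝕂 m M) : Module 𝕂 (Sec E) :=
  Module.compHom _ (algebraMap 𝕂 (SmoothFn 𝕂 m M))

instance (E : VBundle.{uM, uF, uE} 𝕂 m M) : IsScalarTower 𝕂 (SmoothFn 𝕂 m M) (Sec E) :=
  ⟨fun c f s => Sec.ext fun x => mul_smul c (f x) _⟩

instance (E : VBundle.{uM, uF, uE} 𝕂 m M) : SMulCommClass (SmoothFn 𝕂 m M) 𝕂 (Sec E) :=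
  ⟨fun f c s => Sec.ext fun x => smul_comm (f x) c (s.val x)⟩

instance (E : VBundle.{uM, uF, uE} 𝕂 m M) : SMulCommClass 𝕂 (SmoothFn 𝕂 m M) (Sec E) :=
  ⟨fun c f s => Sec.ext fun x => smul_comm c (f x) (s.val x)⟩

/-- A smooth morphism of `𝕂`-vector bundles over the identity of `M`. -/
structure BundleMap (E : VBundle.{uM, uF, uE} 𝕂 m M) (E' : VBundle.{uM, uF, uE} 𝕂 m M) where
  /-- the fibrewise linear maps -/
  toFun : ∀ x, E.E x →ₗ[𝕂] E'.E x
  smooth : ContMDiff ((𝓡 m).prod 𝓘(ℝ, E.F)) ((𝓡 m).prod 𝓘(ℝ, E'.F)) ∞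
    (fun v : Bundle.TotalSpace E.F E.E => Bundle.TotalSpace.mk' E'.F v.1 (toFun v.1 v.2))

/-- The map on sections induced by a morphism of vector bundles. -/
def BundleMap.sec {E E' : VBundle.{uM, uF, uE} 𝕂 m M} (φ : BundleMap E E') :
    Sec E →ₗ[SmoothFn 𝕂 m M] Sec E' where
  toFun s := (⟨fun x => φ.toFun x (s.val x),
    φ.smooth.comp (ContMDiffSection.contMDiff (show Cₛ^∞⟮𝓡 m; E.F, E.E⟯ from s))⟩ :
      Cₛ^∞⟮𝓡 m; E'.F, E'.E⟯)
  map_add' s t := Sec.ext fun x => map_add (φ.toFun x) _ _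
  map_smul' f s := Sec.ext fun x => map_smul (φ.toFun x) _ _

variable (𝕂 m M)

/-- `𝒳(M) ⊗ 𝕂`, the `𝕂`-valued vector fields, as the derivations of `C^∞(M, 𝕂)`. -/
abbrev VectorFields : Type _ := Derivation 𝕂 (SmoothFn 𝕂 m M) (SmoothFn 𝕂 m M)

variable {𝕂 m M}

/-! ### Lie algebroids, Lie pairs, derivations -/

/-- A Lie algebroid structure on the vector bundle `E`. A bundle map `E → TM ⊗ 𝕂` is given by the
corresponding `C^∞(M, 𝕂)`-linear map of sections. -/
structure LieAlgebroid (E : VBundle.{uM, uF, uE} 𝕂 m M) where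
  /-- the bracket of sections -/
  bracket : Sec E →ₗ[𝕂] Sec E →ₗ[𝕂] Sec E
  /-- the anchor -/
  anchor : Sec E →ₗ[SmoothFn 𝕂 m M] VectorFields 𝕂 m M
  bracket_self : ∀ u, bracket u u = 0
  jacobi : ∀ u v w, bracket u (bracket v w) = bracket (bracket u v) w + bracket v (bracket u w)
  anchor_bracket : ∀ u v, anchor (bracket u v) = ⁅anchor u, anchor v⁆
  leibniz : ∀ (u : Sec E) (f : SmoothFn 𝕂 m M) (v : Sec E),
    bracket u (f • v) = anchor u f • v + f • bracket u v

/-- A Lie pair `(L, A)`: the Lie algebroid `A` is a Lie subalgebroid of `L`. -/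
structure LiePair (L A : VBundle.{uM, uF, uE} 𝕂 m M) where
  /-- the Lie algebroid structure of `L` -/
  algL : LieAlgebroid L
  /-- the Lie algebroid structure of `A` -/
  algA : LieAlgebroid A
  /-- the inclusion `A ↪ L` -/
  incl : BundleMap A L
  incl_injective : ∀ x, Function.Injective (incl.toFun x)
  incl_bracket : ∀ a a', incl.sec (algA.bracket a a') =
    algL.bracket (incl.sec a) (incl.sec a')
  incl_anchor : ∀ a, algA.anchor a = algL.anchor (incl.sec a)

/-- A decomposition `L ≅ A ⊕ B` of vector bundles, extending the inclusion of `A`. -/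
structure Splitting {L A : VBundle.{uM, uF, uE} 𝕂 m M} (P : LiePair L A)
    (B : VBundle.{uM, uF, uE} 𝕂 m M) where
  /-- the embedding `B ↪ L` -/
  inclB : BundleMap B L
  /-- the projection `L → A` -/
  prA : BundleMap L A
  /-- the projection `L → B` -/
  prB : BundleMap L B
  prA_incl : ∀ x a, prA.toFun x (P.incl.toFun x a) = a
  prA_inclB : ∀ x b, prA.toFun x (inclB.toFun x b) = 0
  prB_incl : ∀ x a, prB.toFun x (P.incl.toFun x a) = 0
  prB_inclB : ∀ x b, prB.toFun x (inclB.toFun x b) = b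
  decomp : ∀ x l, P.incl.toFun x (prA.toFun x l) + inclB.toFun x (prB.toFun x l) = l

/-- The `C^∞(M, 𝕂)`-module of derivative endomorphisms of `Γ(L)`: pairs `(δ, s)` of an operator
`δ` on `Γ(L)` and a symbol `s ∈ 𝒳(M) ⊗ 𝕂` such that `δ(f u) = s(f) u + f δ(u)`. -/
def DerEnd (L : VBundle.{uM, uF, uE} 𝕂 m M) :
    Submodule (SmoothFn 𝕂 m M) (Module.End 𝕂 (Sec L) × VectorFields 𝕂 m M) where
  carrier := {D | ∀ (f : SmoothFn 𝕂 m M) (u : Sec L), D.1 (f • u) = D.2 f • u + f • D.1 u}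
  zero_mem' := by intro f u; simp
  add_mem' := by
    intro D D' h h' f u
    simp only [Prod.fst_add, Prod.snd_add, LinearMap.add_apply, Derivation.add_apply, h f u,
      h' f u, add_smul, smul_add]
    abel
  smul_mem' := by
    intro g D h f u
    simp only [Prod.smul_fst, Prod.smul_snd, LinearMap.smul_apply, Derivation.smul_apply, h f u,
      smul_add, smul_eq_mul, mul_smul, smul_comm g f]

/-- The commutator bracket on operators. -/
instance (L : VBundle.{uM, uF, uE} 𝕂 m M) : LieRing (Module.End 𝕂 (Sec L)) :=
  LieRing.ofAssociativeRing

instance (L : VBundle.{uM, uF, uE} 𝕂 m M) : LieAlgebra 𝕂 (Module.End 𝕂 (Sec L)) :=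
  LieAlgebra.ofAssociativeAlgebra

/-- The Lie algebra `Der(L)` of derivations of the Lie algebroid `L` (an operator together with
its symbol), with the commutator bracket. -/
def Der {L : VBundle.{uM, uF, uE} 𝕂 m M} (𝓛 : LieAlgebroid L) :
    LieSubalgebra 𝕂 (Module.End 𝕂 (Sec L) × VectorFields 𝕂 m M) where
  carrier := {D | D ∈ DerEnd L ∧ (∀ u, ⁅D.2, 𝓛.anchor u⁆ = 𝓛.anchor (D.1 u)) ∧
    ∀ u v, D.1 (𝓛.bracket u v) = 𝓛.bracket (D.1 u) v + 𝓛.bracket u (D.1 v)}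
  zero_mem' := ⟨(DerEnd L).zero_mem,
    by intro u; refine Derivation.ext fun f => ?_; simp [Derivation.commutator_apply], by intro u v; simp⟩
  add_mem' := by
    rintro D D' ⟨h1, h2, h3⟩ ⟨h1', h2', h3'⟩
    refine ⟨(DerEnd L).add_mem h1 h1', fun u => ?_, fun u v => ?_⟩
    · rw [Prod.fst_add, Prod.snd_add, LinearMap.add_apply, map_add, ← h2, ← h2']
      refine Derivation.ext fun f => ?_
      simp only [Derivation.commutator_apply, Derivation.add_apply, map_add]
      abel
    · simp only [Prod.fst_add, LinearMap.add_apply, map_add, h3, h3']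
      abel
  smul_mem' := by
    rintro c D ⟨h1, h2, h3⟩
    refine ⟨?_, fun u => ?_, fun u v => ?_⟩
    · have : c • D = (algebraMap 𝕂 (SmoothFn 𝕂 m M) c) • D := by
        refine Prod.ext ?_ ?_
        · ext u
          simp
        · ext f
          simp
      rw [this]
      exact (DerEnd L).smul_mem _ h1
    · have : 𝓛.anchor (c • D.1 u) = c • 𝓛.anchor (D.1 u) :=
        LinearMap.map_smul_of_tower _ _ _
      rw [Prod.smul_fst, Prod.smul_snd, LinearMap.smul_apply, this, ← h2]
      refine Derivation.ext fun f => ?_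
      simp only [Derivation.commutator_apply, Derivation.smul_apply, Derivation.map_smul, smul_sub]
    · simp only [Prod.smul_fst, LinearMap.smul_apply, map_smul, h3, smul_add]
  lie_mem' := by
    rintro D D' ⟨h1, h2, h3⟩ ⟨h1', h2', h3'⟩
    refine ⟨fun f u => ?_, fun u => ?_, fun u v => ?_⟩
    · have e : ∀ (f : SmoothFn 𝕂 m M) (u : Sec L),
          D.1 (f • u) = D.2 f • u + f • D.1 u := h1
      have e' : ∀ (f : SmoothFn 𝕂 m M) (u : Sec L),
          D'.1 (f • u) = D'.2 f • u + f • D'.1 u := h1'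
      change D.1 (D'.1 (f • u)) - D'.1 (D.1 (f • u)) =
        (D.2 (D'.2 f) - D'.2 (D.2 f)) • u + f • (D.1 (D'.1 u) - D'.1 (D.1 u))
      simp only [e, e', map_add, sub_smul, smul_sub]
      abel
    · change ⁅⁅D.2, D'.2⁆, 𝓛.anchor u⁆ = 𝓛.anchor (D.1 (D'.1 u) - D'.1 (D.1 u))
      rw [map_sub, ← h2, ← h2', ← h2', ← h2]
      refine Derivation.ext fun f => ?_
      simp only [Derivation.commutator_apply, Derivation.sub_apply, map_sub]
      abel
    · change D.1 (D'.1 _) - D'.1 (D.1 _) =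
        𝓛.bracket (D.1 (D'.1 u) - D'.1 (D.1 u)) v + 𝓛.bracket u (D.1 (D'.1 v) - D'.1 (D.1 v))
      simp only [h3, h3', map_add, map_sub, LinearMap.sub_apply]
      abel

/-- A derivation of the Lie algebroid is in particular a derivative endomorphism. -/
def toDerEnd {L : VBundle.{uM, uF, uE} 𝕂 m M} {𝓛 : LieAlgebroid L} (δ : Der 𝓛) : DerEnd L :=
  ⟨δ.1, δ.2.1⟩

/-! ### Forms, shuffles -/

/-- `Ω_A^k` for `N = C^∞(M, 𝕂)` and `Ω_A^k(B) = Γ(Λ^k A^∨ ⊗ B)` for `N = Γ(B)`: alternating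
`C^∞(M, 𝕂)`-multilinear maps `Γ(A)^k → N`. -/
abbrev Form (A : VBundle.{uM, uF, uE} 𝕂 m M) (N : Type*) [AddCommGroup N]
    [Module (SmoothFn 𝕂 m M) N] (k : ℕ) : Type _ :=
  (Sec A) [⋀^Fin k]→ₗ[SmoothFn 𝕂 m M] N

/-- The wedge product `η ∧ η` of forms and the action `η · X` of `Ω_A` on `Ω_A(B)`. -/
def Form.wedge {A : VBundle.{uM, uF, uE} 𝕂 m M} {N : Type*} [AddCommGroup N]
    [Module (SmoothFn 𝕂 m M) N] {k p : ℕ} (η : Form A (SmoothFn 𝕂 m M) k) (X : Form A N p) :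
    Form A N (k + p) :=
  ((TensorProduct.lid (SmoothFn 𝕂 m M) N).toLinearMap.compAlternatingMap
    (η.domCoprod X)).domDomCongr finSumFinEquiv

/-- `X(x, a₂, …, aₖ)` for a `k`-form `X`; a `0`-form has no argument to fill, and gives zero. -/
def Form.insert {A : VBundle.{uM, uF, uE} 𝕂 m M} {N : Type*} [AddCommGroup N]
    [Module (SmoothFn 𝕂 m M) N] : ∀ {k : ℕ}, Form A N k → Sec A → (Fin (k - 1) → Sec A) → N
  | 0, _, _, _ => 0
  | _ + 1, X, x, a => X (Fin.cons x a)

end Bundles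

section Shuffles

/-- The `(i, j)`-shuffles. -/
def Sh2 (i j : ℕ) : Finset (Equiv.Perm (Fin (i + j))) :=
  open scoped Classical in
  Finset.univ.filter fun σ =>
    StrictMono (fun t : Fin i => σ (Fin.castAdd j t)) ∧
    StrictMono (fun t : Fin j => σ (Fin.natAdd i t))

/-- The `(i, j, k)`-shuffles. -/
def Sh3 (i j k : ℕ) : Finset (Equiv.Perm (Fin (i + j + k))) :=
  open scoped Classical in
  Finset.univ.filter fun σ =>
    StrictMono (fun t : Fin i => σ (Fin.castAdd k (Fin.castAdd j t))) ∧
    StrictMono (fun t : Fin j => σ (Fin.castAdd k (Fin.natAdd i t))) ∧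
    StrictMono (fun t : Fin k => σ (Fin.natAdd (i + j) t))

/-- `∑_{σ ∈ Sh(i,j)} sgn(σ) T((a_{σ(1)}, …, a_{σ(i)}), (a_{σ(i+1)}, …, a_{σ(i+j)}))`, for a sequence
`a` of length `n = i + j`. -/
def shuffleSum2 {G N : Type*} [AddCommGroup N] (i j : ℕ) {n : ℕ} (a : Fin n → G)
    (T : (Fin i → G) → (Fin j → G) → N) : N :=
  if h : i + j = n then
    ∑ σ ∈ Sh2 i j, Equiv.Perm.sign σ •
      T (fun t => a (Fin.cast h (σ (Fin.castAdd j t))))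
        (fun t => a (Fin.cast h (σ (Fin.natAdd i t))))
  else 0

/-- The analogous sum over `(i, j, k)`-shuffles, for a sequence `a` of length `n = i + j + k`. -/
def shuffleSum3 {G N : Type*} [AddCommGroup N] (i j k : ℕ) {n : ℕ} (a : Fin n → G)
    (T : (Fin i → G) → (Fin j → G) → (Fin k → G) → N) : N :=
  if h : i + j + k = n then
    ∑ σ ∈ Sh3 i j k, Equiv.Perm.sign σ •
      T (fun t => a (Fin.cast h (σ (Fin.castAdd k (Fin.castAdd j t)))))
        (fun t => a (Fin.cast h (σ (Fin.castAdd k (Fin.natAdd i t)))))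
        (fun t => a (Fin.cast h (σ (Fin.natAdd (i + j) t))))
  else 0

end Shuffles

/-! ### The `L_{≤3}` algebra `Ω_A(B)` and the action maps of `Der(L)` -/

section Main

variable {𝕂 : Type} [RCLike 𝕂] {m : ℕ} {M : Type uM} [TopologicalSpace M]
  [ChartedSpace (EuclideanSpace ℝ (Fin m)) M] {L A B : VBundle.{uM, uF, uE} 𝕂 m M}
  {P : LiePair L A} (S : Splitting P B)

/-- The Bott connection `∇_a b = pr_B [a, b]`. -/
def Splitting.nabla (a : Sec A) (b : Sec B) : Sec B :=
  S.prB.sec (P.algL.bracket (P.incl.sec a) (S.inclB.sec b))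

/-- `ð_b a = pr_A [b, a]`. -/
def Splitting.eth (b : Sec B) (a : Sec A) : Sec A :=
  S.prA.sec (P.algL.bracket (S.inclB.sec b) (P.incl.sec a))

/-- `[b, b']_B = pr_B [b, b']`. -/
def Splitting.brB (b b' : Sec B) : Sec B :=
  S.prB.sec (P.algL.bracket (S.inclB.sec b) (S.inclB.sec b'))

/-- `β(b, b') = pr_A [b, b']`. -/
def Splitting.beta (b b' : Sec B) : Sec A :=
  S.prA.sec (P.algL.bracket (S.inclB.sec b) (S.inclB.sec b'))

/-- `∑_{i<j} (-1)^{i+j} X([a_i, a_j], a_1, …, â_i, …, â_j, …, a_{k+1})`. -/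
def bracketSum {A : VBundle.{uM, uF, uE} 𝕂 m M} (𝓐 : LieAlgebroid A) {N : Type*} [AddCommGroup N]
    [Module (SmoothFn 𝕂 m M) N] : ∀ {k : ℕ}, Form A N k → (Fin (k + 1) → Sec A) → N
  | 0, _, _ => 0
  | k + 1, X, a => ∑ j : Fin (k + 2), ∑ i : Fin (k + 1),
      if i.castSucc < j then
        ((-1 : ℤ) ^ ((i : ℕ) + (j : ℕ))) •
          X (Fin.cons (𝓐.bracket (a i.castSucc) (a j)) (i.removeNth (j.removeNth a)))
      else 0

/-- The homogeneous pieces `Ω_A^k(B)` of `Ω_A(B)`. -/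
abbrev OmegaB (_S : Splitting P B) (k : ℕ) : Type _ := Form A (Sec B) k

/-- The homogeneous pieces `Ω_A^k` of `Ω_A`. -/
abbrev OmegaA (_S : Splitting P B) (k : ℕ) : Type _ := Form A (SmoothFn 𝕂 m M) k

/-- The brackets of the `L_{≤3}` algebra `Ω_A(B)`: maps with values in forms that are given by the
explicit formulas. (Terms that would contain a form with `-1` remaining arguments are zero.) -/
structure Brackets where
  /-- the unary bracket `d_A^Bott` -/
  d : ∀ k, OmegaB S k → OmegaB S (k + 1)
  /-- the binary bracket -/
  br2 : ∀ p q, OmegaB S p → OmegaB S q → OmegaB S (p + q)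
  /-- the ternary bracket -/
  br3 : ∀ p q r, OmegaB S p → OmegaB S q → OmegaB S r → OmegaB S (p + q + r - 1)
  d_apply : ∀ k (X : OmegaB S k) (a : Fin (k + 1) → Sec A),
    d k X a = (∑ i : Fin (k + 1), ((-1 : ℤ) ^ (i : ℕ)) • S.nabla (a i) (X (i.removeNth a)))
      + bracketSum P.algA X a
  br2_apply : ∀ p q (X : OmegaB S p) (Y : OmegaB S q) (a : Fin (p + q) → Sec A),
    br2 p q X Y a =
      shuffleSum2 p q a (fun u v =>
        ∑ i : Fin p, X (Function.update u i (S.eth (Y v) (u i))))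
      - shuffleSum2 p q a (fun u v =>
        ∑ j : Fin q, Y (Function.update v j (S.eth (X u) (v j))))
      + shuffleSum2 p q a (fun u v => S.brB (X u) (Y v))
  br3_apply : ∀ p q r (X : OmegaB S p) (Y : OmegaB S q) (Z : OmegaB S r)
      (a : Fin (p + q + r - 1) → Sec A),
    br3 p q r X Y Z a =
      ((-1 : ℤ) ^ (p + q + 1)) • shuffleSum3 p q (r - 1) a (fun u v w =>
        Form.insert Z (S.beta (X u) (Y v)) w)
      + ((-1 : ℤ) ^ p) • shuffleSum3 p (q - 1) r a (fun u v w =>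
        Form.insert Y (S.beta (X u) (Z w)) v)
      - shuffleSum3 (p - 1) q r a (fun u v w =>
        Form.insert X (S.beta (Y v) (Z w)) u)

/-- The action maps, given by explicit formulas, on all derivative endomorphisms `δ` of `Γ(L)`.
(Terms that would contain a form with `-1` remaining arguments are zero.) -/
structure ActionMaps where
  /-- the 0-action `κ` -/
  kappa : DerEnd L → OmegaB S 1
  /-- the 1-action `δ ▷ X` -/
  act1 : ∀ k, DerEnd L → OmegaB S k → OmegaB S k
  /-- the 2-action `δ ▷ (X, Y)` -/
  act2 : ∀ i j, DerEnd L → OmegaB S i → OmegaB S j → OmegaB S (i + j - 1)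
  kappa_apply : ∀ (δ : DerEnd L) (a : Fin 1 → Sec A),
    kappa δ a = -S.prB.sec (δ.1.1 (P.incl.sec (a 0)))
  act1_apply : ∀ k (δ : DerEnd L) (X : OmegaB S k) (a : Fin k → Sec A),
    act1 k δ X a =
      -(∑ j : Fin k, X (Function.update a j (S.prA.sec (δ.1.1 (P.incl.sec (a j))))))
      + S.prB.sec (δ.1.1 (S.inclB.sec (X a)))
  act2_apply : ∀ i j (δ : DerEnd L) (X : OmegaB S i) (Y : OmegaB S j)
      (a : Fin (i + j - 1) → Sec A),
    act2 i j δ X Y a =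
      ((-1 : ℤ) ^ (i + 1)) • shuffleSum2 i (j - 1) a (fun u v =>
        Form.insert Y (S.prA.sec (δ.1.1 (S.inclB.sec (X u)))) v)
      + shuffleSum2 (i - 1) j a (fun u v =>
        Form.insert X (S.prA.sec (δ.1.1 (S.inclB.sec (Y v)))) u)

/-- The operators `ϱ₁(δ)` and `ϱ₂(δ, X)` on `Ω_A`, given by explicit formulas. -/
structure RhoMaps where
  /-- `ϱ₁(δ)`, of degree `0` -/
  rho1 : ∀ k, DerEnd L → OmegaA S k → OmegaA S k
  /-- `ϱ₂(δ, X)`, of degree `|X| - 1` -/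
  rho2 : ∀ i k, DerEnd L → OmegaB S i → OmegaA S k → OmegaA S (i + k - 1)
  rho1_apply : ∀ k (δ : DerEnd L) (η : OmegaA S k) (a : Fin k → Sec A),
    rho1 k δ η a =
      δ.1.2 (η a) - ∑ j : Fin k, η (Function.update a j (S.prA.sec (δ.1.1 (P.incl.sec (a j)))))
  rho2_apply : ∀ i k (δ : DerEnd L) (X : OmegaB S i) (η : OmegaA S k)
      (a : Fin (i + k - 1) → Sec A),
    rho2 i k δ X η a =
      ((-1 : ℤ) ^ (i + 1)) • shuffleSum2 i (k - 1) a (fun u v =>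
        Form.insert η (S.prA.sec (δ.1.1 (S.inclB.sec (X u)))) v)

/-- A homogeneous element of `Ω_A(B)`, together with its degree. -/
def hom {S : Splitting P B} {k : ℕ} (X : OmegaB S k) : Σ k, OmegaB S k := ⟨k, X⟩

/-- The inclusion `Ω_A^k(B) → Ω_A(B) = ⨁ k, Ω_A^k(B)`. -/
def inB {S : Splitting P B} {k : ℕ} (X : OmegaB S k) : ⨁ k, OmegaB S k :=
  DirectSum.lof 𝕂 ℕ (OmegaB S) k X

/-- The inclusion `Ω_A^k → Ω_A = ⨁ k, Ω_A^k`. -/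
def inA {S : Splitting P B} {k : ℕ} (η : OmegaA S k) : ⨁ k, OmegaA S k :=
  DirectSum.lof 𝕂 ℕ (OmegaA S) k η

/-- `S(𝔤[1])` for `𝔤 = Ω_A(B)`. -/
abbrev SymOmega : Type _ := GradedSym.SymShift 𝕂 (OmegaB S) (fun k : ℕ => (k : ℤ))

/-- The codifferential `Q` of `S(Ω_A(B)[1])` encodes the unary, binary and ternary brackets of
`b`, all the other brackets being zero. -/
def Encodes (b : Brackets S) (Q : Module.End 𝕂 (SymOmega S)) : Prop :=
  (∀ p (X : OmegaB S p), GradedSym.bracketOf Q [hom X] = inB (b.d p X)) ∧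
  (∀ p q (X : OmegaB S p) (Y : OmegaB S q),
    GradedSym.bracketOf Q [hom X, hom Y] = inB (b.br2 p q X Y)) ∧
  (∀ p q r (X : OmegaB S p) (Y : OmegaB S q) (Z : OmegaB S r),
    GradedSym.bracketOf Q [hom X, hom Y, hom Z] = inB (b.br3 p q r X Y Z)) ∧
  (∀ l : List (Σ k, OmegaB S k), 4 ≤ l.length → GradedSym.bracketOf Q l = 0)

/-- The maps `κ`, `δ ▷ X`, `δ ▷ (X, Y)` are the action maps of `ψ`, all the higher ones being
zero. -/
def HasActionMaps (μ : ActionMaps S)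
    (ψ : Der P.algL →ₗ[𝕂] Module.End 𝕂 (SymOmega S)) : Prop :=
  (∀ δ, GradedSym.actionOf (ψ δ) [] = inB (μ.kappa (toDerEnd δ))) ∧
  (∀ δ k (X : OmegaB S k), GradedSym.actionOf (ψ δ) [hom X] = inB (μ.act1 k (toDerEnd δ) X)) ∧
  (∀ δ i j (X : OmegaB S i) (Y : OmegaB S j),
    GradedSym.actionOf (ψ δ) [hom X, hom Y] = inB (μ.act2 i j (toDerEnd δ) X Y)) ∧
  (∀ δ (l : List (Σ k, OmegaB S k)), 3 ≤ l.length → GradedSym.actionOf (ψ δ) l = 0)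

end Main

end LieAlgd

end

noncomputable section

namespace GradedSym

/-! ### Graded commutators in an associative algebra -/

section SuperCommutator

variable {𝕂 : Type*} [Field 𝕂] {E : Type*} [Ring E] [Algebra 𝕂 E]

/-! The proof is Voronov's derived bracket construction for the multiderivations of `L`. A
multiderivation with `k` arguments is extended to a coderivation, of degree `k - 1`, of the exterior
algebra `Λ` of `Γ(L)` over `𝕂`. These operators are closed under the graded commutator
(`IsMultiDer.superComm`), so their identities can be checked in an associative algebra. The Lie
bracket becomes an operator `m` (`brOp`) with `m² = 0`, by Jacobi; a derivation `δ` becomes an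
operator `derOp δ` that commutes with `m`.

A form on `A` with values in `B`, composed with the projection `L → A` and the inclusion `B → L`, is
also a multiderivation (`hatB`). Forms read only `A`-components and return vectors of `B`, so they
span an abelian subalgebra `V` (`superComm_hatB_hatB`). Conversely, restricting a multiderivation to
`A` and projecting its values to `B` gives a form: it is `R`-multilinear because the symbol terms
lie in `A` (`comp_update_smul`). The kernel of this projection `P` consists of the multiderivations
that preserve the exterior algebra of `A` (`preserves_of_comp_eq_zero`), hence is a subalgebra.

For such a graded Lie algebra `W = V ⊕ ker P`, the module induced from the trivial module of `ker P`
has `S(V)` as a model. The action is given by `x · 1 = P x` and `x · (v y) = [x, v] · y ± v (x ·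
y)`. It is by coderivations (`isCoderivation_act`), it respects brackets (`act_superComm`), and its
corestrictions are the derived brackets `P[⋯[x, v₁], ⋯, vₙ]` (`pr1_act_prodOf`). Take `Q` to be the
action of `-m` and `ψ(δ)` that of `derOp δ`. Then `Q² = 0`, `[Q, ψ(δ)] = 0` and compatibility with
commutators follow from the corresponding facts in `W`; `Q 1 = 0` holds because `A` is a
subalgebroid, and the 0-action of `δ` measures how far `δ` is from preserving `A`.

For the formulas, expand `[⋯[D, X₁], ⋯, Xₙ]`. After projection only the terms with at most one form
to the left of `D` survive (`q_ιInv_superComm_hatB`, `extP_superComm_hatB`). As `m` takes two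
arguments and `δ` one, at most three, respectively two, forms can occur. The surviving terms are
sums over shuffles, computed by the list recursion `shuf`, which `shuffleSum3_eq_shuf` identifies
with the sums over permutations. The sign `(-1)^(k(k+1)/2)` in the embedding of `k`-forms, and the
sign of `-m`, turn the Koszul signs into those of the décalage.

The Leibniz rules in (c) follow from coassociativity and graded commutativity of `shuf`. The
operators `ϱ₁` and `ϱ₂` are well defined because they are components of the same action maps for `L
⊕ R = A ⊕ (B ⊕ R)`. -/

theorem negOne_zpow_add (m n : ℤ) : (-1 : 𝕂) ^ (m + n) = (-1) ^ m * (-1) ^ n :=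
  zpow_add₀ (by simp) m n

variable (𝕂) in
/-- The graded commutator `x y - (-1)^{nk} y x` of `x` of degree `n` and `y` of degree `k` in an
associative algebra. -/
def superComm (n k : ℤ) : E →ₗ[𝕂] E →ₗ[𝕂] E :=
  LinearMap.mul 𝕂 E - ((-1 : 𝕂) ^ (n * k)) • (LinearMap.mul 𝕂 E).flip

theorem superComm_apply (n k : ℤ) (x y : E) :
    superComm 𝕂 n k x y = x * y - ((-1 : 𝕂) ^ (n * k)) • (y * x) := rfl

theorem superComm_swap (n k : ℤ) (x y : E) :
    superComm 𝕂 n k x y = -((-1 : 𝕂) ^ (n * k)) • superComm 𝕂 k n y x := by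
  simp only [superComm_apply, mul_comm k n, smul_sub, smul_smul, neg_mul, negOne_zpow_sq]
  module

/-- The graded Jacobi identity. -/
theorem superComm_jacobi (n k d : ℤ) (x y z : E) :
    superComm 𝕂 (n + k) d (superComm 𝕂 n k x y) z =
      superComm 𝕂 n (k + d) x (superComm 𝕂 k d y z) +
        ((-1 : 𝕂) ^ (k * d)) • superComm 𝕂 (n + d) k (superComm 𝕂 n d x z) y := by
  simp only [superComm_apply, mul_add, add_mul, negOne_zpow_add, mul_sub, sub_mul, smul_sub,
    mul_smul_comm, smul_mul_assoc, smul_smul, mul_assoc, mul_comm d k]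
  have h := negOne_zpow_sq 𝕂 (k * d)
  linear_combination (norm := module) ((-1 : 𝕂) ^ (n * k) * h) • (y * (x * z)) -
    ((-1 : 𝕂) ^ (n * k) * (-1 : 𝕂) ^ (n * d) * h) • (y * (z * x))

end SuperCommutator

/-! ### The symmetric coalgebra: induction on factors, degrees, counit -/

section Induction

variable {𝕂 : Type*} [Field 𝕂] {ι : Type*} [DecidableEq ι]
  {V : ι → Type*} [∀ i, AddCommGroup (V i)] [∀ i, Module 𝕂 (V i)] {deg : ι → ℤ}

variable (𝕂 V deg) in
/-- The quotient map from the tensor algebra. -/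
def Sym.mk : TensorAlgebra 𝕂 (⨁ i, V i) →ₐ[𝕂] Sym 𝕂 V deg := RingQuot.mkAlgHom 𝕂 (Rel 𝕂 V deg)

/-- Induction on the number of factors. -/
theorem Sym.induction {C : Sym 𝕂 V deg → Prop} (one : C 1)
    (add : ∀ x y, C x → C y → C (x + y)) (smul : ∀ (c : 𝕂) x, C x → C (c • x))
    (gen_mul : ∀ i (v : V i) x, C x → C (gen 𝕂 V deg i v * x)) (x : Sym 𝕂 V deg) : C x := by
  obtain ⟨t, rfl⟩ : ∃ t, Sym.mk 𝕂 V deg t = x := RingQuot.mkAlgHom_surjective 𝕂 (Rel 𝕂 V deg) x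
  have key : ∀ x, C x → C (Sym.mk 𝕂 V deg t * x) := by
    induction t using TensorAlgebra.induction with
    | algebraMap r =>
      intro x hx
      rw [AlgHom.commutes, ← Algebra.smul_def]
      exact smul r x hx
    | ι v =>
      induction v using DirectSum.induction_on with
      | zero =>
        intro x hx
        have := smul 0 x hx
        rw [zero_smul] at this
        rwa [map_zero, map_zero, zero_mul]
      | of i v => exact fun x hx => gen_mul i v x hx
      | add a b ha hb =>
        intro x hx
        rw [map_add, map_add, add_mul]
        exact add _ _ (ha x hx) (hb x hx)
    | mul a b ha hb =>
      intro x hx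
      rw [map_mul, mul_assoc]
      exact ha _ (hb x hx)
    | add a b ha hb =>
      intro x hx
      rw [map_add, add_mul]
      exact add _ _ (ha x hx) (hb x hx)
  have := key 1 one
  rwa [mul_one] at this

theorem koszul_koszul (m n : ℤ) (x : Sym 𝕂 V deg) :
    koszul 𝕂 V deg m (koszul 𝕂 V deg n x) = koszul 𝕂 V deg (m + n) x := by
  have h : (koszul 𝕂 V deg m).comp (koszul 𝕂 V deg n) = koszul 𝕂 V deg (m + n) := by
    refine algHom_ext fun i v => ?_
    simp only [AlgHom.comp_apply, koszul_gen, map_smul, smul_smul, add_mul, negOne_zpow_add]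
    rw [mul_comm]
  exact DFunLike.congr_fun h x

theorem prodOf_nil : prodOf (𝕂 := 𝕂) (V := V) deg [] = 1 := rfl

theorem prodOf_cons (v : Σ i, V i) (l : List (Σ i, V i)) :
    prodOf (𝕂 := 𝕂) deg (v :: l) = gen 𝕂 V deg v.1 v.2 * prodOf deg l := by
  simp [prodOf]

theorem gen_mem_degPart (i : ι) (v : V i) : gen 𝕂 V deg i v ∈ degPart 𝕂 V deg (deg i) :=
  Submodule.subset_span ⟨[⟨i, v⟩], by simp [prodOf], by simp⟩

theorem gen_mul_mem_degPart (i : ι) (v : V i) {d : ℤ} {x : Sym 𝕂 V deg}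
    (hx : x ∈ degPart 𝕂 V deg d) : gen 𝕂 V deg i v * x ∈ degPart 𝕂 V deg (d + deg i) := by
  refine Submodule.span_induction (p := fun x _ => gen 𝕂 V deg i v * x ∈
    degPart 𝕂 V deg (d + deg i)) ?_ ?_ ?_ ?_ hx
  · rintro _ ⟨l, rfl, rfl⟩
    exact Submodule.subset_span ⟨⟨i, v⟩ :: l, (prodOf_cons ⟨i, v⟩ l).symm, by simp [add_comm]⟩
  · rw [mul_zero]; exact zero_mem _
  · intro x y _ _ hx hy; rw [mul_add]; exact add_mem hx hy
  · intro c x _ hx; rw [mul_smul_comm]; exact Submodule.smul_mem _ _ hx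

variable (𝕂 V deg) in
/-- The counit of `S(V)`. -/
def counit : Sym 𝕂 V deg →ₐ[𝕂] 𝕂 :=
  lift (fun _ => 0) (by intro i j v w; simp)

theorem counit_gen (i : ι) (v : V i) : counit 𝕂 V deg (gen 𝕂 V deg i v) = 0 := by
  simp [counit, lift_gen]

/-- The projection `pr1` vanishes on products of two generators, so only the constant term of `x`
contributes. -/
theorem pr1_gen_mul (i : ι) (v : V i) (x : Sym 𝕂 V deg) :
    pr1 𝕂 V deg (gen 𝕂 V deg i v * x) = counit 𝕂 V deg x • DirectSum.lof 𝕂 ι V i v := by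
  refine Sym.induction (C := fun x => pr1 𝕂 V deg (gen 𝕂 V deg i v * x) =
    counit 𝕂 V deg x • DirectSum.lof 𝕂 ι V i v) ?_ ?_ ?_ ?_ x
  · rw [mul_one, pr1_gen, map_one, one_smul]
  · intro x y hx hy; rw [mul_add, map_add, map_add, add_smul, hx, hy]
  · intro c x hx; rw [mul_smul_comm, map_smul, map_smul, hx, smul_assoc]
  · intro j w x _; rw [pr1_gen_mul_gen, map_mul, counit_gen, zero_mul, zero_smul]

end Induction

/-! ### The action on the induced module, and derived brackets -/

section Induced

variable (𝕂 : Type*) [Field 𝕂] {ι : Type*} [DecidableEq ι]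
  (V : ι → Type*) [∀ i, AddCommGroup (V i)] [∀ i, Module 𝕂 (V i)] (deg : ι → ℤ)
  (E : Type*) [Ring E] [Algebra 𝕂 E]

/-- A graded Lie algebra `W` of elements of an associative algebra `E`, with an embedded abelian
graded Lie algebra `V` and a projection `P : W → V` whose kernel is closed under brackets. -/
structure DerivedBracketData where
  /-- the abelian subalgebra -/
  emb : ∀ i, V i →ₗ[𝕂] E
  /-- the projection of the elements of degree `n` -/
  proj : ℤ → E →ₗ[𝕂] ⨁ i, V i
  /-- the elements of degree `n` -/
  W : ℤ → Set E
  emb_comm : ∀ i j (v : V i) (w : V j),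
    emb i v * emb j w = ((-1 : 𝕂) ^ (deg i * deg j)) • (emb j w * emb i v)
  superComm_emb : ∀ {n x}, x ∈ W n → ∀ i (v : V i),
    superComm 𝕂 n (deg i) x (emb i v) ∈ W (n + deg i)
  proj_homogeneous : ∀ {n x}, x ∈ W n → ∃ i, ∃ v : V i,
    proj n x = DirectSum.lof 𝕂 ι V i v ∧ (deg i = n ∨ v = 0)
  -- This is what `P[x - P x, y - P y] = 0` becomes when the elements of `V` commute, i.e. closure
  -- of `ker P` under brackets. The alternatives `deg i = n ∨ v = 0` are there because the zero
  -- vector may come with an index of the wrong degree.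
  proj_superComm : ∀ {n k x y}, x ∈ W n → y ∈ W k → ∀ i j (v : V i) (w : V j),
    proj n x = DirectSum.lof 𝕂 ι V i v → (deg i = n ∨ v = 0) →
    proj k y = DirectSum.lof 𝕂 ι V j w → (deg j = k ∨ w = 0) →
    proj (n + k) (superComm 𝕂 n k x y) =
      proj (n + deg j) (superComm 𝕂 n (deg j) x (emb j w)) -
        ((-1 : 𝕂) ^ (n * k)) • proj (k + deg i) (superComm 𝕂 k (deg i) y (emb i v))

namespace DerivedBracketData

variable {𝕂 V deg E} (D : DerivedBracketData 𝕂 V deg E)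

/-- The operators on `ℤ → Hom(E, S(V))` that generate the action of `S(V)`. -/
def mulOp (i : ι) : V i →ₗ[𝕂] Module.End 𝕂 (ℤ → E →ₗ[𝕂] Sym 𝕂 V deg) where
  toFun v :=
    { toFun := fun F n => F (n + deg i) ∘ₗ (superComm 𝕂 n (deg i)).flip (D.emb i v) +
        ((-1 : 𝕂) ^ (n * deg i)) • LinearMap.mulLeft 𝕂 (gen 𝕂 V deg i v) ∘ₗ F n
      map_add' := fun F G => by
        ext n x
        simp only [Pi.add_apply, LinearMap.add_apply, LinearMap.comp_apply, LinearMap.smul_apply,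
          map_add, smul_add]
        abel
      map_smul' := fun c F => by
        ext n x
        simp only [Pi.smul_apply, LinearMap.add_apply, LinearMap.comp_apply, LinearMap.smul_apply,
          map_smul, smul_add, RingHom.id_apply, smul_comm c] }
  map_add' v w := by
    ext F n x
    simp only [LinearMap.coe_mk, AddHom.coe_mk, LinearMap.add_apply, LinearMap.comp_apply,
      LinearMap.smul_apply, map_add, smul_add, Pi.add_apply, LinearMap.mulLeft_apply, add_mul]
    abel
  map_smul' c v := by
    ext F n x
    simp only [LinearMap.coe_mk, AddHom.coe_mk, LinearMap.add_apply, LinearMap.comp_apply,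
      LinearMap.smul_apply, map_smul, smul_add, Pi.smul_apply, LinearMap.mulLeft_apply,
      RingHom.id_apply, smul_mul_assoc, smul_comm c]

/-- Read `F n x` as the action of `x`, in degree `n`, on some `y`; then `mulOp i v F` is the action
on `v y`. The degree is a separate variable because `E` carries no grading. -/
theorem mulOp_apply (i : ι) (v : V i) (F : ℤ → E →ₗ[𝕂] Sym 𝕂 V deg) (n : ℤ) (x : E) :
    D.mulOp i v F n x = F (n + deg i) (superComm 𝕂 n (deg i) x (D.emb i v)) +
      ((-1 : 𝕂) ^ (n * deg i)) • (gen 𝕂 V deg i v * F n x) := rfl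

/-- Graded Jacobi with `[v, w] = 0`. This makes the recursion for the action compatible with the
relations of `S(V)`. -/
theorem superComm_emb_comm (n : ℤ) (x : E) (i j : ι) (v : V i) (w : V j) :
    superComm 𝕂 (n + deg i) (deg j) (superComm 𝕂 n (deg i) x (D.emb i v)) (D.emb j w) =
      ((-1 : 𝕂) ^ (deg i * deg j)) •
        superComm 𝕂 (n + deg j) (deg i) (superComm 𝕂 n (deg j) x (D.emb j w)) (D.emb i v) := by
  have h : superComm 𝕂 (deg i) (deg j) (D.emb i v) (D.emb j w) = 0 := by
    rw [superComm_apply, D.emb_comm, sub_self]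
  rw [superComm_jacobi, h, map_zero, zero_add]

theorem mulOp_comm (i j : ι) (v : V i) (w : V j) :
    D.mulOp i v * D.mulOp j w =
      ((-1 : 𝕂) ^ (deg i * deg j)) • (D.mulOp j w * D.mulOp i v) := by
  ext F n x
  simp only [Module.End.mul_apply, LinearMap.smul_apply, Pi.smul_apply, mulOp_apply,
    D.superComm_emb_comm n x i j v w, map_smul, smul_add, mul_add, mul_smul_comm, add_mul,
    negOne_zpow_add, smul_smul, ← mul_assoc (gen 𝕂 V deg i v), gen_mul_gen 𝕂 i j v w,
    smul_mul_assoc, mul_comm (deg j) (deg i), ← mul_assoc (gen 𝕂 V deg j w)]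
  rw [add_right_comm n]
  have h := negOne_zpow_sq 𝕂 (deg i * deg j)
  linear_combination (norm := module) -((-1 : 𝕂) ^ (n * deg i) * h) •
    (gen 𝕂 V deg i v * F (n + deg j) (superComm 𝕂 n (deg j) x (D.emb j w)))

/-- The action of `S(V)` on `ℤ → Hom(E, S(V))`. -/
def mulHom : Sym 𝕂 V deg →ₐ[𝕂] Module.End 𝕂 (ℤ → E →ₗ[𝕂] Sym 𝕂 V deg) :=
  lift (R := Module.End 𝕂 (ℤ → E →ₗ[𝕂] Sym 𝕂 V deg)) D.mulOp D.mulOp_comm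

/-- The action of elements of degree `n` of `E` on `S(V)`, for the elements of `W` the action on the
induced module `U(W) ⊗_{U(ker P)} 𝕂 ≅ S(V)`. -/
def act (n : ℤ) : E →ₗ[𝕂] Module.End 𝕂 (Sym 𝕂 V deg) :=
  LinearMap.mk₂ 𝕂 (fun x y => D.mulHom y
      (fun n => DirectSum.toModule 𝕂 ι _ (gen 𝕂 V deg) ∘ₗ D.proj n) n x)
    (fun _ _ _ => map_add _ _ _) (fun _ _ _ => map_smul _ _ _)
    (fun x y z => by rw [map_add]; rfl) (fun c x y => by rw [map_smul]; rfl)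

theorem act_one (n : ℤ) (x : E) :
    D.act n x 1 = DirectSum.toModule 𝕂 ι _ (gen 𝕂 V deg) (D.proj n x) := by
  simp [act, mulHom]

theorem act_gen_mul (n : ℤ) (x : E) (i : ι) (v : V i) (y : Sym 𝕂 V deg) :
    D.act n x (gen 𝕂 V deg i v * y) =
      D.act (n + deg i) (superComm 𝕂 n (deg i) x (D.emb i v)) y +
        ((-1 : 𝕂) ^ (n * deg i)) • (gen 𝕂 V deg i v * D.act n x y) := by
  simp [act, mulHom, lift_gen, mulOp_apply]

theorem exists_act_one {n : ℤ} {x : E} (hx : x ∈ D.W n) : ∃ i, ∃ v : V i,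
    D.act n x 1 = gen 𝕂 V deg i v ∧ D.proj n x = DirectSum.lof 𝕂 ι V i v ∧
      (deg i = n ∨ v = 0) := by
  obtain ⟨i, v, h, h'⟩ := D.proj_homogeneous hx
  exact ⟨i, v, by rw [act_one, h, DirectSum.toModule_lof], h, h'⟩

/-- Since `1` is sent into `V`, constant terms never arise; hence a product `v (x · y)` has no
linear part. -/
theorem counit_act (n : ℤ) (x : E) (y : Sym 𝕂 V deg) : counit 𝕂 V deg (D.act n x y) = 0 := by
  revert n x
  refine Sym.induction (C := fun y => ∀ n x, counit 𝕂 V deg (D.act n x y) = 0) ?_ ?_ ?_ ?_ y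
  · intro n x
    rw [act_one]
    generalize D.proj n x = v
    induction v using DirectSum.induction_on with
    | zero => simp
    | of i v =>
      have : DirectSum.toModule 𝕂 ι _ (gen 𝕂 V deg) (DirectSum.of V i v) = gen 𝕂 V deg i v :=
        DirectSum.toModule_lof 𝕂 i v
      rw [this, counit_gen]
    | add a b ha hb => rw [map_add, map_add, ha, hb, add_zero]
  · intro y z hy hz n x; rw [map_add, map_add, hy, hz, add_zero]
  · intro c y hy n x; rw [map_smul, map_smul, hy, smul_zero]
  · intro i v y hy n x
    rw [act_gen_mul, map_add, map_smul, map_mul, counit_gen, zero_mul, hy, smul_zero, add_zero]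

/-- The iterated bracket `[⋯[[x, v₁], v₂], ⋯, vₖ]`. -/
def iterBracket (n : ℤ) (x : E) : List (Σ i, V i) → ℤ × E
  | [] => (n, x)
  | v :: l => iterBracket (n + deg v.1) (superComm 𝕂 n (deg v.1) x (D.emb v.1 v.2)) l

/-- Move `x` to the right through the factors. Each term in which a factor stays on the left has at
least two factors and is dropped by `pr1`; only the iterated bracket, acting on `1`, is left. -/
theorem pr1_act_prodOf (n : ℤ) (x : E) (l : List (Σ i, V i)) :
    pr1 𝕂 V deg (D.act n x (prodOf deg l)) =
      D.proj (D.iterBracket n x l).1 (D.iterBracket n x l).2 := by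
  induction l generalizing n x with
  | nil =>
    rw [prodOf_nil, act_one, iterBracket]
    generalize D.proj n x = v
    induction v using DirectSum.induction_on with
    | zero => simp
    | of i v =>
      have : DirectSum.toModule 𝕂 ι _ (gen 𝕂 V deg) (DirectSum.of V i v) = gen 𝕂 V deg i v :=
        DirectSum.toModule_lof 𝕂 i v
      rw [this, pr1_gen]
      rfl
    | add a b ha hb => rw [map_add, map_add, ha, hb]
  | cons v l ih =>
    rw [prodOf_cons, act_gen_mul, map_add, map_smul, pr1_gen_mul, counit_act, zero_smul, smul_zero,
      add_zero, ih, iterBracket]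

theorem act_mem_degPart {n : ℤ} {x : E} (hx : x ∈ D.W n) {d : ℤ} {y : Sym 𝕂 V deg}
    (hy : y ∈ degPart 𝕂 V deg d) : D.act n x y ∈ degPart 𝕂 V deg (d + n) := by
  refine Submodule.span_induction (p := fun y _ => D.act n x y ∈ degPart 𝕂 V deg (d + n))
    ?_ ?_ ?_ ?_ hy
  · rintro _ ⟨l, rfl, rfl⟩
    clear hy
    induction l generalizing n x with
    | nil =>
      obtain ⟨i, v, h, -, h'⟩ := D.exists_act_one hx
      rw [prodOf_nil, h]
      rcases h' with h' | h'
      · simpa [h'] using gen_mem_degPart (𝕂 := 𝕂) (deg := deg) i v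
      · rw [h', map_zero]; exact zero_mem _
    | cons v l ih =>
      rw [prodOf_cons, act_gen_mul]
      have h1 := ih (D.superComm_emb hx v.1 v.2)
      have h2 := gen_mul_mem_degPart v.1 v.2 (ih hx)
      simp only [List.map_cons, List.sum_cons]
      refine add_mem ?_ (Submodule.smul_mem _ _ ?_)
      · convert h1 using 2; ring
      · convert h2 using 2; ring
  · rw [map_zero]; exact zero_mem _
  · intro y z _ _ hy hz; rw [map_add]; exact add_mem hy hz
  · intro c y _ hy; rw [map_smul]; exact Submodule.smul_mem _ _ hy

theorem koszul_act {n : ℤ} {x : E} (hx : x ∈ D.W n) (d : ℤ) (y : Sym 𝕂 V deg) :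
    koszul 𝕂 V deg d (D.act n x y) =
      ((-1 : 𝕂) ^ (n * d)) • D.act n x (koszul 𝕂 V deg d y) := by
  revert n x
  refine Sym.induction (C := fun y => ∀ {n x}, x ∈ D.W n → koszul 𝕂 V deg d (D.act n x y) =
      ((-1 : 𝕂) ^ (n * d)) • D.act n x (koszul 𝕂 V deg d y)) ?_ ?_ ?_ ?_ y
  · intro n x hx
    obtain ⟨i, v, h, -, h'⟩ := D.exists_act_one hx
    rw [map_one (koszul 𝕂 V deg d), h, koszul_gen]
    rcases h' with h' | h'
    · rw [h', mul_comm]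
    · simp [h']
  · intro y z hy hz n x hx; simp only [map_add, hy hx, hz hx, smul_add]
  · intro c y hy n x hx; simp only [map_smul, hy hx, smul_comm c]
  · intro i v y hy n x hx
    rw [act_gen_mul, map_add, map_smul, map_mul, koszul_gen, hy hx, hy (D.superComm_emb hx i v),
      map_mul, koszul_gen, smul_mul_assoc, smul_mul_assoc, map_smul, act_gen_mul]
    simp only [smul_add, smul_smul, mul_smul_comm, add_mul, negOne_zpow_add,
      mul_comm d (deg i)]
    module

/-- The element `x · 1` is a vector of `V`, hence primitive, and both sides of the coLeibniz rule
satisfy the same recursion when a factor is added. -/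
theorem isCoderivation_act {n : ℤ} {x : E} (hx : x ∈ D.W n) :
    IsCoderivation n (D.act n x) := by
  refine ⟨fun d y hy => D.act_mem_degPart hx hy, LinearMap.ext fun y => ?_⟩
  revert n x
  refine Sym.induction (C := fun y => ∀ {n x}, x ∈ D.W n →
    (comul 𝕂 V deg ∘ₗ D.act n x) y = ((TensorProduct.map (D.act n x) LinearMap.id +
      TensorProduct.map (koszul 𝕂 V deg n).toLinearMap (D.act n x)) ∘ₗ comul 𝕂 V deg) y)
    ?_ ?_ ?_ ?_ y
  · intro n x hx
    obtain ⟨i, v, h, -, -⟩ := D.exists_act_one hx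
    simp [comul_one, h, comul_gen]
  · intro y z hy hz n x hx; rw [map_add, map_add, hy hx, hz hx]
  · intro c y hy n x hx; rw [map_smul, map_smul, hy hx]
  · intro i v y hy n x hx
    have h1 := hy hx
    have h2 := hy (D.superComm_emb hx i v)
    simp only [LinearMap.comp_apply] at h1 h2 ⊢
    rw [comul_gen_mul, act_gen_mul, map_add, map_smul, comul_gen_mul, h1, h2]
    generalize comul 𝕂 V deg y = t
    induction t using TensorProduct.induction_on with
    | zero => simp
    | add s t hs ht => simp only [map_add, smul_add] at hs ht ⊢; rw [← hs, ← ht]; abel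
    | tmul y z =>
      simp only [LinearMap.add_apply, TensorProduct.map_tmul, primMul_tmul, map_add,
        LinearMap.id_apply, AlgHom.toLinearMap_apply, act_gen_mul, D.koszul_act hx, map_mul,
        koszul_gen, koszul_koszul, TensorProduct.add_tmul, TensorProduct.tmul_add,
        smul_mul_assoc, TensorProduct.smul_tmul', TensorProduct.tmul_smul, smul_add, smul_smul,
        negOne_zpow_sq, one_smul]
      rw [add_comm (deg i) n]
      abel

/-- On `1` this is the axiom `proj_superComm`; the inductive step is the graded Jacobi identity for
`x`, `y` and the new factor. -/
theorem act_superComm {n k : ℤ} {x y : E} (hx : x ∈ D.W n) (hy : y ∈ D.W k) :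
    D.act (n + k) (superComm 𝕂 n k x y) = gradedBracket n k (D.act n x) (D.act k y) := by
  refine LinearMap.ext fun z => ?_
  revert n k x y
  refine Sym.induction (C := fun z => ∀ {n k x y}, x ∈ D.W n → y ∈ D.W k →
    D.act (n + k) (superComm 𝕂 n k x y) z = gradedBracket n k (D.act n x) (D.act k y) z)
    ?_ ?_ ?_ ?_ z
  · intro n k x y hx hy
    obtain ⟨i, v, h, hp, h'⟩ := D.exists_act_one hx
    obtain ⟨j, w, g, gp, g'⟩ := D.exists_act_one hy
    have e : ∀ {n : ℤ} {x : E} (j) (w : V j), D.act n x (gen 𝕂 V deg j w) =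
      D.act (n + deg j) (superComm 𝕂 n (deg j) x (D.emb j w)) 1 +
        ((-1 : 𝕂) ^ (n * deg j)) • (gen 𝕂 V deg j w * D.act n x 1) := by
      intro n x j w
      have := D.act_gen_mul n x j w 1
      rwa [mul_one] at this
    simp only [gradedBracket, LinearMap.sub_apply, LinearMap.comp_apply, LinearMap.smul_apply,
      h, g, e]
    rw [act_one, D.proj_superComm hx hy i j v w hp h' gp g', map_sub, map_smul, ← act_one,
      ← act_one]
    -- The two products of `P x` and `P y` cancel by graded commutativity. If one of the vectors is
    -- zero its index may have the wrong degree, but then both products vanish.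
    have : ((-1 : 𝕂) ^ (n * deg j)) • (gen 𝕂 V deg j w * gen 𝕂 V deg i v) =
        ((-1 : 𝕂) ^ (n * k)) • ((-1 : 𝕂) ^ (k * deg i)) •
          (gen 𝕂 V deg i v * gen 𝕂 V deg j w) := by
      rcases h' with rfl | rfl
      · rcases g' with rfl | rfl
        · rw [gen_mul_gen 𝕂 j i w v, smul_smul]
        · simp
      · simp
    rw [smul_add, this]
    abel
  · intro z z' hz hz' n k x y hx hy; rw [map_add, map_add, hz hx hy, hz' hx hy]
  · intro c z hz n k x y hx hy; rw [map_smul, map_smul, hz hx hy]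
  · intro i v z hz n k x y hx hy
    have h1 := hz hx hy
    have h2 := hz hx (D.superComm_emb hy i v)
    have h3 := hz (D.superComm_emb hx i v) hy
    rw [act_gen_mul, superComm_jacobi, map_add, map_smul, LinearMap.add_apply,
      LinearMap.smul_apply, h1, add_assoc n, h2, ← add_assoc n, add_right_comm n, h3]
    simp only [gradedBracket, LinearMap.sub_apply, LinearMap.comp_apply, LinearMap.smul_apply,
      act_gen_mul, map_add, map_smul, add_mul, mul_add, negOne_zpow_add, smul_sub, smul_add,
      mul_sub, mul_smul_comm, smul_smul, mul_comm (deg i) k]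
    linear_combination (norm := module) -((-1 : 𝕂) ^ (n * k) *
      negOne_zpow_sq 𝕂 (k * deg i)) • (D.act k y
        (D.act (n + deg i) (superComm 𝕂 n (deg i) x (D.emb i v)) z))

end DerivedBracketData

end Induced

end GradedSym

namespace LieAlgd

/-! ### Signed shuffles of lists -/

section ListShuffle

variable {G N N' : Type*} [AddCommGroup N] [AddCommGroup N']

/-- The signed sum of `T u v` over all the ways to deal the elements of a list into two lists. -/
def shuf : List G → (List G → List G → N) → N
  | [], T => T [] []
  | a :: l, T => shuf l (fun u v => T (a :: u) v) +
      shuf l (fun u v => ((-1 : ℤ) ^ u.length) • T u (a :: v))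

theorem shuf_congr {l : List G} {T T' : List G → List G → N}
    (h : ∀ u v, u.length + v.length = l.length → T u v = T' u v) : shuf l T = shuf l T' := by
  induction l generalizing T T' with
  | nil => exact h _ _ rfl
  | cons a l ih =>
    rw [shuf, shuf]
    congr 1
    · exact ih fun u v huv => h _ _ (by simp; omega)
    · exact ih fun u v huv => by rw [h u (a :: v) (by simp; omega)]

theorem map_shuf (f : N →+ N') (l : List G) (T : List G → List G → N) :
    f (shuf l T) = shuf l fun u v => f (T u v) := by
  induction l generalizing T with
  | nil => rfl
  | cons a l ih => simp only [shuf, map_add, ih, map_zsmul]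

theorem shuf_add (l : List G) (T T' : List G → List G → N) :
    (shuf l fun u v => T u v + T' u v) = shuf l T + shuf l T' := by
  induction l generalizing T T' with
  | nil => rfl
  | cons a l ih => simp only [shuf, smul_add, ih]; abel

@[simp] theorem shuf_zero (l : List G) : (shuf l fun _ _ => (0 : N)) = 0 := by
  induction l with
  | nil => rfl
  | cons a l ih => simp only [shuf, smul_zero, ih, add_zero]

theorem shuf_zsmul (c : ℤ) (l : List G) (T : List G → List G → N) :
    (shuf l fun u v => c • T u v) = c • shuf l T :=
  (map_shuf (zsmulAddGroupHom c) l T).symm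

theorem shuf_smul {𝕜 : Type*} [Ring 𝕜] [Module 𝕜 N] (c : 𝕜) (l : List G)
    (T : List G → List G → N) : (shuf l fun u v => c • T u v) = c • shuf l T :=
  (map_shuf (DistribSMul.toAddMonoidHom N c) l T).symm

theorem shuf_neg (l : List G) (T : List G → List G → N) :
    (shuf l fun u v => -T u v) = -shuf l T :=
  (map_shuf (negAddMonoidHom : N →+ N) l T).symm

/-- Coassociativity: both sides deal `l` into three lists, and the signs agree because the length of
`w` is the sum of those of `u` and `v`. -/
theorem shuf_assoc (l : List G) (T : List G → List G → List G → N) :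
    (shuf l fun w x => shuf w fun u v => T u v x) =
      shuf l fun u y => shuf y fun v x => T u v x := by
  induction l generalizing T with
  | nil => rfl
  | cons a l ih =>
    simp only [shuf, shuf_add, ih fun u v x => T (a :: u) v x, ← shuf_zsmul, smul_add]
    rw [ih fun u v x => ((-1 : ℤ) ^ u.length) • T u (a :: v) x, add_assoc]
    congr 2
    rw [← ih fun u v x => ((-1 : ℤ) ^ u.length) • ((-1 : ℤ) ^ v.length) • T u v (a :: x)]
    refine shuf_congr fun w x _ => shuf_congr fun u v huv => ?_
    rw [← huv, pow_add, mul_smul]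

/-- Graded cocommutativity: exchanging the two lists reverses the order of each pair with one entry
in `u` and one in `v`. -/
theorem shuf_comm (l : List G) (T : List G → List G → N) :
    shuf l T = shuf l fun u v => ((-1 : ℤ) ^ (u.length * v.length)) • T v u := by
  induction l generalizing T with
  | nil => simp [shuf]
  | cons a l ih =>
    rw [shuf, shuf, ih, ih fun u v => ((-1 : ℤ) ^ u.length) • T u (a :: v), add_comm]
    congr 1
    · refine shuf_congr fun u v _ => ?_
      rw [List.length_cons, add_mul, one_mul, pow_add, mul_smul]
    · refine shuf_congr fun u v _ => ?_
      rw [smul_smul, List.length_cons, mul_add, mul_one, pow_add, mul_comm u.length,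
        mul_left_comm, ← mul_pow]
      simp

theorem shuf_eq_right_nil {l : List G} {T : List G → List G → N}
    (h : ∀ u v, v ≠ [] → T u v = 0) : shuf l T = T l [] := by
  induction l generalizing T with
  | nil => rfl
  | cons a l ih =>
    rw [shuf, ih (T := fun u v => T (a :: u) v) fun u v hv => h _ _ hv]
    have : (fun u v => ((-1 : ℤ) ^ u.length) • T u (a :: v)) = fun _ _ => 0 := by
      funext u v
      rw [h _ _ (by simp), smul_zero]
    rw [this, shuf_zero, add_zero]

theorem shuf_eq_left_nil {l : List G} {T : List G → List G → N}
    (h : ∀ u v, u ≠ [] → T u v = 0) : shuf l T = T [] l := by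
  rw [shuf_comm, shuf_eq_right_nil]
  · simp
  · intro u v hv
    rw [h _ _ hv, smul_zero]

/-- A function of `k` variables, as a function on lists (zero on the lists of other lengths). -/
def onList (k : ℕ) (F : (Fin k → G) → N) (l : List G) : N :=
  if h : l.length = k then F (fun t => l.get (t.cast h.symm)) else 0

theorem onList_of_ne {k : ℕ} (F : (Fin k → G) → N) {l : List G} (h : l.length ≠ k) :
    onList k F l = 0 := dif_neg h

theorem onList_ofFn {k : ℕ} (F : (Fin k → G) → N) (a : Fin k → G) :
    onList k F (List.ofFn a) = F a := by
  rw [onList, dif_pos (by simp)]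
  congr 1
  funext t
  simp

theorem onList_nil (F : (Fin 0 → G) → N) : onList 0 F [] = F ![] := by
  rw [onList, dif_pos (by rfl)]
  congr 1
  exact Subsingleton.elim _ _

theorem onList_cons {k : ℕ} (F : (Fin (k + 1) → G) → N) (a : G) (l : List G) :
    onList (k + 1) F (a :: l) = onList k (fun x => F (Fin.cons a x)) l := by
  by_cases h : l.length = k
  · subst h
    rw [onList, onList, dif_pos rfl, dif_pos (by simp)]
    congr 1
    funext t
    refine Fin.cases rfl (fun t => rfl) t
  · rw [onList_of_ne _ h, onList_of_ne _ (by simpa using h)]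

theorem onList_add (k : ℕ) (F F' : (Fin k → G) → N) (l : List G) :
    onList k (fun x => F x + F' x) l = onList k F l + onList k F' l := by
  unfold onList; split_ifs <;> simp

theorem map_onList (f : N →+ N') (k : ℕ) (F : (Fin k → G) → N) (l : List G) :
    f (onList k F l) = onList k (fun x => f (F x)) l := by
  unfold onList; split_ifs <;> simp

end ListShuffle

/-! ### Permutations increasing on blocks, as shuffles of lists -/

section Perm

variable {G N : Type*} [AddCommGroup N]

theorem decomposeFin_fst {n : ℕ} (σ : Equiv.Perm (Fin (n + 1))) :
    (Equiv.Perm.decomposeFin σ).1 = σ 0 := by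
  obtain ⟨⟨p, e⟩, rfl⟩ := Equiv.Perm.decomposeFin.symm.surjective σ
  rw [Equiv.apply_symm_apply, Equiv.Perm.decomposeFin_symm_apply_zero]

/-- The permutation of `{0, …, n}` that sends `p` to `0` and is `σ` elsewhere. -/
def permInsert {n : ℕ} : Fin (n + 1) × Equiv.Perm (Fin n) ≃ Equiv.Perm (Fin (n + 1)) where
  toFun x := Equiv.Perm.decomposeFin.symm (0, x.2) * x.1.cycleRange
  invFun σ := (σ.symm 0, (Equiv.Perm.decomposeFin (σ * (σ.symm 0).cycleRange⁻¹)).2)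
  left_inv := by
    rintro ⟨p, σ⟩
    have h : (Equiv.Perm.decomposeFin.symm ((0 : Fin (n + 1)), σ) * p.cycleRange).symm 0 = p := by
      rw [Equiv.symm_apply_eq, Equiv.Perm.mul_apply, Fin.cycleRange_self]
      simp
    simp only [h]
    rw [mul_assoc, mul_inv_cancel, mul_one, Equiv.apply_symm_apply]
  right_inv := by
    intro σ
    have h : Equiv.Perm.decomposeFin (σ * (σ.symm 0).cycleRange⁻¹) =
        (0, (Equiv.Perm.decomposeFin (σ * (σ.symm 0).cycleRange⁻¹)).2) := by
      refine Prod.ext ?_ rfl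
      rw [decomposeFin_fst, Equiv.Perm.mul_apply]
      have : (σ.symm 0).cycleRange⁻¹ 0 = σ.symm 0 := by
        rw [Equiv.Perm.inv_eq_iff_eq, Fin.cycleRange_self]
      rw [this, Equiv.apply_symm_apply]
    change Equiv.Perm.decomposeFin.symm (0, _) * _ = _
    rw [← h, Equiv.symm_apply_apply, inv_mul_cancel_right]

theorem permInsert_self {n : ℕ} (p : Fin (n + 1)) (σ : Equiv.Perm (Fin n)) :
    permInsert (p, σ) p = 0 := by
  simp [permInsert, Fin.cycleRange_self]

theorem permInsert_succAbove {n : ℕ} (p : Fin (n + 1)) (σ : Equiv.Perm (Fin n)) (t : Fin n) :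
    permInsert (p, σ) (p.succAbove t) = (σ t).succ := by
  simp [permInsert, Fin.cycleRange_succAbove]

theorem sign_permInsert {n : ℕ} (p : Fin (n + 1)) (σ : Equiv.Perm (Fin n)) :
    Equiv.Perm.sign (permInsert (p, σ)) = (-1) ^ (p : ℕ) * Equiv.Perm.sign σ := by
  simp [permInsert, Fin.sign_cycleRange, mul_comm]

open scoped Classical in
/-- The signed sum over the permutations that are increasing on the blocks of positions with equal
labels. -/
def blockSum {n : ℕ} (lab : Fin n → ℕ) (a : Fin n → G) (F : (Fin n → G) → N) : N :=
  ∑ σ : Equiv.Perm (Fin n), if ∀ x y, x < y → lab x = lab y → σ x < σ y then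
    Equiv.Perm.sign σ • F (a ∘ σ) else 0

-- Group the permutations by the position `p` of the value `0`. Being increasing forces `p` to be
-- the first position of its block; deleting it leaves a permutation of the same kind and costs the
-- sign `(-1)^p`.
open scoped Classical in
theorem blockSum_cons {n : ℕ} (lab : Fin (n + 1) → ℕ) (a₀ : G) (a : Fin n → G)
    (F : (Fin (n + 1) → G) → N) :
    blockSum lab (Fin.cons a₀ a : Fin (n + 1) → G) F =
      ∑ p : Fin (n + 1), if ∀ x < p, lab x ≠ lab p then
        ((-1 : ℤ) ^ (p : ℕ)) • blockSum (lab ∘ p.succAbove) a (fun b => F (p.insertNth a₀ b))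
      else 0 := by
  rw [blockSum, ← permInsert.sum_comp, Fintype.sum_prod_type]
  refine Finset.sum_congr rfl fun p _ => ?_
  split_ifs with hp
  · rw [blockSum, Finset.smul_sum]
    refine Finset.sum_congr rfl fun σ _ => ?_
    have hiff : (∀ x y, x < y → lab x = lab y → permInsert (p, σ) x < permInsert (p, σ) y) ↔
        ∀ x y, x < y → (lab ∘ p.succAbove) x = (lab ∘ p.succAbove) y → σ x < σ y := by
      constructor
      · intro h x y hxy hl
        have := h _ _ (Fin.strictMono_succAbove p hxy) hl
        rwa [permInsert_succAbove, permInsert_succAbove, Fin.succ_lt_succ_iff] at this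
      · intro h x y hxy hl
        rcases Fin.eq_self_or_eq_succAbove p x with rfl | ⟨x, rfl⟩
        · rcases Fin.eq_self_or_eq_succAbove x y with rfl | ⟨y, rfl⟩
          · exact absurd hxy (lt_irrefl _)
          · rw [permInsert_self, permInsert_succAbove]
            exact Fin.succ_pos _
        · rcases Fin.eq_self_or_eq_succAbove p y with rfl | ⟨y, rfl⟩
          · exact absurd hl (hp _ hxy)
          · rw [permInsert_succAbove, permInsert_succAbove, Fin.succ_lt_succ_iff]
            exact h x y ((Fin.strictMono_succAbove p).lt_iff_lt.1 hxy) hl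
    have hF : (Fin.cons a₀ a : Fin (n + 1) → G) ∘ permInsert (p, σ) =
        p.insertNth a₀ (a ∘ σ) := by
      funext x
      rcases Fin.eq_self_or_eq_succAbove p x with rfl | ⟨x, rfl⟩
      · simp [permInsert_self]
      · simp [permInsert_succAbove]
    rw [hF, sign_permInsert]
    by_cases h : ∀ x y, x < y → (lab ∘ p.succAbove) x = (lab ∘ p.succAbove) y → σ x < σ y
    · rw [if_pos h, if_pos (hiff.2 h), mul_smul]
      rcases neg_one_pow_eq_or ℤ (p : ℕ) with h1 | h1 <;>
        rcases neg_one_pow_eq_or ℤˣ (p : ℕ) with h2 | h2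
      · rw [h1, h2, one_smul, one_smul]
      · have := congrArg (Units.val) h2
        push_cast at this
        rw [h1] at this
        norm_num at this
      · have := congrArg (Units.val) h2
        push_cast at this
        rw [h1] at this
        norm_num at this
      · rw [h1, h2, Units.neg_smul, one_smul, neg_smul, one_smul]
    · rw [if_neg h, if_neg (fun h' => h (hiff.1 h')), smul_zero]
  · refine Finset.sum_eq_zero fun σ _ => if_neg fun h => hp fun x hx hl => ?_
    have := h x p hx hl
    rw [permInsert_self] at this
    exact absurd this (by simp)

/-- The block of a position, for blocks of sizes `i`, `j` and the rest. -/
def blockLabel (i j x : ℕ) : ℕ := if x < i then 0 else if x < i + j then 1 else 2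

/-- The first positions of the three blocks are `0`, `i` and `i + j`; an empty block has none,
whence the three conditions. -/
theorem sum_blockLabel_minimal {n i j k : ℕ} (h : i + j + k = n + 1) (g : ℕ → N) :
    (open scoped Classical in ∑ p : Fin (n + 1),
      if ∀ x < p, blockLabel i j x ≠ blockLabel i j p then g p else 0) =
      (if 0 < i then g 0 else 0) + (if 0 < j then g i else 0) +
        (if 0 < k then g (i + j) else 0) := by
  classical
  have key : ∀ (q : ℕ) (c : Prop) [Decidable c], (c → q < n + 1) →
      (if c then g q else 0) = ∑ p : Fin (n + 1), if (p : ℕ) = q ∧ c then g p else 0 := by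
    intro q c _ hq
    split_ifs with hc
    · rw [Finset.sum_eq_single (⟨q, hq hc⟩ : Fin (n + 1))]
      · simp [hc]
      · intro p _ hp
        rw [if_neg]
        rintro ⟨rfl, -⟩
        exact hp rfl
      · simp
    · simp [hc]
  rw [key 0 (0 < i) (by omega), key i (0 < j) (by omega), key (i + j) (0 < k) (by omega),
    ← Finset.sum_add_distrib, ← Finset.sum_add_distrib]
  refine Finset.sum_congr rfl fun p _ => ?_
  have hp := p.2
  have hiff : (∀ x < p, blockLabel i j x ≠ blockLabel i j p) ↔
      (((p : ℕ) = 0 ∧ 0 < i) ∨ ((p : ℕ) = i ∧ 0 < j)) ∨ ((p : ℕ) = i + j ∧ 0 < k) := by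
    constructor
    · intro h'
      by_contra hcon
      have h1 := h' ⟨p - 1, by omega⟩
      have : (p : ℕ) ≠ 0 := by omega
      refine h1 (Fin.lt_def.2 (by simp only; omega)) ?_
      simp only [blockLabel]
      split_ifs <;> omega
    · intro h' x hx
      have hx := Fin.lt_def.1 hx
      simp only [blockLabel]
      split_ifs <;> omega
  by_cases h1 : (p : ℕ) = 0 ∧ 0 < i
  · rw [if_pos (hiff.2 (Or.inl (Or.inl h1))), if_pos h1, if_neg (by omega), if_neg (by omega),
      add_zero, add_zero]
  · by_cases h2 : (p : ℕ) = i ∧ 0 < j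
    · rw [if_pos (hiff.2 (Or.inl (Or.inr h2))), if_neg h1, if_pos h2, if_neg (by omega),
        add_zero, zero_add]
    · by_cases h3 : (p : ℕ) = i + j ∧ 0 < k
      · rw [if_pos (hiff.2 (Or.inr h3)), if_neg h1, if_neg h2, if_pos h3, add_zero, zero_add]
      · rw [if_neg, if_neg h1, if_neg h2, if_neg h3, add_zero, add_zero]
        rw [hiff]
        tauto

theorem ofFn_insertNth {n : ℕ} (p : Fin (n + 1)) (a₀ : G) (b : Fin n → G) :
    List.ofFn (p.insertNth a₀ b : Fin (n + 1) → G) =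
      (List.ofFn b).take p ++ a₀ :: (List.ofFn b).drop p := by
  induction n with
  | zero =>
    obtain rfl : p = 0 := Fin.ext (by omega)
    simp
  | succ n ih =>
    refine Fin.cases ?_ (fun p => ?_) p
    · simp
    · have h0 : (p.succ.insertNth a₀ b : Fin (n + 2) → G) 0 = b 0 := by
        have := Fin.insertNth_apply_succAbove (α := fun _ => G) p.succ a₀ b 0
        rwa [Fin.succ_succAbove_zero] at this
      have h1 : (fun i : Fin (n + 1) => (p.succ.insertNth a₀ b : Fin (n + 2) → G) i.succ) =
          p.insertNth a₀ (fun i => b i.succ) := by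
        funext i
        rcases Fin.eq_self_or_eq_succAbove p i with rfl | ⟨i, rfl⟩
        · simp
        · have := Fin.insertNth_apply_succAbove (α := fun _ => G) p.succ a₀ b i.succ
          rw [Fin.succ_succAbove_succ] at this
          simp [this]
      rw [List.ofFn_succ, h0, h1, ih, List.ofFn_succ (f := b)]
      simp

/-- Both sides obey the same recursion on the first argument: it becomes the head of one of the
three blocks, with sign `1`, `(-1)^i` or `(-1)^(i+j)`. -/
theorem blockSum_eq_shuf {n i j k : ℕ} (h : i + j + k = n) (a : Fin n → G)
    (F : List G → List G → List G → N) :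
    blockSum (fun x => blockLabel i j x) a (fun b => F ((List.ofFn b).take i)
      (((List.ofFn b).drop i).take j) ((List.ofFn b).drop (i + j))) =
    shuf (List.ofFn a) fun u x => shuf x fun v w =>
      if u.length = i ∧ v.length = j ∧ w.length = k then F u v w else 0 := by
  induction n generalizing i j k F with
  | zero =>
    obtain ⟨⟨rfl, rfl⟩, rfl⟩ : (i = 0 ∧ j = 0) ∧ k = 0 := by omega
    simp [blockSum, shuf]
  | succ n ih =>
    obtain ⟨a₀, a, rfl⟩ : ∃ a₀ a', a = Fin.cons a₀ a' := ⟨a 0, Fin.tail a, (Fin.cons_self_tail a).symm⟩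
    rw [blockSum_cons]
    -- The summand is rewritten as a function of a natural number, since the first positions of the
    -- blocks are given as such.
    have hg : ∀ p : Fin (n + 1), ((-1 : ℤ) ^ (p : ℕ)) •
        blockSum ((fun x : Fin (n + 1) => blockLabel i j x) ∘ p.succAbove) a (fun b =>
          F ((List.ofFn (p.insertNth a₀ b : Fin (n + 1) → G)).take i)
          (((List.ofFn (p.insertNth a₀ b : Fin (n + 1) → G)).drop i).take j)
          ((List.ofFn (p.insertNth a₀ b : Fin (n + 1) → G)).drop (i + j))) =
        (fun q : ℕ => ((-1 : ℤ) ^ q) •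
          blockSum (fun x : Fin n => blockLabel i j (if (x : ℕ) < q then x else x + 1)) a
          (fun b => F (((List.ofFn b).take q ++ a₀ :: (List.ofFn b).drop q).take i)
            ((((List.ofFn b).take q ++ a₀ :: (List.ofFn b).drop q).drop i).take j)
            (((List.ofFn b).take q ++ a₀ :: (List.ofFn b).drop q).drop (i + j)))) p := by
      intro p
      simp only [ofFn_insertNth]
      congr 2
      funext x
      simp only [Function.comp_apply, Fin.succAbove, Fin.lt_def, Fin.val_castSucc]
      split_ifs <;> simp
    simp only [hg]
    rw [sum_blockLabel_minimal h (fun q : ℕ => ((-1 : ℤ) ^ q) •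
          blockSum (fun x : Fin n => blockLabel i j (if (x : ℕ) < q then x else x + 1)) a
          (fun b => F (((List.ofFn b).take q ++ a₀ :: (List.ofFn b).drop q).take i)
            ((((List.ofFn b).take q ++ a₀ :: (List.ofFn b).drop q).drop i).take j)
            (((List.ofFn b).take q ++ a₀ :: (List.ofFn b).drop q).drop (i + j))))]
    rw [List.ofFn_cons, shuf, add_assoc]
    congr 1
    · split_ifs with hi
      · obtain ⟨i, rfl⟩ : ∃ i', i = i' + 1 := ⟨i - 1, by omega⟩
        have := ih (i := i) (j := j) (k := k) (by omega) a (fun u v w => F (a₀ :: u) v w)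
        simp only [List.length_cons, add_left_inj]
        rw [← this, pow_zero, one_smul]
        congr 1
        · funext x
          simp only [blockLabel]
          split_ifs <;> omega
        · funext b
          simp [add_right_comm]
      · obtain rfl : i = 0 := by omega
        simp
    · simp only [shuf, smul_add, shuf_add, List.length_cons]
      congr 1
      · split_ifs with hj
        · obtain ⟨j, rfl⟩ : ∃ j', j = j' + 1 := ⟨j - 1, by omega⟩
          have := ih (i := i) (j := j) (k := k) (by omega) a (fun u v w => F u (a₀ :: v) w)
          have h2 : (shuf (List.ofFn a) fun u x => (-1 : ℤ) ^ u.length • shuf x fun v w =>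
              if u.length = i ∧ v.length + 1 = j + 1 ∧ w.length = k then F u (a₀ :: v) w else 0) =
              (-1 : ℤ) ^ i • shuf (List.ofFn a) fun u x => shuf x fun v w =>
              if u.length = i ∧ v.length = j ∧ w.length = k then F u (a₀ :: v) w else 0 := by
            simp only [← shuf_zsmul, add_left_inj]
            refine shuf_congr fun u x _ => shuf_congr fun v w _ => ?_
            split_ifs with h'
            · rw [h'.1]
            · simp
          rw [h2, ← this]
          congr 2
          · funext x
            simp only [blockLabel]
            split_ifs <;> omega
          · funext b
            have hl : ((List.ofFn b).take i).length = i := by simp; omega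
            rw [List.take_left' hl, List.drop_left' hl, ← List.drop_drop, List.drop_left' hl]
            simp [List.drop_drop]
        · obtain rfl : j = 0 := by omega
          simp
      · split_ifs with hk
        · obtain ⟨k, rfl⟩ : ∃ k', k = k' + 1 := ⟨k - 1, by omega⟩
          have := ih (i := i) (j := j) (k := k) (by omega) a (fun u v w => F u v (a₀ :: w))
          have h2 : (shuf (List.ofFn a) fun u x => (-1 : ℤ) ^ u.length • shuf x fun v w =>
              (-1 : ℤ) ^ v.length •
              if u.length = i ∧ v.length = j ∧ w.length + 1 = k + 1 then F u v (a₀ :: w) else 0) =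
              (-1 : ℤ) ^ (i + j) • shuf (List.ofFn a) fun u x => shuf x fun v w =>
              if u.length = i ∧ v.length = j ∧ w.length = k then F u v (a₀ :: w) else 0 := by
            simp only [← shuf_zsmul, add_left_inj]
            refine shuf_congr fun u x _ => shuf_congr fun v w _ => ?_
            split_ifs with h'
            · rw [h'.1, h'.2.1, pow_add, mul_smul]
            · simp
          rw [h2, ← this]
          congr 2
          · funext x
            simp only [blockLabel]
            split_ifs <;> omega
          · funext b
            have hl : ((List.ofFn b).take (i + j)).length = i + j := by simp; omega
            have hi : i ≤ ((List.ofFn b).take (i + j)).length := by omega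
            rw [List.drop_left' hl, List.take_append_of_le_length hi,
              List.drop_append_of_le_length hi, List.take_append_of_le_length (by simp; omega)]
            congr 1
            · rw [List.take_take]; congr 1; omega
            · rw [List.drop_take, List.take_take]; congr 1; omega
        · obtain rfl : k = 0 := by omega
          simp

end Perm

end LieAlgd

namespace LieAlgd

/-! ### Sums over shuffle permutations are list shuffles -/

section ShuffleSum

variable {G N : Type*} [AddCommGroup N]

theorem onList_eq_of_eq_ofFn {k : ℕ} (F : (Fin k → G) → N) {l : List G} (a : Fin k → G)
    (h : l = List.ofFn a) : onList k F l = F a := by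
  rw [h, onList_ofFn]

/-- Shuffles are the permutations increasing on the blocks of `blockLabel`. If the sizes do not add
up to `n`, the left side is zero by definition and every term on the right is zero because some list
has the wrong length. -/
theorem shuffleSum3_eq_shuf (i j k : ℕ) {n : ℕ} (a : Fin n → G)
    (T : (Fin i → G) → (Fin j → G) → (Fin k → G) → N) :
    shuffleSum3 i j k a T = shuf (List.ofFn a) fun u x => shuf x fun v w =>
      onList i (fun u => onList j (fun v => onList k (fun w => T u v w) w) v) u := by
  classical
  by_cases h : i + j + k = n
  · subst h
    set F : List G → List G → List G → N := fun u v w =>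
      onList i (fun u => onList j (fun v => onList k (fun w => T u v w) w) v) u with hF
    have h1 : (shuf (List.ofFn a) fun u x => shuf x fun v w => F u v w) =
        shuf (List.ofFn a) fun u x => shuf x fun v w =>
          if u.length = i ∧ v.length = j ∧ w.length = k then F u v w else 0 := by
      refine shuf_congr fun u x _ => shuf_congr fun v w _ => ?_
      split_ifs with h'
      · rfl
      · simp only [hF, onList]
        split_ifs <;> tauto
    change _ = shuf (List.ofFn a) fun u x => shuf x fun v w => F u v w
    rw [h1, ← blockSum_eq_shuf rfl, blockSum, shuffleSum3, dif_pos rfl, Sh3, Finset.sum_filter]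
    refine Finset.sum_congr rfl fun σ _ => ?_
    have hiff : (StrictMono (fun t : Fin i => σ (Fin.castAdd k (Fin.castAdd j t))) ∧
        StrictMono (fun t : Fin j => σ (Fin.castAdd k (Fin.natAdd i t))) ∧
        StrictMono (fun t : Fin k => σ (Fin.natAdd (i + j) t))) ↔
        ∀ x y : Fin (i + j + k), x < y → blockLabel i j x = blockLabel i j y → σ x < σ y := by
      constructor
      · rintro ⟨h1, h2, h3⟩ x y hxy hl
        rw [Fin.lt_def] at hxy
        have hx := x.2
        have hy := y.2
        by_cases c1 : (y : ℕ) < i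
        · exact h1 (a := ⟨x, by omega⟩) (b := ⟨y, c1⟩) (Fin.lt_def.2 hxy)
        · by_cases c2 : (y : ℕ) < i + j
          · have c3 : i ≤ (x : ℕ) := by
              simp only [blockLabel] at hl
              split_ifs at hl <;> omega
            have hx' : (x : ℕ) - i < j := by omega
            have ex : x = Fin.castAdd k (Fin.natAdd i ⟨x - i, hx'⟩) :=
              Fin.ext (by simp; omega)
            have ey : y = Fin.castAdd k (Fin.natAdd i ⟨y - i, by omega⟩) :=
              Fin.ext (by simp; omega)
            rw [ex, ey]
            exact h2 (Fin.lt_def.2 (by simp only; omega))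
          · have c3 : i + j ≤ (x : ℕ) := by
              simp only [blockLabel] at hl
              split_ifs at hl <;> omega
            have hx' : (x : ℕ) - (i + j) < k := by omega
            have ex : x = Fin.natAdd (i + j) ⟨x - (i + j), hx'⟩ :=
              Fin.ext (by simp; omega)
            have ey : y = Fin.natAdd (i + j) ⟨y - (i + j), by omega⟩ :=
              Fin.ext (by simp; omega)
            rw [ex, ey]
            exact h3 (Fin.lt_def.2 (by simp only; omega))
      · intro h
        refine ⟨fun x y hxy => ?_, fun x y hxy => ?_, fun x y hxy => ?_⟩ <;>
          rw [Fin.lt_def] at hxy <;> have hx := x.2 <;> have hy := y.2 <;>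
          refine h _ _ (Fin.lt_def.2 (by simp; omega)) ?_ <;>
          simp only [blockLabel, Fin.val_castAdd, Fin.val_natAdd] <;> split_ifs <;> omega
    by_cases hσ : ∀ x y : Fin (i + j + k), x < y → blockLabel i j x = blockLabel i j y → σ x < σ y
    · rw [if_pos (hiff.2 hσ), if_pos hσ, hF]
      congr 1
      dsimp only
      rw [onList_eq_of_eq_ofFn _ (fun t : Fin i => a (σ (Fin.castAdd k (Fin.castAdd j t)))),
        onList_eq_of_eq_ofFn _ (fun t : Fin j => a (σ (Fin.castAdd k (Fin.natAdd i t)))),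
        onList_eq_of_eq_ofFn _ (fun t : Fin k => a (σ (Fin.natAdd (i + j) t)))]
      · rfl
      · refine List.ext_getElem (by simp) fun t h1 h2 => ?_
        simp
      · refine List.ext_getElem (by simp; omega) fun t h1 h2 => ?_
        simp
      · refine List.ext_getElem (by simp; omega) fun t h1 h2 => ?_
        simp
    · rw [if_neg (fun h => hσ (hiff.1 h)), if_neg hσ]
  · rw [shuffleSum3, dif_neg h]
    symm
    rw [← shuf_zero (List.ofFn a)]
    refine shuf_congr fun u x hu => ?_
    rw [← shuf_zero x]
    refine shuf_congr fun v w hv => ?_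
    rw [List.length_ofFn] at hu
    simp only [onList]
    split_ifs <;> first | rfl | omega

theorem shuffleSum2_eq_shuffleSum3 (i j : ℕ) {n : ℕ} (a : Fin n → G)
    (T : (Fin i → G) → (Fin j → G) → N) :
    shuffleSum2 i j a T = shuffleSum3 i j 0 a fun u v _ => T u v := by
  have h : Sh2 i j = Sh3 i j 0 := by
    ext σ
    simp only [Sh2, Sh3, Finset.mem_filter, Finset.mem_univ, true_and]
    refine and_congr_right fun _ => (and_iff_left_of_imp fun _ => ?_).symm
    exact Subsingleton.strictMono _
  rw [shuffleSum2, shuffleSum3, h]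
  rfl

theorem shuffleSum2_eq_shuf (i j : ℕ) {n : ℕ} (a : Fin n → G)
    (T : (Fin i → G) → (Fin j → G) → N) :
    shuffleSum2 i j a T = shuf (List.ofFn a) fun u v => onList i (fun u => onList j (T u) v) u := by
  rw [shuffleSum2_eq_shuffleSum3, shuffleSum3_eq_shuf]
  refine shuf_congr fun u x _ => ?_
  rw [shuf_eq_right_nil]
  · simp only [onList_nil]
  · intro v w hw
    have : w.length ≠ 0 := by simpa using hw
    simp only [onList]
    split_ifs <;> tauto

end ShuffleSum

/-! ### The wedge product as a sum over shuffles -/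

section Wedge

open Equiv

variable {R A N N₁ N₂ : Type*} [CommRing R] [AddCommGroup A] [Module R A] [AddCommGroup N]
  [Module R N] [AddCommGroup N₁] [Module R N₁] [AddCommGroup N₂] [Module R N₂]

/-- `domCoprod` sums over the cosets of the block permutations. Each coset contains a shuffle,
obtained by sorting the values on each block, and only one, since strictly increasing maps with the
same range are equal. -/
theorem domCoprod_eq_shuffleSum2 {k p : ℕ} (η : A [⋀^Fin k]→ₗ[R] N₁) (X : A [⋀^Fin p]→ₗ[R] N₂)
    (a : Fin (k + p) → A) :
    (η.domCoprod X).domDomCongr finSumFinEquiv a =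
      shuffleSum2 k p a fun u v => η u ⊗ₜ[R] X v := by
  classical
  rw [AlternatingMap.domDomCongr_apply, AlternatingMap.domCoprod_apply,
    _root_.sum_apply, shuffleSum2, dif_pos rfl]
  symm
  refine Finset.sum_bij (fun σ _ => Quotient.mk'' (finSumFinEquiv.permCongr.symm σ))
    (fun _ _ => Finset.mem_univ _) ?_ ?_ ?_
  · intro σ hσ τ hτ h
    obtain ⟨⟨s, t⟩, hst⟩ := QuotientGroup.leftRel_apply.mp (Quotient.exact' h)
    have hst' : finSumFinEquiv.permCongr.symm τ =
        finSumFinEquiv.permCongr.symm σ * Perm.sumCongrHom _ _ (s, t) := by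
      rw [hst, mul_inv_cancel_left]
    simp only [Sh2, Finset.mem_filter, Finset.mem_univ, true_and] at hσ hτ
    have h1 : ∀ x, τ (Fin.castAdd p x) = σ (Fin.castAdd p (s x)) := fun x => by
      have := congrArg finSumFinEquiv (Equiv.congr_fun hst' (Sum.inl x))
      simpa using this
    have h2 : ∀ x, τ (Fin.natAdd k x) = σ (Fin.natAdd k (t x)) := fun x => by
      have := congrArg finSumFinEquiv (Equiv.congr_fun hst' (Sum.inr x))
      simpa using this
    have e1 := (StrictMono.range_inj hσ.1 hτ.1).1 (by
      rw [funext h1]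
      exact (s.surjective.range_comp (fun x => σ (Fin.castAdd p x))).symm)
    have e2 := (StrictMono.range_inj hσ.2 hτ.2).1 (by
      rw [funext h2]
      exact (t.surjective.range_comp (fun x => σ (Fin.natAdd k x))).symm)
    refine Equiv.ext fun x => ?_
    exact Fin.addCases (fun x => congrFun e1 x) (fun x => congrFun e2 x) x
  · intro q _
    induction q using Quotient.inductionOn' with | _ σ
    set σ' := finSumFinEquiv.permCongr σ with hσ'
    set f : Fin k → Fin (k + p) := fun x => σ' (Fin.castAdd p x)
    set g : Fin p → Fin (k + p) := fun x => σ' (Fin.natAdd k x)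
    have hf : Function.Injective f := σ'.injective.comp (Fin.castAdd_injective k p)
    have hg : Function.Injective g := σ'.injective.comp (Fin.natAdd_injective p k)
    refine ⟨finSumFinEquiv.permCongr (σ * Perm.sumCongrHom _ _ (Tuple.sort f, Tuple.sort g)),
      ?_, ?_⟩
    · simp only [Sh2, Finset.mem_filter, Finset.mem_univ, true_and]
      constructor
      · have := (Tuple.monotone_sort f).strictMono_of_injective (hf.comp (Tuple.sort f).injective)
        convert this using 2 with x
        simp [f, hσ']
      · have := (Tuple.monotone_sort g).strictMono_of_injective (hg.comp (Tuple.sort g).injective)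
        convert this using 2 with x
        simp [g, hσ']
    · rw [Equiv.symm_apply_apply]
      refine Quotient.sound' ?_
      rw [QuotientGroup.leftRel_apply]
      refine ⟨((Tuple.sort f)⁻¹, (Tuple.sort g)⁻¹), ?_⟩
      rw [mul_inv_rev, inv_mul_cancel_right, ← map_inv]
      rfl
  · intro σ _
    rw [AlternatingMap.domCoprod.summand_mk'']
    have hs : Perm.sign (finSumFinEquiv.permCongr.symm σ) = Perm.sign σ := by
      rw [Equiv.permCongr_symm, Perm.sign_permCongr]
    rw [hs]
    simp [MultilinearMap.domDomCongr_apply, MultilinearMap.domCoprod_apply]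

end Wedge

end LieAlgd

namespace LieAlgd

open GradedSym ExteriorAlgebra

/-! ### Coderivations of the exterior algebra -/

section Hat

variable {𝕂 : Type*} [Field 𝕂] {L : Type*} [AddCommGroup L] [Module 𝕂 L]

instance : AddCommGroup (ExteriorAlgebra 𝕂 L) := inferInstance
instance : AddCommMonoid (ExteriorAlgebra 𝕂 L) := inferInstance
instance : Module 𝕂 (ExteriorAlgebra 𝕂 L) := inferInstance
instance : Semiring (ExteriorAlgebra 𝕂 L) := inferInstance
instance : Ring (Module.End 𝕂 (ExteriorAlgebra 𝕂 L)) := inferInstance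
instance : Semiring (Module.End 𝕂 (ExteriorAlgebra 𝕂 L)) := inferInstance
instance : Algebra 𝕂 (Module.End 𝕂 (ExteriorAlgebra 𝕂 L)) := inferInstance
instance : AddCommGroup (Module.End 𝕂 (ExteriorAlgebra 𝕂 L)) := inferInstance
instance : AddCommMonoid (Module.End 𝕂 (ExteriorAlgebra 𝕂 L)) := inferInstance
instance : Module 𝕂 (Module.End 𝕂 (ExteriorAlgebra 𝕂 L)) := inferInstance

theorem negOne_zpow_mul_negOne (n : ℤ) : (-1 : 𝕂) ^ (n * (-1)) = (-1) ^ n := by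
  rw [mul_neg_one, zpow_neg, ← inv_zpow, inv_neg_one]

variable (𝕂) in
/-- Left multiplication by a vector on the exterior algebra. -/
def lmul : L →ₗ[𝕂] Module.End 𝕂 (ExteriorAlgebra 𝕂 L) :=
  LinearMap.mul 𝕂 (ExteriorAlgebra 𝕂 L) ∘ₗ ι 𝕂

@[simp] theorem lmul_apply (u : L) (w : ExteriorAlgebra 𝕂 L) : lmul 𝕂 u w = ι 𝕂 u * w := rfl

/-- Induction on the number of factors. -/
theorem exterior_induction {C : ExteriorAlgebra 𝕂 L → Prop} (one : C 1)
    (add : ∀ x y, C x → C y → C (x + y)) (smul : ∀ (c : 𝕂) x, C x → C (c • x))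
    (ι_mul : ∀ u x, C x → C (ι 𝕂 u * x)) (w : ExteriorAlgebra 𝕂 L) : C w := by
  refine CliffordAlgebra.left_induction (Q := (0 : QuadraticForm 𝕂 L)) (P := C) ?_ add
    (fun x u hx => ι_mul u x hx) w
  intro r
  rw [Algebra.algebraMap_eq_smul_one]
  exact smul r 1 one

theorem apply_ι_mul (n : ℤ) (D : Module.End 𝕂 (ExteriorAlgebra 𝕂 L)) (u : L)
    (w : ExteriorAlgebra 𝕂 L) : D (ι 𝕂 u * w) =
      superComm 𝕂 n (-1) D (lmul 𝕂 u) w + ((-1 : 𝕂) ^ n) • (ι 𝕂 u * D w) := by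
  rw [superComm_apply, negOne_zpow_mul_negOne]
  simp only [LinearMap.sub_apply, LinearMap.smul_apply, Module.End.mul_apply, lmul_apply,
    sub_add_cancel]

/-- As `D(u ∧ w) = [D, u] w ± u ∧ D w`, an operator is determined by its value at `1` and its
commutators with vectors. Identities between coderivations are proved this way, by induction on the
number of arguments. -/
theorem endo_ext (n : ℤ) {D D' : Module.End 𝕂 (ExteriorAlgebra 𝕂 L)} (h1 : D 1 = D' 1)
    (h : ∀ u, superComm 𝕂 n (-1) D (lmul 𝕂 u) = superComm 𝕂 n (-1) D' (lmul 𝕂 u)) : D = D' := by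
  refine LinearMap.ext fun w => ?_
  refine exterior_induction (C := fun w => D w = D' w) h1 ?_ ?_ ?_ w
  · intro x y hx hy; rw [map_add, map_add, hx, hy]
  · intro c x hx; rw [map_smul, map_smul, hx]
  · intro u x hx; rw [apply_ι_mul n, apply_ι_mul n D', hx, h]

theorem ιInv_one : ιInv (1 : ExteriorAlgebra 𝕂 L) = 0 := by
  let m' : Module 𝕂ᵐᵒᵖ L := Module.compHom _ ((RingHom.id 𝕂).fromOpposite mul_comm)
  have : IsCentralScalar 𝕂 L := ⟨fun _ _ => rfl⟩
  change TrivSqZeroExt.snd (toTrivSqZeroExt (1 : ExteriorAlgebra 𝕂 L)) = 0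
  rw [map_one, TrivSqZeroExt.snd_one]

theorem ιInv_ι_mul (u : L) (w : ExteriorAlgebra 𝕂 L) :
    ιInv (ι 𝕂 u * w) = algebraMapInv w • u := by
  refine exterior_induction (C := fun w => ιInv (ι 𝕂 u * w) = algebraMapInv w • u) ?_ ?_ ?_ ?_ w
  · rw [mul_one, map_one, one_smul, ι_leftInverse]
  · intro x y hx hy; rw [mul_add, map_add, map_add, add_smul, hx, hy]
  · intro c x hx; rw [mul_smul_comm, map_smul, map_smul, hx, smul_assoc]
  · intro v x _; simp [ιInv, algebraMapInv]

variable {N : Type*} [AddCommGroup N] [Module 𝕂 N]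

/-- An alternating map as a linear map on the exterior algebra, zero on the other exterior powers. -/
def evalAlt (k : ℕ) : (L [⋀^Fin k]→ₗ[𝕂] N) →ₗ[𝕂] ExteriorAlgebra 𝕂 L →ₗ[𝕂] N :=
  liftAlternating ∘ₗ LinearMap.single 𝕂 (fun i => L [⋀^Fin i]→ₗ[𝕂] N) k

theorem evalAlt_zero_one (X : L [⋀^Fin 0]→ₗ[𝕂] N) : evalAlt 0 X 1 = X ![] := by
  simp only [evalAlt, LinearMap.comp_apply, liftAlternating_one, LinearMap.single_apply,
    Pi.single_eq_same]
  congr 1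
  exact Subsingleton.elim _ _

theorem evalAlt_succ_one {k : ℕ} (X : L [⋀^Fin (k + 1)]→ₗ[𝕂] N) : evalAlt (k + 1) X 1 = 0 := by
  simp [evalAlt, liftAlternating_one]

theorem evalAlt_zero_ι_mul (X : L [⋀^Fin 0]→ₗ[𝕂] N) (u : L) (w : ExteriorAlgebra 𝕂 L) :
    evalAlt 0 X (ι 𝕂 u * w) = 0 := by
  simp only [evalAlt, LinearMap.comp_apply, liftAlternating_ι_mul]
  have : (fun i => AlternatingMap.curryLeft ((LinearMap.single 𝕂
      (fun i => L [⋀^Fin i]→ₗ[𝕂] N) 0 X) (Nat.succ i)) u) = 0 := by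
    funext i
    rw [LinearMap.single_apply, Pi.single_eq_of_ne (by omega)]
    rfl
  rw [this, map_zero, LinearMap.zero_apply]

theorem evalAlt_succ_ι_mul {k : ℕ} (X : L [⋀^Fin (k + 1)]→ₗ[𝕂] N) (u : L)
    (w : ExteriorAlgebra 𝕂 L) :
    evalAlt (k + 1) X (ι 𝕂 u * w) = evalAlt k (X.curryLeft u) w := by
  simp only [evalAlt, LinearMap.comp_apply, liftAlternating_ι_mul]
  have : (fun i => AlternatingMap.curryLeft ((LinearMap.single 𝕂
      (fun i => L [⋀^Fin i]→ₗ[𝕂] N) (k + 1) X) (Nat.succ i)) u) =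
      LinearMap.single 𝕂 (fun i => L [⋀^Fin i]→ₗ[𝕂] N) k (X.curryLeft u) := by
    funext i
    by_cases h : i = k
    · subst h; simp
    · rw [LinearMap.single_apply, LinearMap.single_apply, Pi.single_eq_of_ne (by omega),
        Pi.single_eq_of_ne h]
      rfl
  rw [this]

theorem evalAlt_zero (X : L [⋀^Fin 0]→ₗ[𝕂] N) (w : ExteriorAlgebra 𝕂 L) :
    evalAlt 0 X w = algebraMapInv w • X ![] := by
  refine exterior_induction (C := fun w => evalAlt 0 X w = algebraMapInv w • X ![]) ?_ ?_ ?_ ?_ w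
  · rw [evalAlt_zero_one, map_one, one_smul]
  · intro x y hx hy; rw [map_add, map_add, hx, hy, add_smul]
  · intro c x hx; rw [map_smul, map_smul, hx, smul_assoc]
  · intro u x _; rw [evalAlt_zero_ι_mul]; simp [algebraMapInv]

theorem evalAlt_one (X : L [⋀^Fin 1]→ₗ[𝕂] N) (w : ExteriorAlgebra 𝕂 L) :
    evalAlt 1 X w = X ![ιInv w] := by
  have hX : ∀ u, X ![u] = AlternatingMap.curryLeftLinearMap X u ![] := by
    intro u; rfl
  refine exterior_induction (C := fun w => evalAlt 1 X w = X ![ιInv w]) ?_ ?_ ?_ ?_ w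
  · rw [evalAlt_succ_one, ιInv_one, hX, map_zero, AlternatingMap.zero_apply]
  · intro x y hx hy; simp only [map_add, hx, hy, hX, AlternatingMap.add_apply]
  · intro c x hx; simp only [map_smul, hx, hX, AlternatingMap.smul_apply]
  · intro u x _
    rw [evalAlt_succ_ι_mul, evalAlt_zero, ιInv_ι_mul]
    simp only [hX, map_smul, AlternatingMap.smul_apply]
    rfl

/-- The operators that generate the action of the exterior algebra in the definition of `hat`. -/
def hatOp : L →ₗ[𝕂] Module.End 𝕂
    (ℤ → (ExteriorAlgebra 𝕂 L →ₗ[𝕂] L) →ₗ[𝕂] ExteriorAlgebra 𝕂 L) where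
  toFun u :=
    { toFun := fun F n => F (n - 1) ∘ₗ (lmul 𝕂 u).lcomp 𝕂 L +
        ((-1 : 𝕂) ^ n) • lmul 𝕂 u ∘ₗ F n
      map_add' := fun F G => by
        ext n x
        simp only [Pi.add_apply, LinearMap.add_apply, LinearMap.comp_apply, LinearMap.smul_apply,
          map_add, smul_add]
        abel
      map_smul' := fun c F => by
        ext n x
        simp only [Pi.smul_apply, LinearMap.add_apply, LinearMap.comp_apply, LinearMap.smul_apply,
          map_smul, smul_add, RingHom.id_apply, smul_comm c] }
  map_add' u v := by
    ext F n x
    have : (lmul 𝕂 (u + v)).lcomp 𝕂 L x = (lmul 𝕂 u).lcomp 𝕂 L x + (lmul 𝕂 v).lcomp 𝕂 L x := by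
      ext; simp
    simp only [LinearMap.coe_mk, AddHom.coe_mk, LinearMap.add_apply, LinearMap.comp_apply,
      LinearMap.smul_apply, this]
    simp only [map_add, LinearMap.add_apply, smul_add, Pi.add_apply, LinearMap.comp_apply,
      LinearMap.smul_apply]
    abel
  map_smul' c u := by
    ext F n x
    have : (lmul 𝕂 (c • u)).lcomp 𝕂 L x = c • (lmul 𝕂 u).lcomp 𝕂 L x := by
      ext; simp
    simp only [LinearMap.coe_mk, AddHom.coe_mk, LinearMap.add_apply, LinearMap.comp_apply,
      LinearMap.smul_apply, this]
    simp only [map_smul, LinearMap.smul_apply, smul_add, Pi.smul_apply, LinearMap.add_apply,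
      RingHom.id_apply, LinearMap.comp_apply, smul_comm c]

/-- Read `F n c` as the value at some `w` of the coderivation of degree `n` with corestriction `c`;
then `hatOp u F` gives the values at `u ∧ w`. -/
theorem hatOp_apply (u : L) (F : ℤ → (ExteriorAlgebra 𝕂 L →ₗ[𝕂] L) →ₗ[𝕂] ExteriorAlgebra 𝕂 L)
    (n : ℤ) (c : ExteriorAlgebra 𝕂 L →ₗ[𝕂] L) :
    hatOp u F n c = F (n - 1) (c ∘ₗ lmul 𝕂 u) + ((-1 : 𝕂) ^ n) • (ι 𝕂 u * F n c) := rfl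

/-- This relation lets the recursion descend to the exterior algebra. The outer terms contain `u ∧
u`; the cross terms have signs `(-1)^(n-1)` and `(-1)^n` and cancel. -/
theorem hatOp_mul_self (u : L) : hatOp (𝕂 := 𝕂) u * hatOp u = 0 := by
  ext F n c
  have h1 : (c ∘ₗ lmul 𝕂 u) ∘ₗ lmul 𝕂 u = 0 := by
    ext w
    simp [← mul_assoc]
  simp only [Module.End.mul_apply, hatOp_apply, h1, map_zero, zero_add, mul_add, mul_smul_comm,
    ← mul_assoc, ι_sq_zero, zero_mul, smul_zero, add_zero, zpow_sub_one₀ (neg_ne_zero.2 (one_ne_zero (α := 𝕂)))]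
  simp

/-- The coderivation of the exterior algebra of degree `n` with corestriction `c`. -/
def hat (n : ℤ) : (ExteriorAlgebra 𝕂 L →ₗ[𝕂] L) →ₗ[𝕂] Module.End 𝕂 (ExteriorAlgebra 𝕂 L) :=
  LinearMap.mk₂ 𝕂 (fun c w => ExteriorAlgebra.lift 𝕂 ⟨hatOp, hatOp_mul_self⟩ w
      (fun _ => ι 𝕂 ∘ₗ LinearMap.applyₗ 1) n c)
    (fun _ _ _ => map_add _ _ _) (fun _ _ _ => map_smul _ _ _)
    (fun x y z => by rw [map_add]; rfl) (fun c x y => by rw [map_smul]; rfl)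

theorem hat_one (n : ℤ) (c : ExteriorAlgebra 𝕂 L →ₗ[𝕂] L) : hat n c 1 = ι 𝕂 (c 1) := by
  simp [hat]

theorem hat_ι_mul (n : ℤ) (c : ExteriorAlgebra 𝕂 L →ₗ[𝕂] L) (u : L) (w : ExteriorAlgebra 𝕂 L) :
    hat n c (ι 𝕂 u * w) = hat (n - 1) (c ∘ₗ lmul 𝕂 u) w + ((-1 : 𝕂) ^ n) • (ι 𝕂 u * hat n c w) := by
  simp [hat, hatOp_apply]

/-- Commuting with a vector inserts this vector in the corestriction, so it lowers the number of
arguments by one. -/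
theorem superComm_hat_lmul (n : ℤ) (c : ExteriorAlgebra 𝕂 L →ₗ[𝕂] L) (u : L) :
    superComm 𝕂 n (-1) (hat n c) (lmul 𝕂 u) = hat (n - 1) (c ∘ₗ lmul 𝕂 u) := by
  refine LinearMap.ext fun w => ?_
  have h := apply_ι_mul n (hat n c) u w
  rw [hat_ι_mul] at h
  exact (add_right_cancel h).symm

theorem algebraMapInv_hat (n : ℤ) (c : ExteriorAlgebra 𝕂 L →ₗ[𝕂] L) (w : ExteriorAlgebra 𝕂 L) :
    algebraMapInv (hat n c w) = 0 := by
  revert n c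
  refine exterior_induction (C := fun w => ∀ n c, algebraMapInv (hat n c w) = 0) ?_ ?_ ?_ ?_ w
  · intro n c; rw [hat_one]; simp [algebraMapInv]
  · intro x y hx hy n c; rw [map_add, map_add, hx, hy, add_zero]
  · intro a x hx n c; rw [map_smul, map_smul, hx, smul_zero]
  · intro u x hx n c; rw [hat_ι_mul, map_add, map_smul, map_mul, hx, hx]; simp

theorem ιInv_hat (n : ℤ) (c : ExteriorAlgebra 𝕂 L →ₗ[𝕂] L) (w : ExteriorAlgebra 𝕂 L) :
    ιInv (hat n c w) = c w := by
  revert n c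
  refine exterior_induction (C := fun w => ∀ n c, ιInv (hat n c w) = c w) ?_ ?_ ?_ ?_ w
  · intro n c; rw [hat_one, ι_leftInverse]
  · intro x y hx hy n c; rw [map_add, map_add, hx, hy, map_add]
  · intro a x hx n c; rw [map_smul, map_smul, hx, map_smul]
  · intro u x hx n c
    rw [hat_ι_mul, map_add, map_smul, hx, ιInv_ι_mul, algebraMapInv_hat]
    simp

/-- A corestriction supported on `1` is a single vector, and its coderivation multiplies by it. -/
theorem hat_negOne {c : ExteriorAlgebra 𝕂 L →ₗ[𝕂] L} (h : ∀ u, c ∘ₗ lmul 𝕂 u = 0) :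
    hat (-1) c = lmul 𝕂 (c 1) := by
  refine endo_ext (-1) (by simp [hat_one]) fun u => ?_
  rw [superComm_hat_lmul, h, map_zero]
  refine LinearMap.ext fun w => ?_
  rw [superComm_apply]
  simp [← mul_assoc, ← add_mul, ι_add_mul_swap]

/-- The image of `Λ(f)` is killed if the corestriction is killed by `f`. -/
theorem map_hat {A : Type*} [AddCommGroup A] [Module 𝕂 A] (f : L →ₗ[𝕂] A) (n : ℤ)
    {c : ExteriorAlgebra 𝕂 L →ₗ[𝕂] L} (h : f ∘ₗ c = 0) (w : ExteriorAlgebra 𝕂 L) :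
    ExteriorAlgebra.map f (hat n c w) = 0 := by
  revert n c
  refine exterior_induction (C := fun w => ∀ n c, f ∘ₗ c = 0 →
    ExteriorAlgebra.map f (hat n c w) = 0) ?_ ?_ ?_ ?_ w
  · intro n c h
    rw [hat_one, map_apply_ι, ← LinearMap.comp_apply (f := f), h, LinearMap.zero_apply, map_zero]
  · intro x y hx hy n c h; rw [map_add, map_add, hx n c h, hy n c h, add_zero]
  · intro a x hx n c h; rw [map_smul, map_smul, hx n c h, smul_zero]
  · intro u x hx n c h
    rw [hat_ι_mul, map_add, map_smul, map_mul, hx n c h, hx, mul_zero, smul_zero, add_zero]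
    rw [← LinearMap.comp_assoc, h, LinearMap.zero_comp]

/-- The extension of an endomorphism of `L` to a derivation of the exterior algebra. -/
def derOp : Module.End 𝕂 L →ₗ[𝕂] Module.End 𝕂 (ExteriorAlgebra 𝕂 L) :=
  hat 0 ∘ₗ (ιInv : ExteriorAlgebra 𝕂 L →ₗ[𝕂] L).lcomp 𝕂 L

theorem derOp_apply (δ : Module.End 𝕂 L) : derOp δ = hat 0 (δ ∘ₗ ιInv) := rfl

theorem derOp_one (δ : Module.End 𝕂 L) : derOp δ 1 = 0 := by
  simp [derOp_apply, hat_one, ιInv_one]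

theorem superComm_derOp_lmul (δ : Module.End 𝕂 L) (u : L) :
    superComm 𝕂 0 (-1) (derOp δ) (lmul 𝕂 u) = lmul 𝕂 (δ u) := by
  rw [derOp_apply, superComm_hat_lmul, zero_sub, hat_negOne]
  · simp [ι_leftInverse u]
  · intro v
    refine LinearMap.ext fun w => ?_
    simp [ιInv_ι_mul, algebraMapInv]

theorem derOp_ι_mul (δ : Module.End 𝕂 L) (u : L) (w : ExteriorAlgebra 𝕂 L) :
    derOp δ (ι 𝕂 u * w) = ι 𝕂 (δ u) * w + ι 𝕂 u * derOp δ w := by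
  rw [apply_ι_mul 0, superComm_derOp_lmul, zpow_zero, one_smul, lmul_apply]

theorem superComm_derOp_derOp (δ δ' : Module.End 𝕂 L) :
    superComm 𝕂 0 0 (derOp δ) (derOp δ') = derOp (δ * δ' - δ' * δ) := by
  refine endo_ext 0 (by simp [superComm_apply, derOp_one]) fun u => ?_
  have h := superComm_jacobi (𝕂 := 𝕂) 0 0 (-1) (derOp δ) (derOp δ') (lmul 𝕂 u)
  simp only [zero_add, superComm_derOp_lmul, zero_mul, zpow_zero, one_smul, add_zero] at h ⊢
  rw [h, superComm_swap (-1) 0, superComm_derOp_lmul]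
  simp [sub_eq_add_neg]

end Hat

/-! ### The operator of a Lie bracket -/

section BracketOp

variable {𝕂 : Type*} [Field 𝕂] {L : Type*} [AddCommGroup L] [Module 𝕂 L]
  (br : L →ₗ[𝕂] L →ₗ[𝕂] L) (hbr : ∀ u, br u u = 0)

/-- An alternating bilinear map, as an alternating map of two variables. -/
def bilinAlt : L [⋀^Fin 2]→ₗ[𝕂] L where
  toFun v := br (v 0) (v 1)
  map_update_add' := by
    intro inst v i x y
    rw [Subsingleton.elim inst (instDecidableEqFin 2)]
    fin_cases i <;> simp
  map_update_smul' := by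
    intro inst v i c x
    rw [Subsingleton.elim inst (instDecidableEqFin 2)]
    fin_cases i <;> simp
  map_eq_zero_of_eq' := by
    intro v i j h hij
    have : v 0 = v 1 := by
      fin_cases i <;> fin_cases j <;> simp_all
    change br (v 0) (v 1) = 0
    rw [this, hbr]

/-- The extension of an alternating bilinear map to a coderivation of the exterior algebra. -/
def brOp : Module.End 𝕂 (ExteriorAlgebra 𝕂 L) :=
  hat 1 (evalAlt 2 (bilinAlt br hbr))

theorem brOp_one : brOp br hbr 1 = 0 := by
  rw [brOp, hat_one, evalAlt_succ_one, map_zero]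

theorem superComm_brOp_lmul (u : L) :
    superComm 𝕂 1 (-1) (brOp br hbr) (lmul 𝕂 u) = derOp (br u) := by
  rw [brOp, superComm_hat_lmul, derOp_apply, sub_self]
  congr 1
  refine LinearMap.ext fun w => ?_
  rw [LinearMap.comp_apply, lmul_apply, evalAlt_succ_ι_mul, evalAlt_one]
  rfl

theorem brOp_ι_mul (u : L) (w : ExteriorAlgebra 𝕂 L) :
    brOp br hbr (ι 𝕂 u * w) = derOp (br u) w - ι 𝕂 u * brOp br hbr w := by
  rw [apply_ι_mul 1, superComm_brOp_lmul, zpow_one, neg_smul, one_smul, sub_eq_add_neg]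

/-- The commutator of the left side with `u` is the derivation extending `br (δ u) + [br u, δ]`,
which is zero by the derivation rule. -/
theorem superComm_brOp_derOp {δ : Module.End 𝕂 L}
    (hδ : ∀ u v, δ (br u v) = br (δ u) v + br u (δ v)) :
    superComm 𝕂 1 0 (brOp br hbr) (derOp δ) = 0 := by
  refine endo_ext 1 (by simp [superComm_apply, derOp_one, brOp_one]) fun u => ?_
  have h := superComm_jacobi (𝕂 := 𝕂) 1 0 (-1) (brOp br hbr) (derOp δ) (lmul 𝕂 u)
  simp only [zero_add, add_zero, superComm_derOp_lmul, superComm_brOp_lmul, zero_mul, zpow_zero,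
    one_smul, Int.reduceAdd, Int.reduceNeg, superComm_derOp_derOp] at h
  rw [h, map_zero, LinearMap.zero_apply, ← map_add]
  have h0 : br (δ u) + (br u * δ - δ * br u) = 0 := by
    ext v
    simp [hδ]
  rw [h0, map_zero]

/-- Write `m` for the operator. Jacobi says that `m` commutes with `derOp (br u) = [m, u]`;
expanding this gives `[m², u] = 0`. Together with `m² 1 = 0` this suffices, without dividing by two.
-/
theorem brOp_mul_self (jac : ∀ u v w, br u (br v w) = br (br u v) w + br v (br u w)) :
    brOp br hbr * brOp br hbr = 0 := by
  refine endo_ext 0 (by simp [brOp_one]) fun u => ?_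
  have h := superComm_brOp_derOp br hbr (δ := br u) (fun v w => jac u v w)
  rw [← superComm_brOp_lmul br hbr u] at h
  simp only [superComm_apply] at h ⊢
  simp only [zero_mul, zpow_zero, one_smul, mul_zero, sub_zero, Int.reduceNeg, one_mul,
    mul_add, add_mul, mul_assoc, zpow_neg, zpow_one, inv_neg_one, neg_smul,
    sub_neg_eq_add, add_sub_add_left_eq_sub] at h ⊢
  rw [← h]
  abel

end BracketOp

end LieAlgd

namespace LieAlgd

open GradedSym ExteriorAlgebra

/-! ### Products of vectors, and evaluation of alternating maps -/

section Monomials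

variable {𝕂 : Type*} [Field 𝕂] {L N : Type*} [AddCommGroup L] [Module 𝕂 L]
  [AddCommGroup N] [Module 𝕂 N]

variable (𝕂) in
/-- The product of a list of vectors in the exterior algebra. -/
def mon (l : List L) : ExteriorAlgebra 𝕂 L := (l.map (ι 𝕂)).prod

@[simp] theorem mon_nil : mon 𝕂 ([] : List L) = 1 := rfl

theorem mon_cons (u : L) (l : List L) : mon 𝕂 (u :: l) = ι 𝕂 u * mon 𝕂 l := by
  simp [mon]

theorem map_mon {A : Type*} [AddCommGroup A] [Module 𝕂 A] (f : L →ₗ[𝕂] A) (l : List L) :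
    ExteriorAlgebra.map f (mon 𝕂 l) = mon 𝕂 (l.map f) := by
  induction l with
  | nil => simp
  | cons a l ih => rw [mon_cons, map_mul, ih, map_apply_ι, List.map_cons, mon_cons]

theorem evalAlt_mon (k : ℕ) (X : L [⋀^Fin k]→ₗ[𝕂] N) (l : List L) :
    evalAlt k X (mon 𝕂 l) = onList k X l := by
  induction l generalizing k with
  | nil =>
    cases k with
    | zero => rw [mon_nil, evalAlt_zero_one, onList_nil]
    | succ k => rw [mon_nil, evalAlt_succ_one, onList_of_ne _ (by simp)]
  | cons a l ih =>
    rw [mon_cons]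
    cases k with
    | zero => rw [evalAlt_zero_ι_mul, onList_of_ne _ (by simp)]
    | succ k =>
      rw [evalAlt_succ_ι_mul, ih, onList_cons]
      rfl

theorem ιInv_map {A : Type*} [AddCommGroup A] [Module 𝕂 A] (f : L →ₗ[𝕂] A)
    (w : ExteriorAlgebra 𝕂 L) : ιInv (ExteriorAlgebra.map f w) = f (ιInv w) := by
  refine exterior_induction (C := fun w => ιInv (ExteriorAlgebra.map f w) = f (ιInv w))
    ?_ ?_ ?_ ?_ w
  · rw [map_one, ιInv_one, ιInv_one, map_zero]
  · intro x y hx hy; simp only [map_add, hx, hy]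
  · intro c x hx; simp only [map_smul, hx]
  · intro u x _
    have h : algebraMapInv (ExteriorAlgebra.map f x) = algebraMapInv x := by
      rw [← AlgHom.comp_apply]
      congr 1
      refine hom_ext (LinearMap.ext fun v => ?_)
      simp [algebraMapInv]
    rw [map_mul, map_apply_ι, ιInv_ι_mul, ιInv_ι_mul, map_smul, h]

end Monomials

/-- A decomposition `L = A ⊕ B` of modules. -/
structure ModSplitting (R L A B : Type*) [CommRing R] [AddCommGroup L] [AddCommGroup A]
    [AddCommGroup B] [Module R L] [Module R A] [Module R B] where
  /-- the inclusion of `A` -/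
  i : A →ₗ[R] L
  /-- the inclusion of `B` -/
  j : B →ₗ[R] L
  /-- the projection to `A` -/
  p : L →ₗ[R] A
  /-- the projection to `B` -/
  q : L →ₗ[R] B
  p_i : ∀ a, p (i a) = a
  p_j : ∀ b, p (j b) = 0
  q_i : ∀ a, q (i a) = 0
  q_j : ∀ b, q (j b) = b
  decomp : ∀ u, i (p u) + j (q u) = u

/-! ### Forms over `R` as maps on the exterior algebra over `𝕂` -/

section Forms

variable (𝕂 : Type*) {R A N : Type*} [Field 𝕂] [CommRing R] [Algebra 𝕂 R]
  [AddCommGroup A] [Module 𝕂 A] [Module R A] [IsScalarTower 𝕂 R A]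
  [AddCommGroup N] [Module 𝕂 N] [Module R N] [IsScalarTower 𝕂 R N] [SMulCommClass R 𝕂 N]

/-- Restriction of scalars of alternating maps. -/
def altScalars (k : ℕ) : (A [⋀^Fin k]→ₗ[R] N) →ₗ[𝕂] A [⋀^Fin k]→ₗ[𝕂] N where
  toFun X := { X.toMultilinearMap.restrictScalars 𝕂 with
    map_eq_zero_of_eq' := X.map_eq_zero_of_eq' }
  map_add' _ _ := rfl
  map_smul' _ _ := rfl

@[simp] theorem altScalars_apply (k : ℕ) (X : A [⋀^Fin k]→ₗ[R] N) (a : Fin k → A) :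
    altScalars 𝕂 k X a = X a := rfl

/-- An injective linear map over a field has a left inverse. It makes the projection to forms a
linear map on all operators; the choice is immaterial, as components of multiderivations lie in the
image (`exists_comp_eq`). -/
theorem exists_altScalars_inv (k : ℕ) : ∃ r : (A [⋀^Fin k]→ₗ[𝕂] N) →ₗ[𝕂] A [⋀^Fin k]→ₗ[R] N,
    ∀ X, r (altScalars 𝕂 k X) = X := by
  obtain ⟨r, hr⟩ := LinearMap.exists_leftInverse_of_injective
    (altScalars 𝕂 (R := R) (A := A) (N := N) k) (LinearMap.ker_eq_bot.2 fun X Y h =>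
      AlternatingMap.ext fun a => DFunLike.congr_fun h a)
  exact ⟨r, fun X => DFunLike.congr_fun hr X⟩

/-- A left inverse of the restriction of scalars. -/
def altScalarsInv (k : ℕ) : (A [⋀^Fin k]→ₗ[𝕂] N) →ₗ[𝕂] A [⋀^Fin k]→ₗ[R] N :=
  (exists_altScalars_inv 𝕂 k).choose

theorem altScalarsInv_altScalars (k : ℕ) (X : A [⋀^Fin k]→ₗ[R] N) :
    altScalarsInv 𝕂 k (altScalars 𝕂 k X) = X := (exists_altScalars_inv 𝕂 k).choose_spec X

/-- A form as a linear map on the exterior algebra. -/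
def ev (k : ℕ) : (A [⋀^Fin k]→ₗ[R] N) →ₗ[𝕂] ExteriorAlgebra 𝕂 A →ₗ[𝕂] N :=
  evalAlt k ∘ₗ altScalars 𝕂 k

theorem ev_mon (k : ℕ) (X : A [⋀^Fin k]→ₗ[R] N) (l : List A) :
    ev 𝕂 k X (mon 𝕂 l) = onList k X l := evalAlt_mon k _ l

theorem ev_zero_one (X : A [⋀^Fin 0]→ₗ[R] N) : ev 𝕂 0 X 1 = X ![] := evalAlt_zero_one _

theorem ev_succ_one {k : ℕ} (X : A [⋀^Fin (k + 1)]→ₗ[R] N) : ev 𝕂 (k + 1) X 1 = 0 :=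
  evalAlt_succ_one _

theorem ev_zero_ι_mul (X : A [⋀^Fin 0]→ₗ[R] N) (a : A) (w : ExteriorAlgebra 𝕂 A) :
    ev 𝕂 0 X (ι 𝕂 a * w) = 0 := evalAlt_zero_ι_mul _ _ _

theorem ev_succ_ι_mul {k : ℕ} (X : A [⋀^Fin (k + 1)]→ₗ[R] N) (a : A) (w : ExteriorAlgebra 𝕂 A) :
    ev 𝕂 (k + 1) X (ι 𝕂 a * w) = ev 𝕂 k (X.curryLeft a) w := evalAlt_succ_ι_mul _ _ _

end Forms

/-! ### Multiderivations -/

section MultiDer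

variable {𝕂 : Type*} (R : Type*) {L : Type*} [Field 𝕂] [CommRing R] [Algebra 𝕂 R]
  [AddCommGroup L] [Module 𝕂 L] [Module R L] [IsScalarTower 𝕂 R L]

/-- The extensions to the exterior algebra of the multiderivations of `L` with `k - 1` arguments
(and zero, for `k = 0`). They are operators of degree `k - 2`. -/
def IsMultiDer : ℕ → Module.End 𝕂 (ExteriorAlgebra 𝕂 L) → Prop
  | 0, D => D = 0
  | 1, D => ∃ u, D = lmul 𝕂 u
  | 2, D => D 1 = 0 ∧ ∃ (δ : L → L) (s : R → R),
      (∀ u, superComm 𝕂 0 (-1) D (lmul 𝕂 u) = lmul 𝕂 (δ u)) ∧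
        ∀ (f : R) u, δ (f • u) = s f • u + f • δ u
  | k + 3, D => D 1 = 0 ∧ ∀ u, IsMultiDer (k + 2) (superComm 𝕂 ((k + 1 : ℕ) : ℤ) (-1) D (lmul 𝕂 u))

variable {R}

theorem IsMultiDer.apply_one {k : ℕ} {D : Module.End 𝕂 (ExteriorAlgebra 𝕂 L)}
    (h : IsMultiDer R (k + 2) D) : D 1 = 0 := by
  cases k <;> exact h.1

theorem superComm_lmul_lmul (u v : L) : superComm 𝕂 (-1) (-1) (lmul 𝕂 u) (lmul 𝕂 v) = 0 := by
  refine LinearMap.ext fun w => ?_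
  rw [superComm_apply]
  simp [← mul_assoc, ← add_mul, ι_add_mul_swap]

theorem IsMultiDer.superComm_lmul {k : ℕ} {D : Module.End 𝕂 (ExteriorAlgebra 𝕂 L)}
    (h : IsMultiDer R (k + 1) D) (u : L) :
    IsMultiDer R k (superComm 𝕂 (k - 1) (-1) D (lmul 𝕂 u)) := by
  match k, h with
  -- Index `0` stands for `-1` arguments, where the only operator is zero; two vectors do commute in
  -- the graded sense.
  | 0, ⟨v, hv⟩ =>
    subst hv
    exact superComm_lmul_lmul v u
  | 1, ⟨_, δ, s, h1, _⟩ => exact ⟨δ u, by simpa using h1 u⟩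
  | k + 2, h =>
    have := h.2 u
    convert this using 2
    push_cast
    ring

theorem isMultiDer_of_superComm_lmul {k : ℕ} {D : Module.End 𝕂 (ExteriorAlgebra 𝕂 L)} (h1 : D 1 = 0)
    (h : ∀ u, IsMultiDer R (k + 2) (superComm 𝕂 (k + 1) (-1) D (lmul 𝕂 u))) :
    IsMultiDer R (k + 3) D := by
  refine ⟨h1, fun u => ?_⟩
  exact_mod_cast h u

theorem IsMultiDer.add {k : ℕ} {D D' : Module.End 𝕂 (ExteriorAlgebra 𝕂 L)}
    (h : IsMultiDer R k D) (h' : IsMultiDer R k D') : IsMultiDer R k (D + D') := by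
  match k, h, h' with
  | 0, h, h' => exact (congr_arg₂ _ h h').trans (add_zero 0)
  | 1, ⟨u, h⟩, ⟨u', h'⟩ => exact ⟨u + u', by rw [h, h', map_add]⟩
  | 2, ⟨h1, δ, s, h2, h3⟩, ⟨h1', δ', s', h2', h3'⟩ =>
    refine ⟨by simp [h1, h1'], δ + δ', s + s', fun u => ?_, fun f u => ?_⟩
    · simp [h2, h2']
    · simp only [Pi.add_apply, h3, h3']
      module
  | k + 3, h, h' =>
    refine ⟨by simp [h.1, h'.1], fun u => ?_⟩
    rw [map_add, LinearMap.add_apply]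
    exact (h.2 u).add (h'.2 u)

theorem IsMultiDer.smul {k : ℕ} {D : Module.End 𝕂 (ExteriorAlgebra 𝕂 L)} (c : 𝕂)
    (h : IsMultiDer R k D) : IsMultiDer R k (c • D) := by
  match k, h with
  | 0, h => exact (congr_arg _ h).trans (smul_zero c)
  | 1, ⟨u, h⟩ => exact ⟨c • u, by rw [h, map_smul]⟩
  | 2, ⟨h1, δ, s, h2, h3⟩ =>
    refine ⟨by simp [h1], c • δ, c • s, fun u => ?_, fun f u => ?_⟩
    · simp [h2]
    · simp only [Pi.smul_apply, h3, smul_add, smul_assoc, smul_comm c f]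
  | k + 3, h =>
    refine ⟨by simp [h.1], fun u => ?_⟩
    rw [map_smul, LinearMap.smul_apply]
    exact (h.2 u).smul c

/-- Multiderivations are closed under the graded commutator. -/
theorem IsMultiDer.superComm {k l : ℕ} {D D' : Module.End 𝕂 (ExteriorAlgebra 𝕂 L)}
    (h : IsMultiDer R (k + 1) D) (h' : IsMultiDer R (l + 1) D') :
    IsMultiDer R (k + l) (superComm 𝕂 (k - 1) (l - 1) D D') := by
  match k, l, h, h' with
  -- Commuting with a vector is a contraction, and two derivative endomorphisms have a commutator
  -- with symbol `[s, s']`. In the other cases the Jacobi identity expresses `[[D, D'], u]` by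
  -- commutators with fewer arguments, so the recursion is on `k + l`.
  | k, 0, h, ⟨u, h'⟩ =>
    subst h'
    simpa using h.superComm_lmul u
  | 0, l + 1, ⟨u, h⟩, h' =>
    subst h
    rw [superComm_swap]
    refine .smul _ ?_
    have := h'.superComm_lmul u
    simp only [zero_add, Nat.cast_zero, zero_sub]
    exact this
  | 1, 1, ⟨h1, δ, s, h2, h3⟩, ⟨h1', δ', s', h2', h3'⟩ =>
    simp only [Nat.cast_one, sub_self]
    refine ⟨by simp [superComm_apply, h1, h1'], fun u => δ (δ' u) - δ' (δ u),
      fun f => s (s' f) - s' (s f), fun u => ?_, fun f u => ?_⟩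
    · have h := superComm_jacobi (𝕂 := 𝕂) 0 0 (-1) D D' (lmul 𝕂 u)
      simp only [zero_add, zero_mul, zpow_zero, one_smul, h2, h2'] at h
      rw [h, superComm_swap (-1) 0]
      simp [h2', sub_eq_add_neg]
    -- `IsMultiDer` asks only for a function `δ`. Its additivity follows from `ι (δ w) = [D, w] 1`.
    · have hadd : ∀ u v, δ (u + v) = δ u + δ v := by
        intro u v
        refine ι_leftInverse (R := 𝕂) (M := L) |>.injective ?_
        have e : ∀ w, ι 𝕂 (δ w) = GradedSym.superComm 𝕂 0 (-1) D (lmul 𝕂 w) 1 := by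
          intro w; rw [h2]; simp
        rw [map_add, e, e, e]; simp
      have hadd' : ∀ u v, δ' (u + v) = δ' u + δ' v := by
        intro u v
        refine ι_leftInverse (R := 𝕂) (M := L) |>.injective ?_
        have e : ∀ w, ι 𝕂 (δ' w) = GradedSym.superComm 𝕂 0 (-1) D' (lmul 𝕂 w) 1 := by
          intro w; rw [h2']; simp
        rw [map_add, e, e, e]; simp
      simp only [h3', h3, hadd, hadd']
      module
  | 1, l + 2, h, h' =>
    have e : 1 + (l + 2) = l + 3 := by ring
    rw [e]
    have h1 := h.apply_one
    have h1' := h'.apply_one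
    refine isMultiDer_of_superComm_lmul (by simp [superComm_apply, h1, h1']) fun u => ?_
    have hj := superComm_jacobi (𝕂 := 𝕂) (((1 : ℕ) : ℤ) - 1) (((l + 2 : ℕ) : ℤ) - 1) (-1) D D'
      (lmul 𝕂 u)
    have a1 : ((1 : ℕ) : ℤ) - 1 + (((l + 2 : ℕ) : ℤ) - 1) = l + 1 := by push_cast; ring
    rw [a1] at hj
    rw [hj]
    refine .add ?_ (.smul _ ?_)
    · have := IsMultiDer.superComm (k := 1) (l := l + 1) h (h'.superComm_lmul u)
      rw [show 1 + (l + 1) = l + 2 by ring] at this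
      convert this using 4
      push_cast; ring
    · rw [superComm_swap]
      refine .smul _ ?_
      obtain ⟨v, hv⟩ := h.superComm_lmul u
      rw [hv]
      rw [show ((1 : ℕ) : ℤ) - 1 + -1 = -1 by norm_num]
      exact h'.superComm_lmul v
  | k + 2, l + 1, h, h' =>
    have e : k + 2 + (l + 1) = (k + l) + 3 := by ring
    rw [e]
    have h1 := h.apply_one
    have h1' := h'.apply_one
    refine isMultiDer_of_superComm_lmul (by simp [superComm_apply, h1, h1']) fun u => ?_
    have hj := superComm_jacobi (𝕂 := 𝕂) (((k + 2 : ℕ) : ℤ) - 1) (((l + 1 : ℕ) : ℤ) - 1) (-1) D D'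
      (lmul 𝕂 u)
    have a1 : ((k + 2 : ℕ) : ℤ) - 1 + (((l + 1 : ℕ) : ℤ) - 1) = (k + l : ℕ) + 1 := by
      push_cast; ring
    rw [a1] at hj
    rw [hj]
    refine .add ?_ (.smul _ ?_)
    · have := IsMultiDer.superComm (k := k + 2) (l := l) h (h'.superComm_lmul u)
      rw [show k + 2 + l = k + l + 2 by ring] at this
      convert this using 4
      push_cast; ring
    · have := IsMultiDer.superComm (k := k + 1) (l := l + 1) (h.superComm_lmul u) h'
      rw [show k + 1 + (l + 1) = k + l + 2 by ring] at this
      convert this using 4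
      push_cast; ring
termination_by k + l

end MultiDer

end LieAlgd

namespace LieAlgd

open GradedSym ExteriorAlgebra

/-! ### The derived bracket data of a decomposition `L = A ⊕ B` -/

namespace ModSplitting

variable (𝕂 : Type*) {R L A B : Type*} [Field 𝕂] [CommRing R] [Algebra 𝕂 R]
  [AddCommGroup L] [Module 𝕂 L] [Module R L] [IsScalarTower 𝕂 R L]
  [AddCommGroup A] [Module 𝕂 A] [Module R A] [IsScalarTower 𝕂 R A]
  [AddCommGroup B] [Module 𝕂 B] [Module R B] [IsScalarTower 𝕂 R B] [SMulCommClass R 𝕂 B]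
  (S : ModSplitting R L A B)

/-- The projection of exterior algebras. -/
def extP : ExteriorAlgebra 𝕂 L →ₐ[𝕂] ExteriorAlgebra 𝕂 A :=
  ExteriorAlgebra.map (S.p.restrictScalars 𝕂)

/-- The inclusion of exterior algebras. -/
def extI : ExteriorAlgebra 𝕂 A →ₐ[𝕂] ExteriorAlgebra 𝕂 L :=
  ExteriorAlgebra.map (S.i.restrictScalars 𝕂)

theorem extP_ι_mul (u : L) (w : ExteriorAlgebra 𝕂 L) :
    S.extP 𝕂 (ι 𝕂 u * w) = ι 𝕂 (S.p u) * S.extP 𝕂 w := by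
  rw [extP, map_mul, map_apply_ι]; rfl

theorem extI_ι_mul (a : A) (w : ExteriorAlgebra 𝕂 A) :
    S.extI 𝕂 (ι 𝕂 a * w) = ι 𝕂 (S.i a) * S.extI 𝕂 w := by
  rw [extI, map_mul, map_apply_ι]; rfl

theorem extP_extI (w : ExteriorAlgebra 𝕂 A) : S.extP 𝕂 (S.extI 𝕂 w) = w := by
  have h : (S.p.restrictScalars 𝕂) ∘ₗ (S.i.restrictScalars 𝕂) = LinearMap.id :=
    LinearMap.ext S.p_i
  rw [extP, extI, ← AlgHom.comp_apply, ExteriorAlgebra.map_comp_map, h, ExteriorAlgebra.map_id]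
  rfl

theorem ιInv_extI (w : ExteriorAlgebra 𝕂 A) : ιInv (S.extI 𝕂 w) = S.i (ιInv w) :=
  ιInv_map _ _

theorem extI_mon (l : List A) : S.extI 𝕂 (mon 𝕂 l) = mon 𝕂 (l.map S.i) := map_mon _ _

/-- The coderivation of the exterior algebra of `L` defined by a form on `A` with values in `B`. -/
def hatB (k : ℕ) : (A [⋀^Fin k]→ₗ[R] B) →ₗ[𝕂] Module.End 𝕂 (ExteriorAlgebra 𝕂 L) :=
  hat (k - 1) ∘ₗ (S.extP 𝕂).toLinearMap.lcomp 𝕂 L ∘ₗ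
    LinearMap.compRight 𝕂 (S.j.restrictScalars 𝕂) ∘ₗ ev 𝕂 k

theorem hatB_apply (k : ℕ) (X : A [⋀^Fin k]→ₗ[R] B) : S.hatB 𝕂 k X =
    hat (k - 1) (S.j.restrictScalars 𝕂 ∘ₗ ev 𝕂 k X ∘ₗ (S.extP 𝕂).toLinearMap) := rfl

theorem ιInv_hatB (k : ℕ) (X : A [⋀^Fin k]→ₗ[R] B) (w : ExteriorAlgebra 𝕂 L) :
    ιInv (S.hatB 𝕂 k X w) = S.j (ev 𝕂 k X (S.extP 𝕂 w)) := ιInv_hat _ _ _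

theorem extP_hatB (k : ℕ) (X : A [⋀^Fin k]→ₗ[R] B) (w : ExteriorAlgebra 𝕂 L) :
    S.extP 𝕂 (S.hatB 𝕂 k X w) = 0 :=
  map_hat _ _ (LinearMap.ext fun _ => S.p_j _) _

theorem hatB_succ_one (k : ℕ) (X : A [⋀^Fin (k + 1)]→ₗ[R] B) : S.hatB 𝕂 (k + 1) X 1 = 0 := by
  rw [hatB_apply, hat_one]
  simp [ev_succ_one]

theorem hatB_zero (X : A [⋀^Fin 0]→ₗ[R] B) : S.hatB 𝕂 0 X = lmul 𝕂 (S.j (X ![])) := by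
  rw [hatB_apply, Nat.cast_zero, zero_sub, hat_negOne]
  · simp [ev_zero_one]
  · intro u
    refine LinearMap.ext fun w => ?_
    simp [extP_ι_mul, ev_zero_ι_mul]

theorem superComm_hatB_lmul (k : ℕ) (X : A [⋀^Fin (k + 1)]→ₗ[R] B) (u : L) :
    superComm 𝕂 k (-1) (S.hatB 𝕂 (k + 1) X) (lmul 𝕂 u) = S.hatB 𝕂 k (X.curryLeft (S.p u)) := by
  have e : ((k + 1 : ℕ) : ℤ) - 1 = k := by push_cast; ring
  rw [hatB_apply, hatB_apply, e, superComm_hat_lmul]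
  congr 1
  refine LinearMap.ext fun w => ?_
  simp [extP_ι_mul, ev_succ_ι_mul]

/-- By Jacobi, the commutator with a vector involves the forms contracted with its `A`-component,
which allows a double induction. At the bottom a form is contracted with a vector of `B`, which
gives zero. -/
theorem superComm_hatB_hatB (k l : ℕ) (X : A [⋀^Fin k]→ₗ[R] B) (Y : A [⋀^Fin l]→ₗ[R] B) :
    superComm 𝕂 (k - 1) (l - 1) (S.hatB 𝕂 k X) (S.hatB 𝕂 l Y) = 0 := by
  have key : ∀ (l : ℕ) (Y : A [⋀^Fin (l + 1)]→ₗ[R] B) (b : B),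
      superComm 𝕂 l (-1) (S.hatB 𝕂 (l + 1) Y) (lmul 𝕂 (S.j b)) = 0 := by
    intro l Y b
    rw [superComm_hatB_lmul, S.p_j]
    have : Y.curryLeft (0 : A) = 0 := (AlternatingMap.curryLeftLinearMap Y).map_zero
    rw [this, map_zero]
  induction k generalizing l with
  | zero =>
    rw [hatB_zero]
    cases l with
    | zero => rw [hatB_zero]; simpa using superComm_lmul_lmul _ _
    | succ l =>
      rw [superComm_swap, show ((l + 1 : ℕ) : ℤ) - 1 = l by push_cast; ring]
      have := key l Y (X ![])
      rw [Nat.cast_zero, zero_sub, this, smul_zero]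
  | succ k ihk =>
    induction l with
    | zero =>
      rw [hatB_zero, show ((k + 1 : ℕ) : ℤ) - 1 = k by push_cast; ring, Nat.cast_zero, zero_sub]
      exact key k X _
    | succ l ihl =>
      rw [show ((k + 1 : ℕ) : ℤ) - 1 = k by push_cast; ring,
        show ((l + 1 : ℕ) : ℤ) - 1 = l by push_cast; ring]
      refine endo_ext (k + l) (by simp [superComm_apply, hatB_succ_one]) fun u => ?_
      have h1 := ihl (Y.curryLeft (S.p u))
      have h2 := ihk (l + 1) (X.curryLeft (S.p u)) Y
      rw [show ((k + 1 : ℕ) : ℤ) - 1 = k by push_cast; ring] at h1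
      rw [show ((l + 1 : ℕ) : ℤ) - 1 = l by push_cast; ring] at h2
      rw [superComm_jacobi, superComm_hatB_lmul, superComm_hatB_lmul]
      simp only [← sub_eq_add_neg]
      rw [h1, h2, smul_zero, add_zero, map_zero, LinearMap.zero_apply]

theorem isMultiDer_hatB (k : ℕ) (X : A [⋀^Fin k]→ₗ[R] B) :
    IsMultiDer R (k + 1) (S.hatB 𝕂 k X) := by
  induction k with
  | zero => exact ⟨_, S.hatB_zero 𝕂 X⟩
  | succ k ih =>
    cases k with
    | zero =>
      refine ⟨S.hatB_succ_one 𝕂 0 X, fun u => S.j (X.curryLeft (S.p u) ![]), fun _ => 0,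
        fun u => ?_, fun f u => ?_⟩
      · rw [← hatB_zero, ← superComm_hatB_lmul]; rfl
      · have : X.curryLeft (f • S.p u) = f • X.curryLeft (S.p u) :=
          (AlternatingMap.curryLeftLinearMap X).map_smul _ _
        change S.j (X.curryLeft (S.p (f • u)) ![]) =
          (0 : R) • u + f • S.j (X.curryLeft (S.p u) ![])
        rw [map_smul, this, AlternatingMap.smul_apply, map_smul, zero_smul, zero_add]
    | succ k =>
      refine isMultiDer_of_superComm_lmul (S.hatB_succ_one 𝕂 _ X) fun u => ?_
      have := S.superComm_hatB_lmul 𝕂 (k + 1) X u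
      push_cast at this
      rw [this]
      exact ih _

/-- The component of an operator on the exterior algebra of `L` on the `k`-th exterior power of `A`,
with values in `B`. -/
def comp (k : ℕ) : Module.End 𝕂 (ExteriorAlgebra 𝕂 L) →ₗ[𝕂] A [⋀^Fin k]→ₗ[𝕂] B where
  toFun D := (S.q.restrictScalars 𝕂 ∘ₗ ιInv ∘ₗ D ∘ₗ (S.extI 𝕂).toLinearMap).compAlternatingMap
    (ιMulti 𝕂 k)
  map_add' D D' := by ext; simp
  map_smul' c D := by ext; simp

theorem comp_apply (k : ℕ) (D : Module.End 𝕂 (ExteriorAlgebra 𝕂 L)) (a : Fin k → A) :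
    S.comp 𝕂 k D a = S.q (ιInv (D (S.extI 𝕂 (mon 𝕂 (List.ofFn a))))) := by
  have : ιMulti 𝕂 k a = mon 𝕂 (List.ofFn a) := by
    rw [ιMulti_apply, mon, List.map_ofFn]; rfl
  rw [← this]; rfl

theorem comp_hatB (k : ℕ) (X : A [⋀^Fin k]→ₗ[R] B) :
    S.comp 𝕂 k (S.hatB 𝕂 k X) = altScalars 𝕂 k X := by
  refine AlternatingMap.ext fun a => ?_
  rw [comp_apply, ιInv_hatB, extP_extI, ev_mon, onList_ofFn, S.q_j]; rfl

/-- The correction `± a ∧ D w` has a multiple of `a` as its linear part, and `q` kills it. Hence the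
sign, and with it `n`, is arbitrary, and components on `A` can be computed by contractions. -/
theorem q_ιInv_apply_ι_mul (n : ℤ) (D : Module.End 𝕂 (ExteriorAlgebra 𝕂 L)) (a : A)
    (w : ExteriorAlgebra 𝕂 L) : S.q (ιInv (D (ι 𝕂 (S.i a) * w))) =
      S.q (ιInv (superComm 𝕂 n (-1) D (lmul 𝕂 (S.i a)) w)) := by
  have h : ∀ c : 𝕂, S.q (c • S.i a) = 0 := by
    intro c
    rw [LinearMap.map_smul_of_tower, S.q_i, smul_zero]
  rw [apply_ι_mul n, map_add, map_smul, ιInv_ι_mul, map_add, smul_smul, h, add_zero]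

theorem comp_succ (k : ℕ) (n : ℤ) (D : Module.End 𝕂 (ExteriorAlgebra 𝕂 L)) (a : Fin (k + 1) → A) :
    S.comp 𝕂 (k + 1) D a =
      S.comp 𝕂 k (superComm 𝕂 n (-1) D (lmul 𝕂 (S.i (a 0)))) (Fin.tail a) := by
  rw [comp_apply, comp_apply, List.ofFn_succ, mon_cons, extI_ι_mul, S.q_ιInv_apply_ι_mul 𝕂 n]
  rfl

/-- After contraction with the other arguments a derivative endomorphism is left; its symbol term is
a multiple of a section of `A`, so `q` kills it. -/
theorem comp_update_smul {k : ℕ} {D : Module.End 𝕂 (ExteriorAlgebra 𝕂 L)}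
    (h : IsMultiDer R (k + 1) D) (t : Fin k) (a : Fin k → A) (f : R) (x : A) :
    S.comp 𝕂 k D (Function.update a t (f • x)) = f • S.comp 𝕂 k D (Function.update a t x) := by
  induction k generalizing D with
  | zero => exact t.elim0
  | succ k ih =>
    have hs : ∀ (s : Fin k) (a : Fin (k + 1) → A),
        S.comp 𝕂 (k + 1) D (Function.update a s.succ (f • x)) =
          f • S.comp 𝕂 (k + 1) D (Function.update a s.succ x) := by
      intro s a
      rw [S.comp_succ 𝕂 k (((k + 1 : ℕ) : ℤ) - 1), S.comp_succ 𝕂 k (((k + 1 : ℕ) : ℤ) - 1)]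
      simp only [Fin.tail_update_succ]
      rw [Function.update_of_ne (Fin.succ_ne_zero s).symm,
        Function.update_of_ne (Fin.succ_ne_zero s).symm]
      exact ih (h.superComm_lmul _) _ _
    refine Fin.cases ?_ (fun s => hs s a) t
    match k, h, hs with
    | 0, ⟨_, δ, s, h2, h3⟩, _ =>
      have e : ∀ y, S.comp 𝕂 1 D (Function.update a 0 y) = S.q (δ (S.i y)) := by
        intro y
        rw [S.comp_succ 𝕂 0 0, comp_apply, Function.update_self, h2]
        simp [ι_leftInverse (R := 𝕂) (δ (S.i y))]
      rw [e, e, map_smul, h3, map_add, map_smul, map_smul, S.q_i, smul_zero, zero_add]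
    -- The first slot cannot be reached by contracting the first argument; by alternation it is
    -- exchanged with the second one.
    | k + 1, _, hs =>
      have e : ∀ y, S.comp 𝕂 (k + 2) D (Function.update a 0 y) =
          -S.comp 𝕂 (k + 2) D (Function.update (a ∘ Equiv.swap 0 1) (Fin.succ 0) y) := by
        intro y
        rw [← AlternatingMap.map_swap _ _ (show (0 : Fin (k + 2)) ≠ 1 by simp)]
        congr 1
        rw [Function.update_comp_equiv, Function.comp_assoc, ← Equiv.coe_trans]
        simp
      rw [e, e, hs, smul_neg]

theorem exists_comp_eq {k : ℕ} {D : Module.End 𝕂 (ExteriorAlgebra 𝕂 L)}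
    (h : IsMultiDer R (k + 1) D) : ∃ X : A [⋀^Fin k]→ₗ[R] B, S.comp 𝕂 k D = altScalars 𝕂 k X :=
  ⟨{ toFun := S.comp 𝕂 k D
     map_update_add' := fun a t x y => (S.comp 𝕂 k D).map_update_add a t x y
     map_update_smul' := fun {inst} a t f x => by
      rw [Subsingleton.elim inst (instDecidableEqFin k)]
      exact S.comp_update_smul 𝕂 h t a f x
     map_eq_zero_of_eq' := (S.comp 𝕂 k D).map_eq_zero_of_eq' }, rfl⟩

/-- The operators that preserve the exterior algebra of `A`. -/
def Preserves (D : Module.End 𝕂 (ExteriorAlgebra 𝕂 L)) : Prop :=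
  ∀ w, D (S.extI 𝕂 w) ∈ (S.extI 𝕂).toLinearMap.range

theorem extI_mem_range (w : ExteriorAlgebra 𝕂 A) :
    S.extI 𝕂 w ∈ (S.extI 𝕂).toLinearMap.range := ⟨w, rfl⟩

theorem Preserves.superComm {n k : ℤ} {D D' : Module.End 𝕂 (ExteriorAlgebra 𝕂 L)}
    (h : S.Preserves 𝕂 D) (h' : S.Preserves 𝕂 D') : S.Preserves 𝕂 (superComm 𝕂 n k D D') := by
  intro w
  rw [superComm_apply]
  refine sub_mem ?_ (Submodule.smul_mem _ _ ?_)
  · obtain ⟨v, hv⟩ := h' w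
    rw [Module.End.mul_apply, ← hv]
    exact h v
  · obtain ⟨v, hv⟩ := h w
    rw [Module.End.mul_apply, ← hv]
    exact h' v

theorem Preserves.comp_eq_zero {D : Module.End 𝕂 (ExteriorAlgebra 𝕂 L)} (h : S.Preserves 𝕂 D)
    (k : ℕ) : S.comp 𝕂 k D = 0 := by
  refine AlternatingMap.ext fun a => ?_
  obtain ⟨v, hv⟩ := h (mon 𝕂 (List.ofFn a))
  rw [comp_apply, ← hv]
  exact (congr_arg S.q (S.ιInv_extI 𝕂 v)).trans (S.q_i _)

/-- Contractions of `D` with vectors of `A` again have zero component, so by induction both terms of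
`D(a ∧ w) = [D, a] w ± a ∧ D w` stay in the exterior algebra of `A`. -/
theorem preserves_of_comp_eq_zero {k : ℕ} {D : Module.End 𝕂 (ExteriorAlgebra 𝕂 L)}
    (h : IsMultiDer R (k + 1) D) (h0 : S.comp 𝕂 k D = 0) : S.Preserves 𝕂 D := by
  induction k generalizing D with
  | zero =>
    obtain ⟨u, rfl⟩ := h
    have hu : S.q u = 0 := by
      have := DFunLike.congr_fun h0 ![]
      simpa [comp_apply, ι_leftInverse (R := 𝕂) u] using this
    intro w
    have hi : u = S.i (S.p u) := by
      conv_lhs => rw [← S.decomp u, hu, map_zero, add_zero]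
    rw [hi, lmul_apply, ← extI_ι_mul]
    exact S.extI_mem_range 𝕂 _
  | succ k ih =>
    intro w
    refine exterior_induction (C := fun w => D (S.extI 𝕂 w) ∈ (S.extI 𝕂).toLinearMap.range)
      ?_ ?_ ?_ ?_ w
    · rw [map_one, h.apply_one]; exact zero_mem _
    · intro x y hx hy; rw [map_add, map_add]; exact add_mem hx hy
    · intro c x hx; rw [map_smul, map_smul]; exact Submodule.smul_mem _ _ hx
    · intro a x ⟨v, hv⟩
      rw [extI_ι_mul, apply_ι_mul (((k + 1 : ℕ) : ℤ) - 1)]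
      refine add_mem (ih (h.superComm_lmul _) ?_ x) (Submodule.smul_mem _ _ ?_)
      · refine AlternatingMap.ext fun b => ?_
        have := S.comp_succ 𝕂 k (((k + 1 : ℕ) : ℤ) - 1) D (Fin.cons a b)
        rw [h0, Fin.cons_zero, Fin.tail_cons] at this
        exact this.symm
      · rw [← hv, AlgHom.toLinearMap_apply, ← extI_ι_mul]
        exact S.extI_mem_range 𝕂 _

/-- The sign in the embedding of the `k`-forms. -/
def formSign (k : ℕ) : 𝕂 := (-1) ^ (k * (k + 1) / 2)

theorem formSign_succ (k : ℕ) : formSign 𝕂 (k + 1) = (-1) ^ (k + 1) * formSign 𝕂 k := by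
  rw [formSign, formSign, ← pow_add]
  congr 1
  have : (k + 1) * (k + 1 + 1) = k * (k + 1) + 2 * (k + 1) := by ring
  omega

theorem formSign_mul_self (k : ℕ) : formSign 𝕂 k * formSign 𝕂 k = 1 := by
  rw [formSign, ← mul_pow]; simp

/-- The projection of the operators of degree `n` to the forms with values in `B`. -/
def formProj (n : ℤ) : Module.End 𝕂 (ExteriorAlgebra 𝕂 L) →ₗ[𝕂] ⨁ k : ℕ, A [⋀^Fin k]→ₗ[R] B :=
  DirectSum.lof 𝕂 ℕ (fun k => A [⋀^Fin k]→ₗ[R] B) (n + 1).toNat ∘ₗ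
    (formSign 𝕂 (n + 1).toNat • (altScalarsInv 𝕂 (n + 1).toNat ∘ₗ S.comp 𝕂 (n + 1).toNat))

theorem formProj_apply {n : ℤ} {k : ℕ} (h : n = k - 1) (D : Module.End 𝕂 (ExteriorAlgebra 𝕂 L)) :
    S.formProj 𝕂 n D = DirectSum.lof 𝕂 ℕ (fun k => A [⋀^Fin k]→ₗ[R] B) k
      (formSign 𝕂 k • altScalarsInv 𝕂 k (S.comp 𝕂 k D)) := by
  obtain rfl : (n + 1).toNat = k := by omega
  rfl

/-- The operators of degree `n` on the exterior algebra of `L` given by multiderivations. -/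
def multiDers (n : ℤ) : Set (Module.End 𝕂 (ExteriorAlgebra 𝕂 L)) :=
  {D | D = 0 ∨ ∃ k : ℕ, n = k - 1 ∧ IsMultiDer R (k + 1) D}

variable {S 𝕂}

theorem mem_multiDers {k : ℕ} {D : Module.End 𝕂 (ExteriorAlgebra 𝕂 L)}
    (h : IsMultiDer R (k + 1) D) : D ∈ multiDers 𝕂 (R := R) ((k : ℤ) - 1) :=
  Or.inr ⟨k, rfl, h⟩

theorem multiDers_sub_smul {n : ℤ} {D D' : Module.End 𝕂 (ExteriorAlgebra 𝕂 L)}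
    (h : D ∈ multiDers 𝕂 (R := R) n) (h' : D' ∈ multiDers 𝕂 (R := R) n) (c : 𝕂) :
    D + c • D' ∈ multiDers 𝕂 (R := R) n := by
  rcases h with rfl | ⟨k, hk, h⟩
  · rcases h' with rfl | ⟨l, hl, h'⟩
    · exact Or.inl (by simp)
    · rw [zero_add]; exact Or.inr ⟨l, hl, h'.smul c⟩
  · rcases h' with rfl | ⟨l, hl, h'⟩
    · rw [smul_zero, add_zero]; exact Or.inr ⟨k, hk, h⟩
    · obtain rfl : k = l := by omega
      exact Or.inr ⟨k, hk, h.add (h'.smul c)⟩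

theorem multiDers_superComm {n m : ℤ} {D D' : Module.End 𝕂 (ExteriorAlgebra 𝕂 L)}
    (h : D ∈ multiDers 𝕂 (R := R) n) (h' : D' ∈ multiDers 𝕂 (R := R) m) :
    superComm 𝕂 n m D D' ∈ multiDers 𝕂 (R := R) (n + m) := by
  rcases h with rfl | ⟨k, rfl, h⟩
  · exact Or.inl (by simp)
  rcases h' with rfl | ⟨l, rfl, h'⟩
  · exact Or.inl (by simp)
  have := h.superComm h'
  by_cases h0 : k + l = 0
  · rw [h0] at this
    exact Or.inl this
  · obtain ⟨r, hr⟩ := Nat.exists_eq_succ_of_ne_zero h0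
    rw [hr] at this
    exact Or.inr ⟨r, by omega, this⟩

theorem preserves_of_formProj_eq_zero {n : ℤ} {D : Module.End 𝕂 (ExteriorAlgebra 𝕂 L)}
    (h : D ∈ multiDers 𝕂 (R := R) n) (h0 : S.formProj 𝕂 n D = 0) : S.Preserves 𝕂 D := by
  rcases h with rfl | ⟨k, hk, h⟩
  · exact fun w => zero_mem _
  refine S.preserves_of_comp_eq_zero 𝕂 h ?_
  obtain ⟨X, hX⟩ := S.exists_comp_eq 𝕂 h
  rw [S.formProj_apply 𝕂 hk, hX, altScalarsInv_altScalars] at h0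
  have h1 : formSign 𝕂 k • X = 0 :=
    DirectSum.of_injective (β := fun k => A [⋀^Fin k]→ₗ[R] B) k (h0.trans (map_zero _).symm)
  have h2 := congr_arg (formSign 𝕂 k • ·) h1
  simp only [smul_smul, formSign_mul_self, one_smul, smul_zero] at h2
  rw [hX, h2, map_zero]

theorem Preserves.formProj_eq_zero {D : Module.End 𝕂 (ExteriorAlgebra 𝕂 L)}
    (h : S.Preserves 𝕂 D) (n : ℤ) : S.formProj 𝕂 n D = 0 := by
  simp [formProj, h.comp_eq_zero]

variable (S 𝕂)

/-- The embedding of the forms with values in `B` in the operators on the exterior algebra. -/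
def formEmb (k : ℕ) : (A [⋀^Fin k]→ₗ[R] B) →ₗ[𝕂] Module.End 𝕂 (ExteriorAlgebra 𝕂 L) :=
  formSign 𝕂 k • S.hatB 𝕂 k

theorem formEmb_mem {n : ℤ} {k : ℕ} {X : A [⋀^Fin k]→ₗ[R] B} (h : (k : ℤ) - 1 = n ∨ X = 0) :
    S.formEmb 𝕂 k X ∈ multiDers 𝕂 (R := R) n := by
  rcases h with rfl | rfl
  · exact mem_multiDers ((S.isMultiDer_hatB 𝕂 k X).smul _)
  · exact Or.inl (map_zero _)

theorem formProj_formEmb {n : ℤ} {k : ℕ} {X : A [⋀^Fin k]→ₗ[R] B} (h : (k : ℤ) - 1 = n ∨ X = 0) :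
    S.formProj 𝕂 n (S.formEmb 𝕂 k X) = DirectSum.lof 𝕂 ℕ (fun k => A [⋀^Fin k]→ₗ[R] B) k X := by
  rcases h with rfl | rfl
  · rw [S.formProj_apply 𝕂 rfl]
    simp only [formEmb, LinearMap.smul_apply, map_smul, comp_hatB, altScalarsInv_altScalars,
      smul_smul, formSign_mul_self, one_smul]
  · simp only [map_zero]

theorem preserves_sub_formEmb {n : ℤ} {k : ℕ} {X : A [⋀^Fin k]→ₗ[R] B}
    (h : (k : ℤ) - 1 = n ∨ X = 0) {D : Module.End 𝕂 (ExteriorAlgebra 𝕂 L)}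
    (hD : D ∈ multiDers 𝕂 (R := R) n)
    (hX : S.formProj 𝕂 n D = DirectSum.lof 𝕂 ℕ (fun k => A [⋀^Fin k]→ₗ[R] B) k X) :
    S.Preserves 𝕂 (D - S.formEmb 𝕂 k X) := by
  refine preserves_of_formProj_eq_zero (n := n) ?_ ?_
  · have := multiDers_sub_smul hD (S.formEmb_mem 𝕂 h) (-1)
    rwa [neg_one_smul, ← sub_eq_add_neg] at this
  · rw [map_sub, hX, formProj_formEmb 𝕂 S h, sub_self]

theorem superComm_formEmb_formEmb (k l : ℕ) (X : A [⋀^Fin k]→ₗ[R] B) (Y : A [⋀^Fin l]→ₗ[R] B) :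
    superComm 𝕂 (k - 1) (l - 1) (S.formEmb 𝕂 k X) (S.formEmb 𝕂 l Y) = 0 := by
  simp only [formEmb, LinearMap.smul_apply, map_smul, superComm_hatB_hatB, smul_zero]

/-- The derived bracket construction for the multiderivations of `L = A ⊕ B`. -/
def derivedBracketData : DerivedBracketData 𝕂 (fun k : ℕ => A [⋀^Fin k]→ₗ[R] B)
    (fun k : ℕ => (k : ℤ) - 1) (Module.End 𝕂 (ExteriorAlgebra 𝕂 L)) where
  emb := S.formEmb 𝕂
  proj := S.formProj 𝕂
  W := multiDers 𝕂 (R := R)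
  emb_comm k l X Y := by
    have := S.superComm_formEmb_formEmb 𝕂 k l X Y
    rw [superComm_apply] at this
    exact sub_eq_zero.1 this
  superComm_emb h k X := multiDers_superComm h (S.formEmb_mem 𝕂 (.inl rfl))
  proj_homogeneous := by
    rintro n D (rfl | ⟨k, hk, h⟩)
    -- The zero operator belongs to every degree, also to those below `-1`, where commutators of two
    -- vectors end up.
    · exact ⟨0, 0, by simp, .inr rfl⟩
    · exact ⟨k, _, S.formProj_apply 𝕂 hk D, .inl hk.symm⟩
  proj_superComm := by
    intro n m D D' hD hD' k l X Y hX hk hY hl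
    have e1 := S.preserves_sub_formEmb 𝕂 hk hD hX
    have e2 := S.preserves_sub_formEmb 𝕂 hl hD' hY
    -- Both `D - X` and `D' - Y` preserve the exterior algebra of `A`, hence so does their
    -- commutator; the claim is the expansion of its vanishing projection.
    have e3 := (e1.superComm 𝕂 S e2 (n := n) (k := m)).formProj_eq_zero (n + m)
    have e4 : superComm 𝕂 n m (S.formEmb 𝕂 k X) (S.formEmb 𝕂 l Y) = 0 := by
      rcases hk with rfl | rfl
      · rcases hl with rfl | rfl
        · exact S.superComm_formEmb_formEmb 𝕂 k l X Y
        · simp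
      · simp
    simp only [map_sub, LinearMap.sub_apply, e4, sub_zero] at e3
    -- The degree of `Y` is that of `D'` unless `Y = 0`, and then both sides vanish.
    have e5 : S.formProj 𝕂 (n + (l - 1)) (superComm 𝕂 n (l - 1) D (S.formEmb 𝕂 l Y)) =
        S.formProj 𝕂 (n + m) (superComm 𝕂 n m D (S.formEmb 𝕂 l Y)) := by
      rcases hl with rfl | rfl
      · rfl
      · simp
    have e6 : S.formProj 𝕂 (m + (k - 1)) (superComm 𝕂 m (k - 1) D' (S.formEmb 𝕂 k X)) =
        S.formProj 𝕂 (m + n) (superComm 𝕂 m n D' (S.formEmb 𝕂 k X)) := by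
      rcases hk with rfl | rfl
      · rfl
      · simp
    rw [e5, e6, ← sub_eq_zero, ← e3, superComm_swap n m (S.formEmb 𝕂 k X) D', add_comm m n]
    simp only [map_smul, neg_smul, map_neg]
    abel

end ModSplitting

end LieAlgd

namespace LieAlgd

open GradedSym ExteriorAlgebra

/-! ### Operators evaluated on products of vectors -/

section Expansions

variable {𝕂 : Type*} [Field 𝕂]

/-- All comparisons of signs go through this lemma; the witness given for `Even` is half the
difference of the exponents. -/
theorem negOne_zpow_congr {a b : ℤ} (h : Even (a - b)) : (-1 : 𝕂) ^ a = (-1) ^ b := by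
  obtain ⟨c, hc⟩ := h
  obtain rfl : a = b + (c + c) := by omega
  rw [negOne_zpow_add, negOne_zpow_add, negOne_zpow_sq, mul_one]

theorem negOne_pow_zsmul {N : Type*} [AddCommGroup N] [Module 𝕂 N] (k : ℕ) (x : N) :
    ((-1 : ℤ) ^ k) • x = ((-1 : 𝕂) ^ (k : ℤ)) • x := by
  rw [← Int.cast_smul_eq_zsmul 𝕂]
  push_cast
  rw [zpow_natCast]

section Shuf

variable {N N' : Type*} [AddCommGroup N] [Module 𝕂 N] [AddCommGroup N'] [Module 𝕂 N'] {G : Type*}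

theorem linear_shuf (f : N →ₗ[𝕂] N') (l : List G) (T : List G → List G → N) :
    f (shuf l T) = shuf l fun u v => f (T u v) := map_shuf f.toAddMonoidHom l T

theorem shuf_singleton {k : ℕ} (a : Fin (k + 1) → G) {T : List G → List G → N}
    (hT : ∀ u v, u.length ≠ 1 → T u v = 0) :
    shuf (List.ofFn a) T =
      ∑ i : Fin (k + 1), ((-1 : ℤ) ^ (i : ℕ)) • T [a i] (List.ofFn (i.removeNth a)) := by
  induction k generalizing T with
  | zero =>
    have : List.ofFn a = [a 0] := by simp
    rw [this]
    simp [shuf, hT [] [a 0] (by simp)]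
  | succ k ih =>
    rw [List.ofFn_succ, shuf, shuf_eq_left_nil, ih (fun i => a i.succ), Fin.sum_univ_succ (n := k + 1)]
    · congr 1
      · simp only [Fin.val_zero, pow_zero, one_smul, Fin.removeNth_zero]
        rfl
      · refine Finset.sum_congr rfl fun i _ => ?_
        rw [List.ofFn_succ (f := i.succ.removeNth a)]
        simp only [List.length_singleton, Fin.val_succ, pow_succ, mul_smul]
        simp only [pow_zero, one_smul, Fin.removeNth, Fin.succ_succAbove_zero,
          Fin.succ_succAbove_succ]
        rfl
    · intro u v hu
      rw [hT u _ hu, smul_zero]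
    · intro u v hu
      exact hT _ _ (by simpa using hu)

/-- Bringing the entries `i < j` to the front has sign `(-1)^(i+j-1)`, which explains the overall
minus. The inner index runs over the positions left after removing `j`. -/
theorem shuf_pair {k : ℕ} (a : Fin (k + 2) → G) {T : List G → List G → N}
    (hT : ∀ u v, u.length ≠ 2 → T u v = 0) :
    shuf (List.ofFn a) T = -∑ j : Fin (k + 2), ∑ i : Fin (k + 1), if i.castSucc < j then
      ((-1 : ℤ) ^ ((i : ℕ) + (j : ℕ))) •
        T [a i.castSucc, a j] (List.ofFn (i.removeNth (j.removeNth a))) else 0 := by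
  have hs : ∀ {k : ℕ} (a : Fin (k + 2) → G) {T : List G → List G → N}
      (_ : ∀ u v, u.length ≠ 2 → T u v = 0),
      shuf (List.ofFn (Fin.tail a)) (fun u v => T (a 0 :: u) v) =
        ∑ j : Fin (k + 1), ((-1 : ℤ) ^ (j : ℕ)) •
          T [a 0, a j.succ] (List.ofFn (j.removeNth (Fin.tail a))) := by
    intro k a T hT
    rw [shuf_singleton]
    · rfl
    · intro u v hu
      exact hT _ _ (by simpa using hu)
  induction k generalizing T with
  | zero =>
    rw [List.ofFn_succ, shuf]
    have h1 := hs a hT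
    have h2 : (shuf (List.ofFn fun i : Fin 1 => a i.succ)
        fun u v => ((-1 : ℤ) ^ u.length) • T u (a 0 :: v)) = 0 := by
      have : (List.ofFn fun i : Fin 1 => a i.succ) = [a 1] := by simp
      rw [this]
      simp [shuf, hT [a 1] _ (by simp), hT [] _ (by simp)]
    rw [h2, add_zero]
    refine h1.trans ?_
    simp [Fin.sum_univ_succ]
  | succ k ih =>
    rw [List.ofFn_succ, shuf]
    have h1 := hs a hT
    have h2 := ih (Fin.tail a) (T := fun u v => ((-1 : ℤ) ^ u.length) • T u (a 0 :: v))
      (fun u v hu => by rw [hT u _ hu, smul_zero])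
    refine (congr_arg₂ (· + ·) h1 h2).trans ?_
    rw [Fin.sum_univ_succ (f := fun j : Fin (k + 3) => _)]
    simp only [Fin.not_lt_zero, if_false, Finset.sum_const_zero, zero_add]
    have h3 : ∀ j : Fin (k + 2), (∑ i : Fin (k + 2), if i.castSucc < j.succ then
        ((-1 : ℤ) ^ ((i : ℕ) + (j.succ : ℕ))) •
          T [a i.castSucc, a j.succ] (List.ofFn (i.removeNth (j.succ.removeNth a))) else 0) =
        -(((-1 : ℤ) ^ (j : ℕ)) • T [a 0, a j.succ] (List.ofFn (j.removeNth (Fin.tail a)))) +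
        ∑ i : Fin (k + 1), if i.castSucc < j then
          ((-1 : ℤ) ^ ((i : ℕ) + (j : ℕ))) • ((-1 : ℤ) ^ 2) •
            T [Fin.tail a i.castSucc, Fin.tail a j]
              (a 0 :: List.ofFn (i.removeNth (j.removeNth (Fin.tail a)))) else 0 := by
      intro j
      rw [Fin.sum_univ_succ]
      congr 1
      · rw [if_pos (by simp)]
        simp only [Fin.val_zero, Fin.val_succ, zero_add, pow_succ, mul_neg, mul_one, neg_smul,
          Fin.castSucc_zero, Fin.removeNth_zero]
        congr 5
        funext t
        simp [Fin.removeNth, Fin.tail]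
      · refine Finset.sum_congr rfl fun i _ => ?_
        have e : (i.succ.castSucc < j.succ) ↔ (i.castSucc < j) := by
          rw [← Fin.succ_castSucc, Fin.succ_lt_succ_iff]
        simp only [e]
        refine if_congr Iff.rfl ?_ rfl
        rw [List.ofFn_succ]
        simp only [Fin.val_succ, even_two, Even.neg_pow, one_pow, one_smul, Fin.removeNth,
          Fin.succ_succAbove_zero, Fin.succ_succAbove_succ, Fin.tail, Fin.succ_castSucc]
        congr 1
        ring
    simp only [h3, Finset.sum_add_distrib, Finset.sum_neg_distrib, neg_add, neg_neg]
    rfl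

end Shuf

theorem shuf_map {N G G' : Type*} [AddCommGroup N] (f : G → G') (l : List G)
    (T : List G' → List G' → N) :
    shuf (l.map f) T = shuf l fun u v => T (u.map f) (v.map f) := by
  induction l generalizing T with
  | nil => rfl
  | cons a l ih => simp only [List.map_cons, shuf, ih, List.length_map]

variable {L : Type*} [AddCommGroup L] [Module 𝕂 L]

theorem ιInv_mon_of_ne {l : List L} (h : l.length ≠ 1) : ιInv (mon 𝕂 l) = 0 := by
  match l, h with
  | [], _ => rw [mon_nil, ιInv_one]
  | u :: v :: l, _ =>
    rw [mon_cons, mon_cons, ιInv_ι_mul]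
    simp [algebraMapInv]

@[simp] theorem ιInv_mon_singleton (u : L) : ιInv (mon 𝕂 [u]) = u := by
  rw [mon_cons, mon_nil, mul_one, ι_leftInverse]

/-- A coderivation of the exterior algebra is a sum over shuffles. -/
theorem hat_mon {k : ℕ} {n : ℤ} (hn : n = k - 1) {c : ExteriorAlgebra 𝕂 L →ₗ[𝕂] L} {l : List L}
    (hc : ∀ u : List L, u.length ≠ k → c (mon 𝕂 u) = 0) :
    hat n c (mon 𝕂 l) = shuf l fun u v => ι 𝕂 (c (mon 𝕂 u)) * mon 𝕂 v := by
  induction l generalizing k n c with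
  | nil => simp [shuf, hat_one]
  | cons a l ih =>
    have hc' : ∀ u : List L, (c ∘ₗ lmul 𝕂 a) (mon 𝕂 u) = c (mon 𝕂 (a :: u)) := by
      intro u; rw [mon_cons]; rfl
    have h1 : hat (n - 1) (c ∘ₗ lmul 𝕂 a) (mon 𝕂 l) =
        shuf l fun u v => ι 𝕂 (c (mon 𝕂 (a :: u))) * mon 𝕂 v := by
      cases k with
      -- If `c` lives on the empty list only, inserting `a` makes it vanish on all products.
      | zero =>
        have h0 : ∀ u : List L, (c ∘ₗ lmul 𝕂 a) (mon 𝕂 u) = 0 := fun u => by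
          rw [hc', hc _ (by simp)]
        have h2 : ∀ n, hat n (c ∘ₗ lmul 𝕂 a) (mon 𝕂 l) = 0 := by
          intro n
          have key : ∀ (l : List L) (n : ℤ) (c : ExteriorAlgebra 𝕂 L →ₗ[𝕂] L),
              (∀ u : List L, c (mon 𝕂 u) = 0) → hat n c (mon 𝕂 l) = 0 := by
            intro l
            induction l with
            | nil => intro n c h; rw [mon_nil, hat_one, ← mon_nil, h, map_zero]
            | cons b l ih =>
              intro n c h
              rw [mon_cons, hat_ι_mul, ih _ _ h, ih, mul_zero, smul_zero, add_zero]
              intro u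
              rw [LinearMap.comp_apply, lmul_apply, ← mon_cons, h]
          exact key l n _ h0
        rw [h2]
        simp only [← hc', h0, map_zero, zero_mul, shuf_zero]
      | succ k =>
        rw [ih (k := k) (n := n - 1) (c := c ∘ₗ lmul 𝕂 a) (by rw [hn]; push_cast; ring)]
        · simp only [hc']
        · intro u hu
          rw [hc', hc _ (by simpa using hu)]
    rw [mon_cons, hat_ι_mul, h1, ih hn hc, shuf]
    congr 1
    rw [← lmul_apply, linear_shuf, ← shuf_smul]
    refine shuf_congr fun u v _ => ?_
    -- Moving `a` past the vector `c u` gives `-1`, which together with `(-1)^(k-1)` is the sign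
    -- `(-1)^k` of the shuffle.
    by_cases hu : u.length = k
    · have hs : ι 𝕂 a * ι 𝕂 (c (mon 𝕂 u)) = -(ι 𝕂 (c (mon 𝕂 u)) * ι 𝕂 a) :=
        eq_neg_of_add_eq_zero_left (ι_add_mul_swap _ _)
      rw [lmul_apply, mon_cons, ← mul_assoc, hs, ← mul_assoc, negOne_pow_zsmul (𝕂 := 𝕂), hu, hn,
        neg_mul, smul_neg, ← neg_smul, sub_eq_add_neg, negOne_zpow_add]
      simp
    · rw [hc u hu]
      simp

variable {br : L →ₗ[𝕂] L →ₗ[𝕂] L} {hbr : ∀ u, br u u = 0}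

theorem brOp_mon {k : ℕ} (a : Fin (k + 2) → L) :
    brOp br hbr (mon 𝕂 (List.ofFn a)) = -∑ j : Fin (k + 2), ∑ i : Fin (k + 1),
      if i.castSucc < j then ((-1 : ℤ) ^ ((i : ℕ) + (j : ℕ))) •
        (ι 𝕂 (br (a i.castSucc) (a j)) * mon 𝕂 (List.ofFn (i.removeNth (j.removeNth a)))) else 0 := by
  have h : ∀ u : List L, u.length ≠ 2 → evalAlt 2 (bilinAlt br hbr) (mon 𝕂 u) = 0 := by
    intro u hu
    rw [evalAlt_mon, onList_of_ne _ hu]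
  rw [brOp, hat_mon (k := 2) (by norm_num) h, shuf_pair]
  · have e : ∀ x y, evalAlt 2 (bilinAlt br hbr) (mon 𝕂 [x, y]) = br x y := by
      intro x y
      have := onList_ofFn (bilinAlt br hbr) ![x, y]
      rw [evalAlt_mon]
      refine Eq.trans ?_ (this.trans rfl)
      simp
    simp only [e]
  · intro u v hu
    rw [h u hu, map_zero, zero_mul]

theorem brOp_mon_singleton (u : L) : brOp br hbr (mon 𝕂 [u]) = 0 := by
  rw [mon_cons, mon_nil, brOp_ι_mul, derOp_one, brOp_one, mul_zero, sub_zero]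

theorem ιInv_brOp_ι_mul (u : L) (w : ExteriorAlgebra 𝕂 L) :
    ιInv (brOp br hbr (ι 𝕂 u * w)) = br u (ιInv w) := by
  rw [brOp, ιInv_hat, evalAlt_succ_ι_mul, evalAlt_one]; rfl

theorem ιInv_derOp (δ : Module.End 𝕂 L) (w : ExteriorAlgebra 𝕂 L) :
    ιInv (derOp δ w) = δ (ιInv w) := ιInv_hat _ _ _

variable {R N : Type*} [CommRing R] [Algebra 𝕂 R] [Module R L] [IsScalarTower 𝕂 R L]
  [AddCommGroup N] [Module 𝕂 N] [Module R N] [IsScalarTower 𝕂 R N] [SMulCommClass R 𝕂 N]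

theorem ev_derOp_mon (k : ℕ) (X : L [⋀^Fin k]→ₗ[R] N) (δ : Module.End 𝕂 L) (l : List L) :
    ev 𝕂 k X (derOp δ (mon 𝕂 l)) =
      onList k (fun u => ∑ i : Fin k, X (Function.update u i (δ (u i)))) l := by
  induction l generalizing k with
  | nil =>
    rw [mon_nil, derOp_one, map_zero]
    cases k with
    | zero => rw [onList_nil]; simp
    | succ k => rw [onList_of_ne _ (by simp)]
  | cons a l ih =>
    rw [mon_cons, derOp_ι_mul, map_add]
    cases k with
    | zero => rw [ev_zero_ι_mul, ev_zero_ι_mul, onList_of_ne _ (by simp), add_zero]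
    | succ k =>
      rw [ev_succ_ι_mul, ev_succ_ι_mul, ev_mon, ih, onList_cons, ← onList_add]
      congr 1
      funext u
      rw [Fin.sum_univ_succ]
      congr 1
      · rw [Fin.cons_zero, Fin.update_cons_zero]; rfl
      · refine Finset.sum_congr rfl fun i _ => ?_
        rw [Fin.cons_succ, ← Fin.cons_update]; rfl

end Expansions

/-! ### Operators of forms, and projections to `A` -/

namespace ModSplitting

variable {𝕂 R L A B : Type*} [Field 𝕂] [CommRing R] [Algebra 𝕂 R]
  [AddCommGroup L] [Module 𝕂 L] [Module R L] [IsScalarTower 𝕂 R L]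
  [AddCommGroup A] [Module 𝕂 A] [Module R A] [IsScalarTower 𝕂 R A]
  [AddCommGroup B] [Module 𝕂 B] [Module R B] [IsScalarTower 𝕂 R B] [SMulCommClass R 𝕂 B]
  (S : ModSplitting R L A B)

theorem hatB_mon (k : ℕ) (X : A [⋀^Fin k]→ₗ[R] B) (l : List A) :
    S.hatB 𝕂 k X (S.extI 𝕂 (mon 𝕂 l)) =
      shuf l fun u v => ι 𝕂 (S.j (onList k X u)) * S.extI 𝕂 (mon 𝕂 v) := by
  have hp : ∀ u : List L, S.extP 𝕂 (mon 𝕂 u) = mon 𝕂 (u.map S.p) := fun u => map_mon _ _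
  have hc : ∀ u : List L, (S.j.restrictScalars 𝕂 ∘ₗ ev 𝕂 k X ∘ₗ (S.extP 𝕂).toLinearMap) (mon 𝕂 u) =
      S.j (onList k X (u.map S.p)) := by
    intro u
    simp [hp, ev_mon]
  rw [extI_mon, hatB_apply, hat_mon (k := k) rfl, shuf_map]
  · refine shuf_congr fun u v _ => ?_
    rw [hc, List.map_map, extI_mon, show S.p ∘ S.i = id from funext S.p_i, List.map_id]
  · intro u hu
    rw [hc, onList_of_ne _ (by simpa using hu), map_zero]

/-- Multiplication by a vector of `B` is the operator of a `0`-form, and operators of forms commute.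
-/
theorem hatB_j_mul (k : ℕ) (X : A [⋀^Fin k]→ₗ[R] B) (b : B) (w : ExteriorAlgebra 𝕂 L) :
    S.hatB 𝕂 k X (ι 𝕂 (S.j b) * w) = ((-1 : 𝕂) ^ ((k : ℤ) - 1)) • (ι 𝕂 (S.j b) * S.hatB 𝕂 k X w) := by
  have h : superComm 𝕂 ((k : ℤ) - 1) (-1) (S.hatB 𝕂 k X) (lmul 𝕂 (S.j b)) = 0 := by
    have := S.superComm_hatB_hatB 𝕂 k 0 X (AlternatingMap.constOfIsEmpty R A (Fin 0) b)
    rw [hatB_zero] at this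
    simpa using this
  rw [apply_ι_mul ((k : ℤ) - 1), h, LinearMap.zero_apply, zero_add]

variable (𝕂) in
/-- The compression to `A` of an endomorphism of `L`. -/
def endA (δ : Module.End 𝕂 L) : Module.End 𝕂 A :=
  S.p.restrictScalars 𝕂 ∘ₗ δ ∘ₗ S.i.restrictScalars 𝕂

theorem endA_apply (δ : Module.End 𝕂 L) (a : A) : S.endA 𝕂 δ a = S.p (δ (S.i a)) := rfl

theorem extP_derOp_extI (δ : Module.End 𝕂 L) (w : ExteriorAlgebra 𝕂 A) :
    S.extP 𝕂 (derOp δ (S.extI 𝕂 w)) = derOp (S.endA 𝕂 δ) w := by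
  refine exterior_induction (C := fun w => S.extP 𝕂 (derOp δ (S.extI 𝕂 w)) =
    derOp (S.endA 𝕂 δ) w) ?_ ?_ ?_ ?_ w
  · rw [map_one, derOp_one, derOp_one, map_zero]
  · intro x y hx hy; simp only [map_add, hx, hy]
  · intro c x hx; simp only [map_smul, hx]
  · intro a x hx
    rw [extI_ι_mul, derOp_ι_mul, map_add, extP_ι_mul, extP_ι_mul, extP_extI, hx, derOp_ι_mul,
      S.p_i, endA_apply]

theorem extP_derOp_j_mul (δ : Module.End 𝕂 L) (b : B) (w : ExteriorAlgebra 𝕂 L) :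
    S.extP 𝕂 (derOp δ (ι 𝕂 (S.j b) * w)) = ι 𝕂 (S.p (δ (S.j b))) * S.extP 𝕂 w := by
  rw [derOp_ι_mul, map_add, extP_ι_mul, extP_ι_mul, S.p_j, map_zero, zero_mul, add_zero]

variable {br : L →ₗ[𝕂] L →ₗ[𝕂] L} {hbr : ∀ u, br u u = 0}

theorem extP_brOp_extI {brA : A →ₗ[𝕂] A →ₗ[𝕂] A} {hbrA : ∀ a, brA a a = 0}
    (h : ∀ a a', S.p (br (S.i a) (S.i a')) = brA a a') (w : ExteriorAlgebra 𝕂 A) :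
    S.extP 𝕂 (brOp br hbr (S.extI 𝕂 w)) = brOp brA hbrA w := by
  refine exterior_induction (C := fun w => S.extP 𝕂 (brOp br hbr (S.extI 𝕂 w)) =
    brOp brA hbrA w) ?_ ?_ ?_ ?_ w
  · rw [map_one, brOp_one, brOp_one, map_zero]
  · intro x y hx hy; simp only [map_add, hx, hy]
  · intro c x hx; simp only [map_smul, hx]
  · intro a x hx
    have e : S.endA 𝕂 (br (S.i a)) = brA a := LinearMap.ext (h a)
    rw [extI_ι_mul, brOp_ι_mul, map_sub, extP_derOp_extI, extP_ι_mul, hx, brOp_ι_mul, S.p_i, e]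

/-- The projection kills a remaining factor from `B`, so the bracket must consume it. -/
theorem extP_brOp_j_mul (b : B) (w : ExteriorAlgebra 𝕂 L) :
    S.extP 𝕂 (brOp br hbr (ι 𝕂 (S.j b) * w)) = S.extP 𝕂 (derOp (br (S.j b)) w) := by
  rw [brOp_ι_mul, map_sub, extP_ι_mul, S.p_j, map_zero, zero_mul, sub_zero]

theorem extP_brOp_j_mul_j_mul (b b' : B) (w : ExteriorAlgebra 𝕂 L) :
    S.extP 𝕂 (brOp br hbr (ι 𝕂 (S.j b) * (ι 𝕂 (S.j b') * w))) =
      ι 𝕂 (S.p (br (S.j b) (S.j b'))) * S.extP 𝕂 w := by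
  rw [extP_brOp_j_mul, extP_derOp_j_mul]

/-! ### Vanishing of the higher brackets and actions -/

section Vanishing

variable (𝕂)

/-- The span of the products with at least `m` factors in `B`. -/
def factorsB : ℕ → Submodule 𝕂 (ExteriorAlgebra 𝕂 L)
  | 0 => ⊤
  | m + 1 => Submodule.span 𝕂 {x | ∃ b, ∃ w ∈ factorsB m, x = ι 𝕂 (S.j b) * w}

theorem factorsB_induction {m : ℕ} {p : ExteriorAlgebra 𝕂 L → Prop}
    (mem : ∀ b, ∀ w ∈ S.factorsB 𝕂 m, p (ι 𝕂 (S.j b) * w)) (zero : p 0)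
    (add : ∀ x y, p x → p y → p (x + y)) (smul : ∀ (c : 𝕂) x, p x → p (c • x))
    {w : ExteriorAlgebra 𝕂 L} (hw : w ∈ S.factorsB 𝕂 (m + 1)) : p w := by
  refine Submodule.span_induction (p := fun x _ => p x) ?_ zero (fun x y _ _ => add x y)
    (fun c x _ => smul c x) hw
  rintro _ ⟨b, w, hw, rfl⟩
  exact mem b w hw

/-- The operator of a form creates one factor in `B` and, up to sign, passes through those already
present. -/
theorem hatB_mem_factorsB {m : ℕ} {w : ExteriorAlgebra 𝕂 L} (hw : w ∈ S.factorsB 𝕂 m) (k : ℕ)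
    (X : A [⋀^Fin k]→ₗ[R] B) : S.hatB 𝕂 k X w ∈ S.factorsB 𝕂 (m + 1) := by
  induction m generalizing w with
  | zero =>
    clear hw
    have hj : ∀ b (w : ExteriorAlgebra 𝕂 L), ι 𝕂 (S.j b) * w ∈ S.factorsB 𝕂 1 :=
      fun b w => Submodule.subset_span ⟨b, w, Submodule.mem_top, rfl⟩
    revert k X
    refine exterior_induction (C := fun w => ∀ (k : ℕ) (X : A [⋀^Fin k]→ₗ[R] B),
      S.hatB 𝕂 k X w ∈ S.factorsB 𝕂 1) ?_ ?_ ?_ ?_ w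
    · intro k X
      cases k with
      | zero => rw [hatB_zero]; exact hj _ _
      | succ k => rw [hatB_succ_one]; exact zero_mem _
    · intro x y hx hy k X; rw [map_add]; exact add_mem (hx k X) (hy k X)
    · intro c x hx k X; rw [map_smul]; exact Submodule.smul_mem _ _ (hx k X)
    · intro u x hx k X
      cases k with
      | zero => rw [hatB_zero]; exact hj _ _
      | succ k =>
        rw [apply_ι_mul k, superComm_hatB_lmul]
        refine add_mem (hx _ _) (Submodule.smul_mem _ _ ?_)
        refine S.factorsB_induction 𝕂 (p := fun y => ι 𝕂 u * y ∈ S.factorsB 𝕂 1) ?_ ?_ ?_ ?_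
          (hx (k + 1) X)
        · intro b w _
          have hs : ι 𝕂 u * ι 𝕂 (S.j b) = -(ι 𝕂 (S.j b) * ι 𝕂 u) :=
            eq_neg_of_add_eq_zero_left (ι_add_mul_swap _ _)
          rw [← mul_assoc, hs, neg_mul, mul_assoc]
          exact neg_mem (hj _ _)
        · rw [mul_zero]; exact zero_mem _
        · intro x y hx hy; rw [mul_add]; exact add_mem hx hy
        · intro c x hx; rw [mul_smul_comm]; exact Submodule.smul_mem _ _ hx
  | succ m ih =>
    refine S.factorsB_induction 𝕂 (p := fun w => S.hatB 𝕂 k X w ∈ S.factorsB 𝕂 (m + 2))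
      ?_ ?_ ?_ ?_ hw
    · intro b w hw
      rw [hatB_j_mul]
      exact Submodule.smul_mem _ _ (Submodule.subset_span ⟨b, _, ih hw, rfl⟩)
    · rw [map_zero]; exact zero_mem _
    · intro x y hx hy; rw [map_add]; exact add_mem hx hy
    · intro c x hx; rw [map_smul]; exact Submodule.smul_mem _ _ hx

theorem linearMap_factorsB_eq_zero {N : Type*} [AddCommGroup N] [Module 𝕂 N]
    {f : ExteriorAlgebra 𝕂 L →ₗ[𝕂] N} {m : ℕ}
    (h : ∀ b, ∀ w ∈ S.factorsB 𝕂 m, f (ι 𝕂 (S.j b) * w) = 0) {w : ExteriorAlgebra 𝕂 L}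
    (hw : w ∈ S.factorsB 𝕂 (m + 1)) : f w = 0 := by
  refine S.factorsB_induction 𝕂 (p := fun w => f w = 0) h (map_zero f) ?_ ?_ hw
  · intro x y hx hy; rw [map_add, hx, hy, add_zero]
  · intro c x hx; rw [map_smul, hx, smul_zero]

theorem extP_factorsB_one {w : ExteriorAlgebra 𝕂 L} (hw : w ∈ S.factorsB 𝕂 1) : S.extP 𝕂 w = 0 :=
  S.linearMap_factorsB_eq_zero 𝕂 (f := (S.extP 𝕂).toLinearMap) (fun b w _ => by
    rw [AlgHom.toLinearMap_apply, extP_ι_mul, S.p_j, map_zero, zero_mul]) hw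

/-- A derivation changes only one factor, so one of the two factors in `B` survives and is killed by
the projection. The bracket consumes two factors, hence the bound three in the next lemma. -/
theorem extP_derOp_factorsB_two (δ : Module.End 𝕂 L) {w : ExteriorAlgebra 𝕂 L}
    (hw : w ∈ S.factorsB 𝕂 2) : S.extP 𝕂 (derOp δ w) = 0 :=
  S.linearMap_factorsB_eq_zero 𝕂 (f := (S.extP 𝕂).toLinearMap ∘ₗ derOp δ) (fun b w hw => by
    rw [LinearMap.comp_apply, AlgHom.toLinearMap_apply, extP_derOp_j_mul,
      S.extP_factorsB_one 𝕂 hw, mul_zero]) hw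

theorem extP_brOp_factorsB_three {w : ExteriorAlgebra 𝕂 L}
    (hw : w ∈ S.factorsB 𝕂 3) : S.extP 𝕂 (brOp br hbr w) = 0 :=
  S.linearMap_factorsB_eq_zero 𝕂 (f := (S.extP 𝕂).toLinearMap ∘ₗ brOp br hbr) (fun b w hw => by
    rw [LinearMap.comp_apply, AlgHom.toLinearMap_apply, extP_brOp_j_mul,
      S.extP_derOp_factorsB_two 𝕂 _ hw]) hw

theorem algebraMapInv_factorsB_one {w : ExteriorAlgebra 𝕂 L} (hw : w ∈ S.factorsB 𝕂 1) :
    algebraMapInv w = 0 :=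
  S.linearMap_factorsB_eq_zero 𝕂 (f := (algebraMapInv (R := 𝕂) (M := L)).toLinearMap)
    (fun b w _ => by simp [algebraMapInv]) hw

theorem ιInv_factorsB_two {w : ExteriorAlgebra 𝕂 L} (hw : w ∈ S.factorsB 𝕂 2) : ιInv w = 0 :=
  S.linearMap_factorsB_eq_zero 𝕂 (fun b w hw => by
    rw [ιInv_ι_mul, S.algebraMapInv_factorsB_one 𝕂 hw, zero_smul]) hw

theorem ιInv_brOp_factorsB_three {w : ExteriorAlgebra 𝕂 L} (hw : w ∈ S.factorsB 𝕂 3) :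
    ιInv (brOp br hbr w) = 0 :=
  S.linearMap_factorsB_eq_zero 𝕂 (f := ιInv ∘ₗ brOp br hbr) (fun b w hw => by
    rw [LinearMap.comp_apply, ιInv_brOp_ι_mul, S.ιInv_factorsB_two 𝕂 hw, map_zero]) hw

/-- In the second term of the commutator the form stands leftmost, so only the `A`-components of `D
w` matter. With the next lemma, where such a term disappears, this shows that at most one form can
stand to the left of `D` in an iterated commutator. -/
theorem q_ιInv_superComm_hatB (n : ℤ) (D : Module.End 𝕂 (ExteriorAlgebra 𝕂 L)) (k : ℕ)
    (X : A [⋀^Fin k]→ₗ[R] B) (w : ExteriorAlgebra 𝕂 L) :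
    S.q (ιInv (superComm 𝕂 n (k - 1) D (S.hatB 𝕂 k X) w)) = S.q (ιInv (D (S.hatB 𝕂 k X w))) -
      ((-1 : 𝕂) ^ (n * (k - 1))) • ev 𝕂 k X (S.extP 𝕂 (D w)) := by
  rw [superComm_apply]
  simp only [LinearMap.sub_apply, LinearMap.smul_apply, Module.End.mul_apply, map_sub, map_smul,
    ιInv_hatB, LinearMap.map_smul_of_tower, S.q_j]

theorem extP_superComm_hatB (n : ℤ) (D : Module.End 𝕂 (ExteriorAlgebra 𝕂 L)) (k : ℕ)
    (X : A [⋀^Fin k]→ₗ[R] B) (w : ExteriorAlgebra 𝕂 L) :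
    S.extP 𝕂 (superComm 𝕂 n (k - 1) D (S.hatB 𝕂 k X) w) = S.extP 𝕂 (D (S.hatB 𝕂 k X w)) := by
  rw [superComm_apply]
  simp only [LinearMap.sub_apply, LinearMap.smul_apply, Module.End.mul_apply, map_sub, map_smul,
    extP_hatB, smul_zero, sub_zero]

theorem factorsB_succ_le (m : ℕ) : S.factorsB 𝕂 (m + 1) ≤ S.factorsB 𝕂 m := by
  induction m with
  | zero => exact le_top
  | succ m ih =>
    refine Submodule.span_mono ?_
    rintro _ ⟨b, w, hw, rfl⟩
    exact ⟨b, w, ih hw, rfl⟩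

theorem factorsB_antitone : Antitone (S.factorsB 𝕂) := antitone_nat_of_succ_le (S.factorsB_succ_le 𝕂)

/-- Iterated brackets with sufficiently many forms vanish. -/
theorem q_ιInv_iterBracket_eq_zero (l : List (Σ k : ℕ, A [⋀^Fin k]→ₗ[R] B)) (n : ℤ)
    {D : Module.End 𝕂 (ExteriorAlgebra 𝕂 L)}
    (h1 : ∀ m, l.length ≤ m + 1 → ∀ w ∈ S.factorsB 𝕂 m, S.extP 𝕂 (D w) = 0)
    (h2 : ∀ w ∈ S.factorsB 𝕂 l.length, S.q (ιInv (D w)) = 0) (w : ExteriorAlgebra 𝕂 L) :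
    S.q (ιInv (((S.derivedBracketData 𝕂).iterBracket n D l).2 w)) = 0 := by
  induction l generalizing n D with
  | nil => exact h2 w Submodule.mem_top
  | cons X l ih =>
    have e : superComm 𝕂 n ((X.1 : ℤ) - 1) D ((S.derivedBracketData 𝕂).emb X.1 X.2) =
        formSign 𝕂 X.1 • superComm 𝕂 n ((X.1 : ℤ) - 1) D (S.hatB 𝕂 X.1 X.2) :=
      (superComm 𝕂 n ((X.1 : ℤ) - 1) D).map_smul (formSign 𝕂 X.1) (S.hatB 𝕂 X.1 X.2)
    -- The form adds a factor in `B`: vanishing of `D` on `m + 1` such factors becomes vanishing of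
    -- `[D, X]` on `m` of them.
    refine ih _ ?_ ?_
    · intro m hm w hw
      rw [e, LinearMap.smul_apply, map_smul, extP_superComm_hatB,
        h1 (m + 1) (by simpa using hm) _ (S.hatB_mem_factorsB 𝕂 hw _ _), smul_zero]
    · intro w hw
      rw [e, LinearMap.smul_apply, map_smul, LinearMap.map_smul_of_tower, q_ιInv_superComm_hatB,
        h2 _ (S.hatB_mem_factorsB 𝕂 hw _ _), h1 l.length le_rfl w hw]
      simp

theorem formProj_iterBracket_eq_zero (l : List (Σ k : ℕ, A [⋀^Fin k]→ₗ[R] B)) (n : ℤ)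
    {D : Module.End 𝕂 (ExteriorAlgebra 𝕂 L)}
    (h1 : ∀ m, l.length ≤ m + 1 → ∀ w ∈ S.factorsB 𝕂 m, S.extP 𝕂 (D w) = 0)
    (h2 : ∀ w ∈ S.factorsB 𝕂 l.length, S.q (ιInv (D w)) = 0) (k : ℤ) :
    S.formProj 𝕂 k ((S.derivedBracketData 𝕂).iterBracket n D l).2 = 0 := by
  have : S.comp 𝕂 (k + 1).toNat ((S.derivedBracketData 𝕂).iterBracket n D l).2 = 0 := by
    refine AlternatingMap.ext fun a => ?_
    rw [comp_apply, S.q_ιInv_iterBracket_eq_zero 𝕂 l n h1 h2]; rfl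
  simp [formProj, this]

/-- Of three forms at least two stand to the right of `δ`, which is too many for one argument. For
the bracket, below, four forms leave at least three on the right. -/
theorem pr1_act_derOp_eq_zero (δ : Module.End 𝕂 L) (n : ℤ)
    {l : List (Σ k : ℕ, A [⋀^Fin k]→ₗ[R] B)} (hl : 3 ≤ l.length) :
    pr1 𝕂 _ _ ((S.derivedBracketData 𝕂).act n (derOp δ) (prodOf _ l)) = 0 := by
  rw [DerivedBracketData.pr1_act_prodOf]
  refine S.formProj_iterBracket_eq_zero 𝕂 l n (fun m hm w hw => ?_) (fun w hw => ?_) _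
  · exact S.extP_derOp_factorsB_two 𝕂 δ (S.factorsB_antitone 𝕂 (by omega) hw)
  · rw [ιInv_derOp, S.ιInv_factorsB_two 𝕂 (S.factorsB_antitone 𝕂 (by omega) hw), map_zero, map_zero]

theorem pr1_act_brOp_eq_zero (n : ℤ) {l : List (Σ k : ℕ, A [⋀^Fin k]→ₗ[R] B)}
    (hl : 4 ≤ l.length) :
    pr1 𝕂 _ _ ((S.derivedBracketData 𝕂).act n (brOp br hbr) (prodOf _ l)) = 0 := by
  rw [DerivedBracketData.pr1_act_prodOf]
  refine S.formProj_iterBracket_eq_zero 𝕂 l n (fun m hm w hw => ?_) (fun w hw => ?_) _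
  · exact S.extP_brOp_factorsB_three 𝕂 (S.factorsB_antitone 𝕂 (by omega) hw)
  · rw [S.ιInv_brOp_factorsB_three 𝕂 (S.factorsB_antitone 𝕂 (by omega) hw), map_zero]

end Vanishing

end ModSplitting

end LieAlgd

namespace LieAlgd

open GradedSym ExteriorAlgebra

/-! ### The explicit derived brackets -/

section Reorder

variable {G N : Type*} [AddCommGroup N]

theorem shuf_shuf_swap (l : List G) (T : List G → List G → List G → N) :
    (shuf l fun u x => shuf x fun v w => T u v w) =
      shuf l fun u x => shuf x fun v w => ((-1 : ℤ) ^ (u.length * v.length)) • T v u w := by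
  rw [← shuf_assoc, ← shuf_assoc]
  refine shuf_congr fun x w _ => ?_
  exact shuf_comm _ _

theorem shuf_shuf_comm (l : List G) (T : List G → List G → List G → N) :
    (shuf l fun u x => shuf x fun v w => T u v w) =
      shuf l fun u x => shuf x fun v w => ((-1 : ℤ) ^ (v.length * w.length)) • T u w v :=
  shuf_congr fun _ _ _ => shuf_comm _ _

end Reorder

theorem neg_negOne_zpow {𝕂 : Type*} [Field 𝕂] (n : ℤ) : -(-1 : 𝕂) ^ n = (-1) ^ (n + 1) := by
  rw [negOne_zpow_add, zpow_one, mul_neg_one]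

namespace ModSplitting

variable {𝕂 R L A B : Type*} [Field 𝕂] [CommRing R] [Algebra 𝕂 R]
  [AddCommGroup L] [Module 𝕂 L] [Module R L] [IsScalarTower 𝕂 R L]
  [AddCommGroup A] [Module 𝕂 A] [Module R A] [IsScalarTower 𝕂 R A]
  [AddCommGroup B] [Module 𝕂 B] [Module R B] [IsScalarTower 𝕂 R B] [SMulCommClass R 𝕂 B]
  (S : ModSplitting R L A B) {br : L →ₗ[𝕂] L →ₗ[𝕂] L} {hbr : ∀ u, br u u = 0}

theorem neg_br (hbr : ∀ u, br u u = 0) (u v : L) : -br u v = br v u := by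
  have h := hbr (u + v)
  simp only [map_add, LinearMap.add_apply, hbr, zero_add, add_zero] at h
  exact (neg_eq_of_add_eq_zero_left h)

variable (𝕂) in
/-- Contraction of a form with `k` arguments: the last `k - 1` arguments are taken from a list. -/
def evCons (k : ℕ) (X : A [⋀^Fin k]→ₗ[R] B) (a : A) (l : List A) : B := ev 𝕂 k X (ι 𝕂 a * mon 𝕂 l)

theorem evCons_of_ne {k : ℕ} (X : A [⋀^Fin k]→ₗ[R] B) (a : A) {l : List A} (h : l.length + 1 ≠ k) :
    evCons 𝕂 k X a l = 0 := by
  rw [evCons, ← mon_cons, ev_mon, onList_of_ne _ (by simpa using h)]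

theorem evCons_zero (k : ℕ) (X : A [⋀^Fin k]→ₗ[R] B) (l : List A) : evCons 𝕂 k X 0 l = 0 := by
  rw [evCons, map_zero, zero_mul, map_zero]

theorem evCons_neg (k : ℕ) (X : A [⋀^Fin k]→ₗ[R] B) (a : A) (l : List A) :
    evCons 𝕂 k X (-a) l = -evCons 𝕂 k X a l := by
  rw [evCons, map_neg, neg_mul, map_neg]; rfl

variable {p q r : ℕ} (X : A [⋀^Fin p]→ₗ[R] B) (Y : A [⋀^Fin q]→ₗ[R] B) (Z : A [⋀^Fin r]→ₗ[R] B)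
  (l : List A)

/-- The form `Y` acts first. Passing `X` through the value of `Y` gives `(-1)^(p-1)`, restoring the
order of the arguments gives `(-1)^(pq)`, and antisymmetry of the bracket gives `-1`. -/
theorem q_ιInv_brOp_hatB_hatB :
    S.q (ιInv (brOp br hbr (S.hatB 𝕂 p X (S.hatB 𝕂 q Y (S.extI 𝕂 (mon 𝕂 l)))))) =
      ((-1 : 𝕂) ^ ((p : ℤ) + p * q)) •
        shuf l fun u v => S.q (br (S.j (onList p X u)) (S.j (onList q Y v))) := by
  have h := linear_shuf (S.q.restrictScalars 𝕂 ∘ₗ ιInv ∘ₗ brOp br hbr ∘ₗ S.hatB 𝕂 p X) l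
    (fun u v => ι 𝕂 (S.j (onList q Y u)) * S.extI 𝕂 (mon 𝕂 v))
  simp only [LinearMap.comp_apply, LinearMap.restrictScalars_apply] at h
  rw [hatB_mon, h, shuf_comm, ← shuf_smul]
  refine shuf_congr fun u v _ => ?_
  rw [hatB_j_mul, map_smul, map_smul, LinearMap.map_smul_of_tower, ιInv_brOp_ι_mul, ιInv_hatB,
    extP_extI, ev_mon, ← neg_br hbr, map_neg, negOne_pow_zsmul (𝕂 := 𝕂), smul_neg, smul_neg, smul_smul,
    ← neg_smul]
  -- The sign of a shuffle depends on the lengths of the lists; terms with other lengths than `p`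
  -- and `q` vanish. The same case distinction recurs below.
  by_cases hu : u.length = p
  · by_cases hv : v.length = q
    · rw [hu, hv, ← negOne_zpow_add, neg_negOne_zpow]
      congr 1
      refine negOne_zpow_congr ?_
      push_cast
      exact ⟨0, by ring⟩
    · simp [onList_of_ne _ hv]
  · simp [onList_of_ne _ hu]

theorem ev_extP_brOp_hatB :
    ev 𝕂 q Y (S.extP 𝕂 (brOp br hbr (S.hatB 𝕂 p X (S.extI 𝕂 (mon 𝕂 l))))) =
      shuf l fun u v => onList q (fun w => ∑ i : Fin q,
        Y (Function.update w i (S.p (br (S.j (onList p X u)) (S.i (w i)))))) v := by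
  have h := linear_shuf (ev 𝕂 q Y ∘ₗ (S.extP 𝕂).toLinearMap ∘ₗ brOp br hbr) l
    (fun u v => ι 𝕂 (S.j (onList p X u)) * S.extI 𝕂 (mon 𝕂 v))
  simp only [LinearMap.comp_apply, AlgHom.toLinearMap_apply] at h
  rw [hatB_mon, h]
  refine shuf_congr fun u v _ => ?_
  rw [extP_brOp_j_mul, extP_derOp_extI, ev_derOp_mon]
  rfl

theorem onList_sum_update_eq_zero {δ : Module.End 𝕂 L} (h : δ = 0) (l : List A) :
    onList q (fun w => ∑ i : Fin q, Y (Function.update w i (S.p (δ (S.i (w i)))))) l = 0 := by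
  subst h
  rw [onList]
  split_ifs
  · simp [AlternatingMap.map_update_zero]
  · rfl

theorem ev_extP_brOp_hatB_comm :
    ev 𝕂 q Y (S.extP 𝕂 (brOp br hbr (S.hatB 𝕂 p X (S.extI 𝕂 (mon 𝕂 l))))) =
      ((-1 : 𝕂) ^ ((p : ℤ) * q)) • shuf l fun v u => onList q (fun w => ∑ i : Fin q,
        Y (Function.update w i (S.p (br (S.j (onList p X u)) (S.i (w i)))))) v := by
  rw [ev_extP_brOp_hatB, shuf_comm, ← shuf_smul]
  refine shuf_congr fun v u _ => ?_
  rw [negOne_pow_zsmul (𝕂 := 𝕂)]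
  by_cases hu : u.length = p
  · by_cases hv : v.length = q
    · rw [hu, hv]
      congr 2
      push_cast
      ring
    · rw [onList_of_ne _ hv, smul_zero, smul_zero]
  · rw [onList_sum_update_eq_zero, smul_zero, smul_zero]
    rw [onList_of_ne _ hu, map_zero, map_zero]

theorem ev_extP_brOp_hatB_hatB :
    ev 𝕂 r Z (S.extP 𝕂 (brOp br hbr (S.hatB 𝕂 p X (S.hatB 𝕂 q Y (S.extI 𝕂 (mon 𝕂 l)))))) =
      ((-1 : 𝕂) ^ ((p : ℤ) + p * q)) • shuf l fun u x => shuf x fun v w =>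
        evCons 𝕂 r Z (S.p (br (S.j (onList p X u)) (S.j (onList q Y v)))) w := by
  have h := linear_shuf (ev 𝕂 r Z ∘ₗ (S.extP 𝕂).toLinearMap ∘ₗ brOp br hbr ∘ₗ S.hatB 𝕂 p X) l
    (fun u v => ι 𝕂 (S.j (onList q Y u)) * S.extI 𝕂 (mon 𝕂 v))
  simp only [LinearMap.comp_apply, AlgHom.toLinearMap_apply] at h
  have h' : ∀ b (v : List A), ev 𝕂 r Z (S.extP 𝕂 (brOp br hbr (S.hatB 𝕂 p X
      (ι 𝕂 (S.j b) * S.extI 𝕂 (mon 𝕂 v))))) = shuf v fun x w => ((-1 : 𝕂) ^ ((p : ℤ) - 1)) •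
        evCons 𝕂 r Z (S.p (br (S.j b) (S.j (onList p X x)))) w := by
    intro b v
    have h := linear_shuf (((-1 : 𝕂) ^ ((p : ℤ) - 1)) • (ev 𝕂 r Z ∘ₗ (S.extP 𝕂).toLinearMap ∘ₗ
      brOp br hbr ∘ₗ lmul 𝕂 (S.j b))) v
      (fun u v => ι 𝕂 (S.j (onList p X u)) * S.extI 𝕂 (mon 𝕂 v))
    simp only [LinearMap.comp_apply, AlgHom.toLinearMap_apply, LinearMap.smul_apply,
      lmul_apply] at h
    rw [hatB_j_mul, map_smul, map_smul, map_smul, hatB_mon, h]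
    refine shuf_congr fun u v _ => ?_
    rw [extP_brOp_j_mul_j_mul, extP_extI]
    rfl
  rw [hatB_mon, h]
  simp only [h']
  rw [shuf_shuf_swap, ← shuf_smul]
  refine shuf_congr fun u x _ => ?_
  rw [← shuf_smul]
  refine shuf_congr fun v w _ => ?_
  rw [← neg_br hbr, map_neg, evCons_neg, negOne_pow_zsmul (𝕂 := 𝕂), smul_neg, smul_neg, smul_smul,
    ← neg_smul]
  by_cases hu : u.length = p
  · by_cases hv : v.length = q
    · rw [hu, hv, ← negOne_zpow_add, neg_negOne_zpow]
      congr 1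
      refine negOne_zpow_congr ?_
      push_cast
      exact ⟨0, by ring⟩
    · simp [onList_of_ne _ hv, evCons_zero]
  · simp [onList_of_ne _ hu, evCons_zero]

theorem extP_derOp_hatB (δ : Module.End 𝕂 L) :
    ev 𝕂 q Y (S.extP 𝕂 (derOp δ (S.hatB 𝕂 p X (S.extI 𝕂 (mon 𝕂 l))))) =
      shuf l fun u v => evCons 𝕂 q Y (S.p (δ (S.j (onList p X u)))) v := by
  have h := linear_shuf (ev 𝕂 q Y ∘ₗ (S.extP 𝕂).toLinearMap ∘ₗ derOp δ) l
    (fun u v => ι 𝕂 (S.j (onList p X u)) * S.extI 𝕂 (mon 𝕂 v))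
  simp only [LinearMap.comp_apply, AlgHom.toLinearMap_apply] at h
  rw [hatB_mon, h]
  refine shuf_congr fun u v _ => ?_
  rw [extP_derOp_j_mul, extP_extI]
  rfl

/-- The unary bracket. -/
theorem q_ιInv_superComm_brOp {brA : A →ₗ[𝕂] A →ₗ[𝕂] A} {hbrA : ∀ a, brA a a = 0}
    (h : ∀ a a', S.p (br (S.i a) (S.i a')) = brA a a') (a : Fin (p + 1) → A) :
    S.q (ιInv (superComm 𝕂 1 (p - 1) (brOp br hbr) (S.hatB 𝕂 p X)
      (S.extI 𝕂 (mon 𝕂 (List.ofFn a))))) = ((-1 : 𝕂) ^ ((p : ℤ) + 1)) •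
        ((∑ i : Fin (p + 1), ((-1 : ℤ) ^ (i : ℕ)) •
          S.q (br (S.i (a i)) (S.j (X (i.removeNth a))))) -
        ev 𝕂 p X (brOp brA hbrA (mon 𝕂 (List.ofFn a)))) := by
  have h1 := linear_shuf (S.q.restrictScalars 𝕂 ∘ₗ ιInv ∘ₗ brOp br hbr) (List.ofFn a)
    (fun u v => ι 𝕂 (S.j (onList p X u)) * S.extI 𝕂 (mon 𝕂 v))
  simp only [LinearMap.comp_apply, LinearMap.restrictScalars_apply, ιInv_brOp_ι_mul,
    ιInv_extI] at h1
  rw [q_ιInv_superComm_hatB, S.extP_brOp_extI (hbrA := hbrA) h, hatB_mon, h1, shuf_comm,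
    shuf_singleton, smul_sub, Finset.smul_sum]
  · congr 1
    · refine Finset.sum_congr rfl fun i _ => ?_
      rw [onList_ofFn, ιInv_mon_singleton, ← neg_br hbr, map_neg, smul_neg, smul_neg, ← neg_smul,
        List.length_ofFn, negOne_pow_zsmul (𝕂 := 𝕂) (([a i] : List A).length * p), smul_comm,
        neg_smul, ← smul_neg, smul_neg, smul_neg, ← neg_smul, neg_negOne_zpow]
      simp
    · congr 1
      exact negOne_zpow_congr ⟨-1, by ring⟩
  · intro u v hu
    rw [ιInv_mon_of_ne hu]
    simp

/-- The binary bracket. -/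
theorem q_ιInv_superComm_superComm_brOp :
    S.q (ιInv (superComm 𝕂 p (q - 1) (superComm 𝕂 1 (p - 1) (brOp br hbr) (S.hatB 𝕂 p X))
      (S.hatB 𝕂 q Y) (S.extI 𝕂 (mon 𝕂 l)))) = ((-1 : 𝕂) ^ ((p : ℤ) + p * q)) •
        ((shuf l fun u v => onList p (fun w => ∑ i : Fin p,
          X (Function.update w i (S.p (br (S.j (onList q Y v)) (S.i (w i)))))) u) -
        (shuf l fun u v => onList q (fun w => ∑ i : Fin q,
          Y (Function.update w i (S.p (br (S.j (onList p X u)) (S.i (w i)))))) v) +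
        shuf l fun u v => S.q (br (S.j (onList p X u)) (S.j (onList q Y v)))) := by
  rw [q_ιInv_superComm_hatB, q_ιInv_superComm_hatB, extP_superComm_hatB, q_ιInv_brOp_hatB_hatB,
    ev_extP_brOp_hatB_comm, ev_extP_brOp_hatB, smul_smul, ← negOne_zpow_add]
  have e1 : (-1 : 𝕂) ^ (1 * ((p : ℤ) - 1) + q * p) = -(-1) ^ ((p : ℤ) + p * q) := by
    rw [neg_negOne_zpow]
    exact negOne_zpow_congr ⟨-1, by ring⟩
  have e2 : (-1 : 𝕂) ^ ((p : ℤ) * (q - 1)) = (-1) ^ ((p : ℤ) + p * q) :=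
    negOne_zpow_congr ⟨-p, by ring⟩
  rw [e1, e2]
  module

/-- The ternary bracket. -/
theorem q_ιInv_superComm_superComm_superComm_brOp :
    S.q (ιInv (superComm 𝕂 (p + q - 1) (r - 1) (superComm 𝕂 p (q - 1)
      (superComm 𝕂 1 (p - 1) (brOp br hbr) (S.hatB 𝕂 p X)) (S.hatB 𝕂 q Y)) (S.hatB 𝕂 r Z)
        (S.extI 𝕂 (mon 𝕂 l)))) =
      ((-1 : 𝕂) ^ (1 + (p : ℤ) + r + p * q + p * r + q * r)) •
        (((-1 : ℤ) ^ (p + q + 1)) • (shuf l fun u x => shuf x fun v w =>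
          evCons 𝕂 r Z (S.p (br (S.j (onList p X u)) (S.j (onList q Y v)))) w) +
        ((-1 : ℤ) ^ p) • (shuf l fun u x => shuf x fun v w =>
          evCons 𝕂 q Y (S.p (br (S.j (onList p X u)) (S.j (onList r Z w)))) v) -
        shuf l fun u x => shuf x fun v w =>
          evCons 𝕂 p X (S.p (br (S.j (onList q Y v)) (S.j (onList r Z w)))) u) := by
  -- With all three forms on the right there are at least three factors, too many for the bracket to
  -- leave a single vector.
  have h0 : S.q (ιInv (brOp br hbr (S.hatB 𝕂 p X (S.hatB 𝕂 q Y (S.hatB 𝕂 r Z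
      (S.extI 𝕂 (mon 𝕂 l))))))) = 0 := by
    rw [S.ιInv_brOp_factorsB_three 𝕂, map_zero]
    exact S.hatB_mem_factorsB 𝕂 (S.hatB_mem_factorsB 𝕂 (S.hatB_mem_factorsB 𝕂
      (m := 0) Submodule.mem_top _ _) _ _) _ _
  -- When `Y` stands on the left, the arguments come in the order `X`, `Z`, `Y`. One slot of `Y` is
  -- filled by `β`, so `q - 1` arguments pass the `r` arguments of `Z`; likewise for `X` in `hX`.
  have hY : (shuf l fun u x => shuf x fun v w =>
      evCons 𝕂 q Y (S.p (br (S.j (onList p X u)) (S.j (onList r Z v)))) w) =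
      ((-1 : 𝕂) ^ ((r : ℤ) * (q - 1))) • shuf l fun u x => shuf x fun v w =>
        evCons 𝕂 q Y (S.p (br (S.j (onList p X u)) (S.j (onList r Z w)))) v := by
    rw [shuf_shuf_comm, ← shuf_smul]
    refine shuf_congr fun u x _ => ?_
    rw [← shuf_smul]
    refine shuf_congr fun v w _ => ?_
    rw [negOne_pow_zsmul (𝕂 := 𝕂)]
    by_cases hw : w.length = r
    · by_cases hv : v.length + 1 = q
      · rw [hw]
        congr 2
        subst hv
        push_cast
        ring
      · rw [evCons_of_ne _ _ hv, smul_zero, smul_zero]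
    · simp [onList_of_ne _ hw, evCons_zero]
  have hX : (shuf l fun u x => shuf x fun v w =>
      evCons 𝕂 p X (S.p (br (S.j (onList q Y u)) (S.j (onList r Z v)))) w) =
      ((-1 : 𝕂) ^ (((q : ℤ) + r) * (p - 1))) • shuf l fun u x => shuf x fun v w =>
        evCons 𝕂 p X (S.p (br (S.j (onList q Y v)) (S.j (onList r Z w)))) u := by
    rw [shuf_shuf_comm, shuf_shuf_swap, ← shuf_smul]
    refine shuf_congr fun u x _ => ?_
    rw [← shuf_smul]
    refine shuf_congr fun v w _ => ?_
    rw [negOne_pow_zsmul (𝕂 := 𝕂), negOne_pow_zsmul (𝕂 := 𝕂), smul_smul, ← negOne_zpow_add]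
    by_cases hw : w.length = r
    · by_cases hv : v.length = q
      · by_cases hu : u.length + 1 = p
        · rw [hw, hv]
          congr 2
          subst hu
          push_cast
          ring
        · rw [evCons_of_ne _ _ hu, smul_zero, smul_zero]
      · simp [onList_of_ne _ hv, evCons_zero]
    · simp [onList_of_ne _ hw, evCons_zero]
  rw [q_ιInv_superComm_hatB, q_ιInv_superComm_hatB, q_ιInv_superComm_hatB, extP_superComm_hatB,
    extP_superComm_hatB, extP_superComm_hatB, h0, ev_extP_brOp_hatB_hatB, ev_extP_brOp_hatB_hatB,
    ev_extP_brOp_hatB_hatB, hY, hX]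
  simp only [negOne_pow_zsmul (𝕂 := 𝕂), smul_add, smul_sub, smul_smul, ← negOne_zpow_add]
  have e1 : (-1 : 𝕂) ^ (1 * ((p : ℤ) - 1) + (q + q * r + (q + r) * (p - 1))) =
      (-1) ^ (1 + (p : ℤ) + r + p * q + p * r + q * r) :=
    negOne_zpow_congr ⟨-1 - r, by ring⟩
  have e2 : (-1 : 𝕂) ^ ((p : ℤ) * (q - 1) + (p + p * r + r * (q - 1))) =
      -(-1) ^ (1 + (p : ℤ) + r + p * q + p * r + q * r + (p : ℕ)) := by
    rw [neg_negOne_zpow]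
    exact negOne_zpow_congr ⟨-1 - p - r, by ring⟩
  have e3 : (-1 : 𝕂) ^ (((p : ℤ) + q - 1) * (r - 1) + (p + p * q)) =
      -(-1) ^ (1 + (p : ℤ) + r + p * q + p * r + q * r + (p + q + 1 : ℕ)) := by
    rw [neg_negOne_zpow]
    exact negOne_zpow_congr ⟨-1 - p - q - r, by push_cast; ring⟩
  simp only [add_assoc, mul_add, add_mul] at e1 e2 e3 ⊢
  rw [e1, e2, e3]
  module

/-- The unary action. -/
theorem q_ιInv_superComm_derOp (δ : Module.End 𝕂 L) :
    S.q (ιInv (superComm 𝕂 0 (p - 1) (derOp δ) (S.hatB 𝕂 p X) (S.extI 𝕂 (mon 𝕂 l)))) =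
      -onList p (fun w => ∑ i : Fin p, X (Function.update w i (S.p (δ (S.i (w i)))))) l +
        S.q (δ (S.j (onList p X l))) := by
  rw [q_ιInv_superComm_hatB, ιInv_derOp, ιInv_hatB, extP_extI, extP_derOp_extI, ev_derOp_mon, ev_mon,
    zero_mul, zpow_zero, one_smul, sub_eq_add_neg, add_comm]
  rfl

/-- The binary action. -/
theorem q_ιInv_superComm_superComm_derOp (δ : Module.End 𝕂 L) :
    S.q (ιInv (superComm 𝕂 (p - 1) (q - 1) (superComm 𝕂 0 (p - 1) (derOp δ) (S.hatB 𝕂 p X))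
      (S.hatB 𝕂 q Y) (S.extI 𝕂 (mon 𝕂 l)))) = ((-1 : 𝕂) ^ (1 + (q : ℤ) + p * q)) •
        (((-1 : ℤ) ^ (p + 1)) •
          (shuf l fun u v => evCons 𝕂 q Y (S.p (δ (S.j (onList p X u)))) v) +
        shuf l fun u v => evCons 𝕂 p X (S.p (δ (S.j (onList q Y v)))) u) := by
  have h : (shuf l fun u v => evCons 𝕂 p X (S.p (δ (S.j (onList q Y u)))) v) =
      ((-1 : 𝕂) ^ ((q : ℤ) * (p - 1))) •
        shuf l fun u v => evCons 𝕂 p X (S.p (δ (S.j (onList q Y v)))) u := by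
    rw [shuf_comm, ← shuf_smul]
    refine shuf_congr fun u v _ => ?_
    rw [negOne_pow_zsmul (𝕂 := 𝕂)]
    by_cases hv : v.length = q
    · by_cases hu : u.length + 1 = p
      · rw [hv]
        congr 2
        subst hu
        push_cast
        ring
      · rw [evCons_of_ne _ _ hu, smul_zero, smul_zero]
    · simp [onList_of_ne _ hv, evCons_zero]
  rw [q_ιInv_superComm_hatB, q_ιInv_superComm_hatB, extP_superComm_hatB, ιInv_derOp, ιInv_hatB,
    extP_hatB, map_zero, map_zero, map_zero, map_zero, extP_derOp_hatB, extP_derOp_hatB, h]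
  simp only [negOne_pow_zsmul (𝕂 := 𝕂), smul_add, smul_smul, ← negOne_zpow_add, zero_mul, zpow_zero,
    one_smul]
  have e1 : (-1 : 𝕂) ^ ((q : ℤ) * (p - 1)) = -(-1) ^ (1 + (q : ℤ) + p * q) := by
    rw [neg_negOne_zpow]
    exact negOne_zpow_congr ⟨-1 - q, by ring⟩
  have e2 : (-1 : 𝕂) ^ (((p : ℤ) - 1) * (q - 1)) = -(-1) ^ (1 + (q : ℤ) + p * q + (p + 1 : ℕ)) := by
    rw [neg_negOne_zpow]
    exact negOne_zpow_congr ⟨-1 - p - q, by push_cast; ring⟩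
  rw [e1, e2]
  module

end ModSplitting

end LieAlgd

namespace LieAlgd

open GradedSym ExteriorAlgebra

/-! ### The brackets and action maps as forms -/

namespace ModSplitting

variable {𝕂 R L A B : Type*} [Field 𝕂] [CommRing R] [Algebra 𝕂 R]
  [AddCommGroup L] [Module 𝕂 L] [Module R L] [IsScalarTower 𝕂 R L]
  [AddCommGroup A] [Module 𝕂 A] [Module R A] [IsScalarTower 𝕂 R A]
  [AddCommGroup B] [Module 𝕂 B] [Module R B] [IsScalarTower 𝕂 R B] [SMulCommClass R 𝕂 B]
  (S : ModSplitting R L A B) {br : L →ₗ[𝕂] L →ₗ[𝕂] L} {hbr : ∀ u, br u u = 0}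

variable (𝕂) in
/-- The form with values in `B` defined by a multiderivation with `k` arguments. -/
def form (k : ℕ) : Module.End 𝕂 (ExteriorAlgebra 𝕂 L) →ₗ[𝕂] A [⋀^Fin k]→ₗ[R] B :=
  altScalarsInv 𝕂 k ∘ₗ S.comp 𝕂 k

/-- The chosen left inverse drops out because the component of a multiderivation is `R`-multilinear.
-/
theorem form_apply {k : ℕ} {D : Module.End 𝕂 (ExteriorAlgebra 𝕂 L)}
    (h : IsMultiDer R (k + 1) D) (a : Fin k → A) :
    S.form 𝕂 k D a = S.q (ιInv (D (S.extI 𝕂 (mon 𝕂 (List.ofFn a))))) := by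
  obtain ⟨X, hX⟩ := S.exists_comp_eq 𝕂 h
  rw [form, LinearMap.comp_apply, hX, altScalarsInv_altScalars, ← comp_apply, hX]
  rfl

theorem isMultiDer_derOp {δ : Module.End 𝕂 L} {s : R → R}
    (h : ∀ (f : R) u, δ (f • u) = s f • u + f • δ u) : IsMultiDer R 2 (derOp δ) :=
  ⟨derOp_one δ, δ, s, superComm_derOp_lmul δ, h⟩

theorem isMultiDer_brOp {s : L → R → R}
    (h : ∀ u (f : R) v, br u (f • v) = s u f • v + f • br u v) : IsMultiDer R 3 (brOp br hbr) :=
  isMultiDer_of_superComm_lmul (brOp_one br hbr) fun u => by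
    rw [Nat.cast_zero, zero_add (1 : ℤ), superComm_brOp_lmul]
    exact isMultiDer_derOp (h u)

variable (𝕂)

/-- The operator `[D, X]`. -/
def br1 (n : ℤ) (D : Module.End 𝕂 (ExteriorAlgebra 𝕂 L)) {p : ℕ} (X : A [⋀^Fin p]→ₗ[R] B) :
    Module.End 𝕂 (ExteriorAlgebra 𝕂 L) := superComm 𝕂 n (p - 1) D (S.hatB 𝕂 p X)

variable {𝕂}

theorem isMultiDer_br1 {k p : ℕ} {n : ℤ} (hn : n = k - 1)
    {D : Module.End 𝕂 (ExteriorAlgebra 𝕂 L)} (h : IsMultiDer R (k + 1) D)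
    (X : A [⋀^Fin p]→ₗ[R] B) : IsMultiDer R (k + p) (S.br1 𝕂 n D X) := by
  subst hn
  exact h.superComm (S.isMultiDer_hatB 𝕂 p X)

/-- The exponent `k(k+1)/2` is quadratic in `k` with polarization `pq`. -/
theorem formSign_add (p q : ℕ) :
    formSign 𝕂 (p + q) = formSign 𝕂 p * formSign 𝕂 q * (-1) ^ (p * q) := by
  induction q with
  | zero => simp [formSign]
  | succ q ih =>
    rw [← add_assoc, formSign_succ, formSign_succ, ih, mul_add, pow_add (-1 : 𝕂) (p * q), mul_one,
      add_assoc, pow_add (-1 : 𝕂) p]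
    ring

theorem superComm_formEmb (n : ℤ) (D : Module.End 𝕂 (ExteriorAlgebra 𝕂 L)) {p : ℕ}
    (X : A [⋀^Fin p]→ₗ[R] B) :
    superComm 𝕂 n (p - 1) D ((S.derivedBracketData 𝕂).emb p X) = formSign 𝕂 p • S.br1 𝕂 n D X :=
  (superComm 𝕂 n ((p : ℤ) - 1) D).map_smul _ _

theorem br1_smul (n : ℤ) (c : 𝕂) (D : Module.End 𝕂 (ExteriorAlgebra 𝕂 L)) {p : ℕ}
    (X : A [⋀^Fin p]→ₗ[R] B) : S.br1 𝕂 n (c • D) X = c • S.br1 𝕂 n D X := by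
  rw [br1, map_smul]; rfl

theorem proj_smul {n : ℤ} {k : ℕ} (h : n = k - 1) (c : 𝕂) (D : Module.End 𝕂 (ExteriorAlgebra 𝕂 L)) :
    (S.derivedBracketData 𝕂).proj n (c • D) =
      DirectSum.lof 𝕂 ℕ (fun k => A [⋀^Fin k]→ₗ[R] B) k ((c * formSign 𝕂 k) • S.form 𝕂 k D) := by
  refine (S.formProj_apply 𝕂 h _).trans ?_
  simp only [form, map_smul, smul_smul, mul_comm c]
  rfl

variable {p q r : ℕ} (X : A [⋀^Fin p]→ₗ[R] B) (Y : A [⋀^Fin q]→ₗ[R] B) (Z : A [⋀^Fin r]→ₗ[R] B)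
  (D : Module.End 𝕂 (ExteriorAlgebra 𝕂 L))

theorem pr1_act_nil {n : ℤ} {k : ℕ} (hn : n = k - 1) :
    pr1 𝕂 _ _ ((S.derivedBracketData 𝕂).act n D (prodOf _ [])) =
      DirectSum.lof 𝕂 ℕ (fun k => A [⋀^Fin k]→ₗ[R] B) k (formSign 𝕂 k • S.form 𝕂 k D) := by
  rw [DerivedBracketData.pr1_act_prodOf]
  have := S.proj_smul hn 1 D
  rwa [one_smul, one_mul] at this

theorem pr1_act_singleton {n : ℤ} {k : ℕ} (hk : n + (p - 1) = k - 1) :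
    pr1 𝕂 _ _ ((S.derivedBracketData 𝕂).act n D (prodOf _ [⟨p, X⟩])) =
      DirectSum.lof 𝕂 ℕ (fun k => A [⋀^Fin k]→ₗ[R] B) k
        ((formSign 𝕂 p * formSign 𝕂 k) • S.form 𝕂 k (S.br1 𝕂 n D X)) := by
  rw [DerivedBracketData.pr1_act_prodOf]
  simp only [DerivedBracketData.iterBracket, superComm_formEmb]
  exact S.proj_smul hk _ _

theorem pr1_act_pair {n n' : ℤ} {k : ℕ} (hn' : n + (p - 1) = n') (hk : n' + (q - 1) = k - 1) :
    pr1 𝕂 _ _ ((S.derivedBracketData 𝕂).act n D (prodOf _ [⟨p, X⟩, ⟨q, Y⟩])) =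
      DirectSum.lof 𝕂 ℕ (fun k => A [⋀^Fin k]→ₗ[R] B) k
        ((formSign 𝕂 p * formSign 𝕂 q * formSign 𝕂 k) •
          S.form 𝕂 k (S.br1 𝕂 n' (S.br1 𝕂 n D X) Y)) := by
  subst hn'
  rw [DerivedBracketData.pr1_act_prodOf]
  simp only [DerivedBracketData.iterBracket, superComm_formEmb, br1_smul, smul_smul]
  rw [mul_comm (formSign 𝕂 p)]
  exact S.proj_smul hk _ _

theorem pr1_act_triple {n n' n'' : ℤ} {k : ℕ} (hn' : n + (p - 1) = n') (hn'' : n' + (q - 1) = n'')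
    (hk : n'' + (r - 1) = k - 1) :
    pr1 𝕂 _ _ ((S.derivedBracketData 𝕂).act n D (prodOf _ [⟨p, X⟩, ⟨q, Y⟩, ⟨r, Z⟩])) =
      DirectSum.lof 𝕂 ℕ (fun k => A [⋀^Fin k]→ₗ[R] B) k
        ((formSign 𝕂 p * formSign 𝕂 q * formSign 𝕂 r * formSign 𝕂 k) •
          S.form 𝕂 k (S.br1 𝕂 n'' (S.br1 𝕂 n' (S.br1 𝕂 n D X) Y) Z)) := by
  subst hn' hn''
  rw [DerivedBracketData.pr1_act_prodOf]
  simp only [DerivedBracketData.iterBracket, superComm_formEmb, br1_smul, smul_smul]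
  rw [show formSign 𝕂 p * formSign 𝕂 q * formSign 𝕂 r =
    formSign 𝕂 r * (formSign 𝕂 q * formSign 𝕂 p) by ring]
  exact S.proj_smul hk _ _

/-! ### The brackets and the action maps -/

variable (br hbr) in
/-- The operator `[m, X]` for the Lie bracket `m`. -/
def opD : Module.End 𝕂 (ExteriorAlgebra 𝕂 L) := S.br1 𝕂 1 (brOp br hbr) X

variable (br hbr) in
/-- The operator `[[m, X], Y]` for the Lie bracket `m`. -/
def opBr2 : Module.End 𝕂 (ExteriorAlgebra 𝕂 L) := S.br1 𝕂 p (S.opD br hbr X) Y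

variable (br hbr) in
/-- The operator `[[[m, X], Y], Z]` for the Lie bracket `m`. -/
def opBr3 : Module.End 𝕂 (ExteriorAlgebra 𝕂 L) := S.br1 𝕂 (p + q - 1) (S.opBr2 br hbr X Y) Z

variable (br hbr) in
/-- The unary bracket. -/
def formD : A [⋀^Fin (p + 1)]→ₗ[R] B :=
  ((-1 : 𝕂) ^ ((p : ℤ) + 1)) • S.form 𝕂 (p + 1) (S.opD br hbr X)

variable (br hbr) in
/-- The binary bracket. -/
def formBr2 : A [⋀^Fin (p + q)]→ₗ[R] B :=
  ((-1 : 𝕂) ^ ((p : ℤ) + p * q)) • S.form 𝕂 (p + q) (S.opBr2 br hbr X Y)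

variable (br hbr) in
/-- The ternary bracket. -/
def formBr3 : A [⋀^Fin (p + q + r - 1)]→ₗ[R] B :=
  ((-1 : 𝕂) ^ (1 + (p : ℤ) + r + p * q + p * r + q * r)) •
    S.form 𝕂 (p + q + r - 1) (S.opBr3 br hbr X Y Z)

/-- The unary action. -/
def formAct1 (δ : Module.End 𝕂 L) : A [⋀^Fin p]→ₗ[R] B :=
  S.form 𝕂 p (S.br1 𝕂 0 (derOp δ) X)

/-- The binary action. -/
def formAct2 (δ : Module.End 𝕂 L) : A [⋀^Fin (p + q - 1)]→ₗ[R] B :=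
  ((-1 : 𝕂) ^ (1 + (q : ℤ) + p * q)) •
    S.form 𝕂 (p + q - 1) (S.br1 𝕂 (p - 1) (S.br1 𝕂 0 (derOp δ) X) Y)

section Multiderivations

variable {s : L → R → R}

theorem isMultiDer_opD (hs : ∀ u (f : R) v, br u (f • v) = s u f • v + f • br u v) :
    IsMultiDer R (p + 2) (S.opD br hbr X) := by
  rw [add_comm]
  exact S.isMultiDer_br1 (k := 2) (by norm_num) (isMultiDer_brOp hs) X

theorem isMultiDer_opBr2 (hs : ∀ u (f : R) v, br u (f • v) = s u f • v + f • br u v) :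
    IsMultiDer R (p + q + 1) (S.opBr2 br hbr X Y) := by
  rw [add_right_comm]
  exact S.isMultiDer_br1 (k := p + 1) (by push_cast; ring) (S.isMultiDer_opD X hs) Y

theorem isMultiDer_opBr3 (hs : ∀ u (f : R) v, br u (f • v) = s u f • v + f • br u v) :
    IsMultiDer R (p + q + r) (S.opBr3 br hbr X Y Z) :=
  S.isMultiDer_br1 (k := p + q) (by push_cast; ring) (S.isMultiDer_opBr2 X Y hs) Z

end Multiderivations

section Formulas

variable {s : L → R → R}

theorem formD_apply (hs : ∀ u (f : R) v, br u (f • v) = s u f • v + f • br u v)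
    {brA : A →ₗ[𝕂] A →ₗ[𝕂] A} {hbrA : ∀ a, brA a a = 0}
    (h : ∀ a a', S.p (br (S.i a) (S.i a')) = brA a a') (a : Fin (p + 1) → A) :
    S.formD br hbr X a = (∑ i : Fin (p + 1), ((-1 : ℤ) ^ (i : ℕ)) •
      S.q (br (S.i (a i)) (S.j (X (i.removeNth a))))) -
        ev 𝕂 p X (brOp brA hbrA (mon 𝕂 (List.ofFn a))) := by
  rw [formD, AlternatingMap.smul_apply, S.form_apply (S.isMultiDer_opD X hs), opD, br1,
    S.q_ιInv_superComm_brOp X (hbrA := hbrA) h, smul_smul, negOne_zpow_sq, one_smul]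

theorem formBr2_apply (hs : ∀ u (f : R) v, br u (f • v) = s u f • v + f • br u v)
    (a : Fin (p + q) → A) :
    S.formBr2 br hbr X Y a = (shuf (List.ofFn a) fun u v => onList p (fun w => ∑ i : Fin p,
          X (Function.update w i (S.p (br (S.j (onList q Y v)) (S.i (w i)))))) u) -
        (shuf (List.ofFn a) fun u v => onList q (fun w => ∑ i : Fin q,
          Y (Function.update w i (S.p (br (S.j (onList p X u)) (S.i (w i)))))) v) +
        shuf (List.ofFn a) fun u v => S.q (br (S.j (onList p X u)) (S.j (onList q Y v))) := by
  rw [formBr2, AlternatingMap.smul_apply, S.form_apply (S.isMultiDer_opBr2 X Y hs), opBr2, opD, br1,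
    br1, S.q_ιInv_superComm_superComm_brOp, smul_smul, negOne_zpow_sq, one_smul]

theorem formBr3_apply (hs : ∀ u (f : R) v, br u (f • v) = s u f • v + f • br u v)
    (a : Fin (p + q + r - 1) → A) :
    S.formBr3 br hbr X Y Z a = ((-1 : ℤ) ^ (p + q + 1)) • (shuf (List.ofFn a) fun u x =>
          shuf x fun v w =>
            evCons 𝕂 r Z (S.p (br (S.j (onList p X u)) (S.j (onList q Y v)))) w) +
        ((-1 : ℤ) ^ p) • (shuf (List.ofFn a) fun u x => shuf x fun v w =>
          evCons 𝕂 q Y (S.p (br (S.j (onList p X u)) (S.j (onList r Z w)))) v) -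
        shuf (List.ofFn a) fun u x => shuf x fun v w =>
          evCons 𝕂 p X (S.p (br (S.j (onList q Y v)) (S.j (onList r Z w)))) u := by
  -- For three `0`-forms the degree `p + q + r - 1` is truncated to `0` instead of `-1`; the
  -- operator is zero there, being a multiderivation of index `0`.
  by_cases h0 : p + q + r = 0
  · obtain ⟨⟨rfl, rfl⟩, rfl⟩ : (p = 0 ∧ q = 0) ∧ r = 0 := by omega
    have h : ∀ (X : A [⋀^Fin 0]→ₗ[R] B) (a : A) (l : List A), evCons 𝕂 0 X a l = 0 :=
      fun X a l => evCons_of_ne X a (by simp)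
    have hD : S.opBr3 br hbr X Y Z = 0 := S.isMultiDer_opBr3 X Y Z hs
    simp [formBr3, hD, h]
  · have hD : IsMultiDer R (p + q + r - 1 + 1) (S.opBr3 br hbr X Y Z) := by
      rw [Nat.sub_add_cancel (Nat.pos_of_ne_zero h0)]
      exact S.isMultiDer_opBr3 X Y Z hs
    rw [formBr3, AlternatingMap.smul_apply, S.form_apply hD, opBr3, opBr2, opD, br1, br1, br1,
      S.q_ιInv_superComm_superComm_superComm_brOp, smul_smul, negOne_zpow_sq, one_smul]

theorem form_derOp_apply {δ : Module.End 𝕂 L} {s : R → R}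
    (h : ∀ (f : R) u, δ (f • u) = s f • u + f • δ u) (a : Fin 1 → A) :
    S.form 𝕂 1 (derOp δ) a = S.q (δ (S.i (a 0))) := by
  rw [S.form_apply (isMultiDer_derOp h), ιInv_derOp, ιInv_extI]
  simp

theorem formAct1_apply {δ : Module.End 𝕂 L} {s : R → R}
    (h : ∀ (f : R) u, δ (f • u) = s f • u + f • δ u) (a : Fin p → A) :
    S.formAct1 X δ a = -(∑ i : Fin p, X (Function.update a i (S.p (δ (S.i (a i)))))) +
      S.q (δ (S.j (X a))) := by
  have hD := S.isMultiDer_br1 (k := 1) (n := 0) (by norm_num) (isMultiDer_derOp h) X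
  rw [add_comm] at hD
  rw [formAct1, S.form_apply hD, br1, q_ιInv_superComm_derOp, onList_ofFn, onList_ofFn]

theorem formAct2_apply {δ : Module.End 𝕂 L} {s : R → R}
    (h : ∀ (f : R) u, δ (f • u) = s f • u + f • δ u) (a : Fin (p + q - 1) → A) :
    S.formAct2 X Y δ a = ((-1 : ℤ) ^ (p + 1)) •
          (shuf (List.ofFn a) fun u v => evCons 𝕂 q Y (S.p (δ (S.j (onList p X u)))) v) +
        shuf (List.ofFn a) fun u v => evCons 𝕂 p X (S.p (δ (S.j (onList q Y v)))) u := by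
  have hD := S.isMultiDer_br1 (k := 1) (n := 0) (by norm_num) (isMultiDer_derOp h) X
  rw [add_comm] at hD
  have hE := S.isMultiDer_br1 (k := p) rfl hD Y
  by_cases h0 : p + q = 0
  · obtain ⟨rfl, rfl⟩ : p = 0 ∧ q = 0 := by omega
    have h : ∀ (X : A [⋀^Fin 0]→ₗ[R] B) (a : A) (l : List A), evCons 𝕂 0 X a l = 0 :=
      fun X a l => evCons_of_ne X a (by simp)
    have hE' : S.br1 𝕂 (((0 : ℕ) : ℤ) - 1) (S.br1 𝕂 0 (derOp δ) X) Y = 0 := hE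
    rw [formAct2, hE']
    simp [h]
  · rw [← Nat.sub_add_cancel (Nat.pos_of_ne_zero h0)] at hE
    rw [formAct2, AlternatingMap.smul_apply, S.form_apply hE, br1, br1,
      S.q_ιInv_superComm_superComm_derOp, smul_smul, negOne_zpow_sq, one_smul]

end Formulas

/-! ### Comparison with the décalage signs -/

section Decalage

/-- Here `c` is the décalage sign and `d` the product of the signs of the embeddings; the minus is
that of `Q`, which is the action of the negative of the bracket. -/
theorem smul_neg_map_smul {M N : Type*} [AddCommGroup M] [Module 𝕂 M] [AddCommGroup N] [Module 𝕂 N]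
    (f : M →ₗ[𝕂] N) {c d e : 𝕂} (h : -(c * d) = e) (x : M) : c • -f (d • x) = f (e • x) := by
  rw [map_smul, map_smul, ← h, smul_neg, smul_smul, neg_smul]

theorem smul_map_smul {M N : Type*} [AddCommGroup M] [Module 𝕂 M] [AddCommGroup N] [Module 𝕂 N]
    (f : M →ₗ[𝕂] N) {c d e : 𝕂} (h : c * d = e) (x : M) : c • f (d • x) = f (e • x) := by
  rw [map_smul, map_smul, ← h, smul_smul]

theorem formSign_mul_succ (p : ℕ) : formSign 𝕂 p * formSign 𝕂 (p + 1) = (-1) ^ ((p : ℤ) + 1) := by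
  rw [formSign_succ, mul_left_comm, formSign_mul_self, mul_one, ← zpow_natCast]
  push_cast
  rfl

theorem formSign_mul_add (p q : ℕ) :
    formSign 𝕂 p * formSign 𝕂 q * formSign 𝕂 (p + q) = (-1) ^ ((p : ℤ) * q) := by
  rw [formSign_add, ← mul_assoc, mul_mul_mul_comm, formSign_mul_self, formSign_mul_self, one_mul,
    one_mul, ← zpow_natCast]
  push_cast
  rfl

theorem formSign_mul_add_sub_one {p q : ℕ} (h : p + q ≠ 0) :
    formSign 𝕂 p * formSign 𝕂 q * formSign 𝕂 (p + q - 1) = (-1) ^ ((p : ℤ) * q + p + q) := by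
  have h1 := formSign_mul_add (𝕂 := 𝕂) p q
  obtain ⟨t, ht⟩ := Nat.exists_eq_succ_of_ne_zero h
  rw [ht, Nat.succ_eq_add_one] at h1
  rw [ht, Nat.succ_eq_add_one, Nat.add_sub_cancel]
  have h2 := formSign_mul_succ (𝕂 := 𝕂) t
  have h3 : formSign 𝕂 t = (-1) ^ ((t : ℤ) + 1) * formSign 𝕂 (t + 1) := by
    rw [← h2, mul_assoc, formSign_mul_self, mul_one]
  rw [h3, mul_left_comm, h1, ← negOne_zpow_add]
  refine negOne_zpow_congr ⟨0, ?_⟩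
  have : (p : ℤ) + q = t + 1 := by exact_mod_cast ht
  linear_combination -this

variable (br hbr) in
/-- The codifferential. -/
def codiff : Module.End 𝕂 (SymShift 𝕂 (fun k : ℕ => A [⋀^Fin k]→ₗ[R] B) (fun k : ℕ => (k : ℤ))) :=
  (S.derivedBracketData 𝕂).act 1 (-brOp br hbr)

/-- The coderivation given by the action of a derivation of `L`. -/
def coder : Module.End 𝕂 L →ₗ[𝕂]
    Module.End 𝕂 (SymShift 𝕂 (fun k : ℕ => A [⋀^Fin k]→ₗ[R] B) (fun k : ℕ => (k : ℤ))) :=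
  (S.derivedBracketData 𝕂).act 0 ∘ₗ derOp

theorem bracketOf_codiff (l : List (Σ k : ℕ, A [⋀^Fin k]→ₗ[R] B)) :
    bracketOf (deg := fun k : ℕ => (k : ℤ)) (S.codiff br hbr) l =
      ((-1 : 𝕂) ^ (((l.length * (l.length + 1) / 2 : ℕ) : ℤ) + decalage (fun k : ℕ => (k : ℤ)) l)) •
        -pr1 𝕂 _ _ ((S.derivedBracketData 𝕂).act 1 (brOp br hbr) (prodOf _ l)) := by
  rw [bracketOf, codiff, map_neg, LinearMap.neg_apply, map_neg]

theorem bracketOf_codiff_singleton :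
    bracketOf (deg := fun k : ℕ => (k : ℤ)) (S.codiff br hbr) [⟨p, X⟩] =
      DirectSum.lof 𝕂 ℕ (fun k => A [⋀^Fin k]→ₗ[R] B) (p + 1) (S.formD br hbr X) := by
  rw [bracketOf_codiff, S.pr1_act_singleton X (brOp br hbr) (n := 1) (k := p + 1)
    (by push_cast; ring)]
  refine smul_neg_map_smul _ ?_ _
  rw [formSign_mul_succ, ← negOne_zpow_add, neg_negOne_zpow]
  simp only [decalage, List.length_cons, List.length_nil]
  exact negOne_zpow_congr ⟨1, by push_cast; norm_num; ring⟩

theorem bracketOf_codiff_pair :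
    bracketOf (deg := fun k : ℕ => (k : ℤ)) (S.codiff br hbr) [⟨p, X⟩, ⟨q, Y⟩] =
      DirectSum.lof 𝕂 ℕ (fun k => A [⋀^Fin k]→ₗ[R] B) (p + q) (S.formBr2 br hbr X Y) := by
  rw [bracketOf_codiff, S.pr1_act_pair X Y (brOp br hbr) (n := 1) (n' := p) (k := p + q)
    (by ring) (by push_cast; ring)]
  refine smul_neg_map_smul _ ?_ _
  rw [formSign_mul_add, ← negOne_zpow_add, neg_negOne_zpow]
  simp only [decalage, List.length_cons, List.length_nil]
  exact negOne_zpow_congr ⟨2, by push_cast; norm_num; ring⟩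

theorem bracketOf_codiff_triple {s : L → R → R}
    (hs : ∀ u (f : R) v, br u (f • v) = s u f • v + f • br u v) :
    bracketOf (deg := fun k : ℕ => (k : ℤ)) (S.codiff br hbr) [⟨p, X⟩, ⟨q, Y⟩, ⟨r, Z⟩] =
      DirectSum.lof 𝕂 ℕ (fun k => A [⋀^Fin k]→ₗ[R] B) (p + q + r - 1)
        (S.formBr3 br hbr X Y Z) := by
  by_cases h0 : p + q + r = 0
  · obtain ⟨⟨rfl, rfl⟩, rfl⟩ : (p = 0 ∧ q = 0) ∧ r = 0 := by omega
    have hD : S.opBr3 br hbr X Y Z = 0 := S.isMultiDer_opBr3 X Y Z hs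
    rw [formBr3, hD, map_zero, smul_zero, map_zero, bracketOf_codiff,
      DerivedBracketData.pr1_act_prodOf]
    simp only [DerivedBracketData.iterBracket, superComm_formEmb, br1_smul, smul_smul]
    have e : S.br1 𝕂 (1 + (((0 : ℕ) : ℤ) - 1) + (((0 : ℕ) : ℤ) - 1))
        (S.br1 𝕂 (1 + (((0 : ℕ) : ℤ) - 1)) (S.br1 𝕂 1 (brOp br hbr) X) Y) Z = 0 := hD
    rw [e, smul_zero, map_zero, neg_zero, smul_zero]
  · rw [bracketOf_codiff, S.pr1_act_triple X Y Z (brOp br hbr) (n := 1) (n' := p)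
      (n'' := p + q - 1) (k := p + q + r - 1) (by ring) (by ring) (by omega)]
    refine smul_neg_map_smul _ ?_ _
    have e : formSign 𝕂 p * formSign 𝕂 q * formSign 𝕂 r * formSign 𝕂 (p + q + r - 1) =
        (-1) ^ ((p : ℤ) * q) * (-1) ^ (((p : ℤ) + q) * r + (p + q) + r) := by
      have h1 := formSign_mul_add (𝕂 := 𝕂) p q
      have h2 := formSign_mul_add_sub_one (𝕂 := 𝕂) h0
      push_cast at h2
      rw [← h1, ← h2]
      linear_combination -(formSign 𝕂 p * formSign 𝕂 q * formSign 𝕂 r *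
        formSign 𝕂 (p + q + r - 1)) * formSign_mul_self 𝕂 (p + q)
    rw [e, ← negOne_zpow_add, ← negOne_zpow_add, neg_negOne_zpow]
    simp only [decalage, List.length_cons, List.length_nil]
    exact negOne_zpow_congr ⟨3 + p + q, by push_cast; norm_num; ring⟩

theorem bracketOf_codiff_eq_zero {l : List (Σ k : ℕ, A [⋀^Fin k]→ₗ[R] B)} (hl : 4 ≤ l.length) :
    bracketOf (deg := fun k : ℕ => (k : ℤ)) (S.codiff br hbr) l = 0 := by
  rw [bracketOf_codiff, S.pr1_act_brOp_eq_zero 𝕂 1 hl, neg_zero, smul_zero]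

theorem actionOf_coder_nil (δ : Module.End 𝕂 L) :
    actionOf (deg := fun k : ℕ => (k : ℤ)) (S.coder δ) [] =
      DirectSum.lof 𝕂 ℕ (fun k => A [⋀^Fin k]→ₗ[R] B) 1 (-S.form 𝕂 1 (derOp δ)) := by
  rw [actionOf, coder, LinearMap.comp_apply, S.pr1_act_nil (derOp δ) (n := 0) (k := 1) (by norm_num)]
  rw [← neg_one_smul 𝕂 (S.form 𝕂 1 (derOp δ))]
  refine smul_map_smul _ ?_ _
  simp [decalage, formSign]

theorem actionOf_coder_singleton (δ : Module.End 𝕂 L) :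
    actionOf (deg := fun k : ℕ => (k : ℤ)) (S.coder δ) [⟨p, X⟩] =
      DirectSum.lof 𝕂 ℕ (fun k => A [⋀^Fin k]→ₗ[R] B) p (S.formAct1 X δ) := by
  rw [actionOf, coder, LinearMap.comp_apply,
    S.pr1_act_singleton X (derOp δ) (n := 0) (k := p) (by ring), formAct1,
    ← one_smul 𝕂 (S.form 𝕂 p (S.br1 𝕂 0 (derOp δ) X)), smul_smul]
  refine smul_map_smul _ ?_ _
  rw [formSign_mul_self]
  simp [decalage]

theorem actionOf_coder_pair {δ : Module.End 𝕂 L} {s : R → R}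
    (hs : ∀ (f : R) u, δ (f • u) = s f • u + f • δ u) :
    actionOf (deg := fun k : ℕ => (k : ℤ)) (S.coder δ) [⟨p, X⟩, ⟨q, Y⟩] =
      DirectSum.lof 𝕂 ℕ (fun k => A [⋀^Fin k]→ₗ[R] B) (p + q - 1) (S.formAct2 X Y δ) := by
  -- For two sections of `B` the degree is truncated to `0`, and the iterated commutator is zero.
  by_cases h0 : p + q = 0
  · obtain ⟨rfl, rfl⟩ : p = 0 ∧ q = 0 := by omega
    have hD := S.isMultiDer_br1 (k := 1) (n := 0) (by norm_num) (isMultiDer_derOp hs) X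
    have hE : S.br1 𝕂 (((0 : ℕ) : ℤ) - 1) (S.br1 𝕂 0 (derOp δ) X) Y = 0 :=
      S.isMultiDer_br1 (k := 0) rfl hD Y
    rw [formAct2, hE, map_zero, smul_zero, map_zero, actionOf, coder, LinearMap.comp_apply,
      DerivedBracketData.pr1_act_prodOf]
    simp only [DerivedBracketData.iterBracket, superComm_formEmb, br1_smul, smul_smul]
    rw [zero_add, hE, smul_zero, map_zero, smul_zero]
  · rw [actionOf, coder, LinearMap.comp_apply, S.pr1_act_pair X Y (derOp δ) (n := 0) (n' := p - 1)
      (k := p + q - 1) (by ring) (by omega)]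
    refine smul_map_smul _ ?_ _
    rw [formSign_mul_add_sub_one h0, ← negOne_zpow_add]
    simp only [decalage, List.length_cons, List.length_nil]
    exact negOne_zpow_congr ⟨2 + p, by push_cast; norm_num; ring⟩

theorem actionOf_coder_eq_zero (δ : Module.End 𝕂 L) {l : List (Σ k : ℕ, A [⋀^Fin k]→ₗ[R] B)}
    (hl : 3 ≤ l.length) : actionOf (deg := fun k : ℕ => (k : ℤ)) (S.coder δ) l = 0 := by
  rw [actionOf, coder, LinearMap.comp_apply, S.pr1_act_derOp_eq_zero 𝕂 δ 0 hl, smul_zero]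

end Decalage

/-! ### The codifferential and the morphism of dg Lie algebras -/

section Codifferential

variable {s : L → R → R}

theorem neg_brOp_mem (hs : ∀ u (f : R) v, br u (f • v) = s u f • v + f • br u v) :
    -brOp br hbr ∈ multiDers 𝕂 (R := R) (1 : ℤ) := by
  have := mem_multiDers (R := R) ((isMultiDer_brOp (hbr := hbr) hs).smul (-1) : IsMultiDer R (2 + 1) _)
  rw [neg_one_smul] at this
  exact this

theorem derOp_mem {δ : Module.End 𝕂 L} {s : R → R}
    (hs : ∀ (f : R) u, δ (f • u) = s f • u + f • δ u) :
    derOp δ ∈ multiDers 𝕂 (R := R) (0 : ℤ) := by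
  simpa using mem_multiDers (R := R) (isMultiDer_derOp hs : IsMultiDer R (1 + 1) _)

theorem isCodifferential_codiff [CharZero 𝕂]
    (hs : ∀ u (f : R) v, br u (f • v) = s u f • v + f • br u v)
    (jac : ∀ u v w, br u (br v w) = br (br u v) w + br v (br u w))
    (hA : ∀ a a', S.q (br (S.i a) (S.i a')) = 0) :
    IsCodifferential (deg := fun k : ℕ => (k : ℤ) - 1) (S.codiff br hbr) where
  coderivation := (S.derivedBracketData 𝕂).isCoderivation_act (neg_brOp_mem hs)
  map_one := by
    -- Closure of `A` under the bracket means that the bracket operator lies in the kernel of the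
    -- projection, so it sends `1` to zero.
    have h0 : S.comp 𝕂 2 (brOp br hbr) = 0 := by
      refine AlternatingMap.ext fun a => ?_
      rw [comp_apply, List.ofFn_succ, mon_cons, extI_ι_mul, ιInv_brOp_ι_mul, ιInv_extI]
      simp [hA]
    have h1 : (S.derivedBracketData 𝕂).proj 1 (-brOp br hbr) = 0 := by
      refine (S.formProj_apply 𝕂 (n := 1) (k := 2) (by norm_num) _).trans ?_
      rw [map_neg, h0, neg_zero, map_zero, smul_zero, map_zero]
    rw [codiff, DerivedBracketData.act_one, h1, map_zero]
  sq_zero := by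
    have h := (S.derivedBracketData 𝕂).act_superComm (neg_brOp_mem (R := R) (hbr := hbr) hs)
      (neg_brOp_mem (hbr := hbr) hs)
    have h0 : superComm 𝕂 1 1 (-brOp br hbr) (-brOp br hbr) = 0 := by
      rw [superComm_apply, neg_mul_neg, brOp_mul_self br hbr jac, smul_zero, sub_zero]
    rw [h0, map_zero] at h
    refine LinearMap.ext fun x => ?_
    have hx := LinearMap.congr_fun h x
    -- For `Q` of odd degree `[Q, Q] = 2 Q²`; here the characteristic matters.
    rw [LinearMap.zero_apply, gradedBracket, LinearMap.sub_apply, LinearMap.smul_apply, mul_one,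
      zpow_one, neg_smul, one_smul, sub_neg_eq_add, ← two_smul 𝕂, eq_comm] at hx
    exact (smul_eq_zero.1 hx).resolve_left two_ne_zero

theorem isCoderivation_coder {δ : Module.End 𝕂 L} {s : R → R}
    (hs : ∀ (f : R) u, δ (f • u) = s f • u + f • δ u) :
    IsCoderivation (deg := fun k : ℕ => (k : ℤ) - 1) 0 (S.coder δ) :=
  (S.derivedBracketData 𝕂).isCoderivation_act (derOp_mem hs)

theorem coder_lie {δ δ' : Module.End 𝕂 L} {s s' : R → R}
    (hs : ∀ (f : R) u, δ (f • u) = s f • u + f • δ u)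
    (hs' : ∀ (f : R) u, δ' (f • u) = s' f • u + f • δ' u) :
    S.coder (δ * δ' - δ' * δ) =
      gradedBracket (deg := fun k : ℕ => (k : ℤ) - 1) 0 0 (S.coder δ) (S.coder δ') := by
  have h := (S.derivedBracketData 𝕂).act_superComm (derOp_mem (R := R) hs) (derOp_mem hs')
  rw [superComm_derOp_derOp, add_zero] at h
  exact h

theorem gradedBracket_codiff_coder (hs : ∀ u (f : R) v, br u (f • v) = s u f • v + f • br u v)
    {δ : Module.End 𝕂 L} {s' : R → R} (hs' : ∀ (f : R) u, δ (f • u) = s' f • u + f • δ u)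
    (hδ : ∀ u v, δ (br u v) = br (δ u) v + br u (δ v)) :
    gradedBracket (deg := fun k : ℕ => (k : ℤ) - 1) 1 0 (S.codiff br hbr) (S.coder δ) = 0 := by
  have h := (S.derivedBracketData 𝕂).act_superComm (neg_brOp_mem (R := R) (hbr := hbr) hs)
    (derOp_mem hs')
  rw [map_neg, LinearMap.neg_apply, superComm_brOp_derOp br hbr hδ, neg_zero, map_zero] at h
  exact h.symm

end Codifferential

end ModSplitting

end LieAlgd

namespace LieAlgd

open GradedSym ExteriorAlgebra

/-! ### Sections of vector bundles: the stated formulas for brackets and actions -/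

section OnList

variable {G N : Type*} [AddCommGroup N]

theorem eq_ofFn_or (k : ℕ) (l : List G) : (∃ a : Fin k → G, l = List.ofFn a) ∨ l.length ≠ k := by
  by_cases hl : l.length = k
  · subst hl
    exact .inl ⟨l.get, (List.ofFn_get l).symm⟩
  · exact .inr hl

@[simp] theorem onList_fun_zero (k : ℕ) (l : List G) : onList k (fun _ => (0 : N)) l = 0 := by
  simp [onList]

end OnList

section EvCons

variable {𝕂 R A N : Type*} [Field 𝕂] [CommRing R] [Algebra 𝕂 R]
  [AddCommGroup A] [Module 𝕂 A] [Module R A] [IsScalarTower 𝕂 R A]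
  [AddCommGroup N] [Module 𝕂 N] [Module R N] [IsScalarTower 𝕂 R N] [SMulCommClass R 𝕂 N]

theorem ModSplitting.evCons_eq_onList (k : ℕ) (X : A [⋀^Fin k]→ₗ[R] N) (a : A) (l : List A) :
    evCons 𝕂 k X a l = onList k X (a :: l) := by
  rw [evCons, ← mon_cons, ev_mon]

end EvCons

variable {𝕂 : Type} [RCLike 𝕂] {m : ℕ} {M : Type*} [TopologicalSpace M]
  [ChartedSpace (EuclideanSpace ℝ (Fin m)) M] {L A B : VBundle 𝕂 m M}

theorem onList_cons_eq_insert {N : Type*} [AddCommGroup N] [Module (SmoothFn 𝕂 m M) N] {k : ℕ}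
    (X : Form A N k) (a : Sec A) (l : List (Sec A)) :
    onList k X (a :: l) = onList (k - 1) (X.insert a) l := by
  cases k with
  | zero => exact (onList_of_ne _ (by simp)).trans (onList_fun_zero _ _).symm
  | succ k => exact onList_cons _ _ _

theorem insert_zero {N : Type*} [AddCommGroup N] [Module (SmoothFn 𝕂 m M) N] {k : ℕ}
    (X : Form A N k) : (X.insert (0 : Sec A)) = 0 := by
  cases k with
  | zero => rfl
  | succ k => exact funext fun a => X.map_coord_zero 0 rfl

variable {P : LiePair L A} (S : Splitting P B)

/-- The decomposition of modules of sections. -/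
def Splitting.modSplitting : ModSplitting (SmoothFn 𝕂 m M) (Sec L) (Sec A) (Sec B) where
  i := P.incl.sec
  j := S.inclB.sec
  p := S.prA.sec
  q := S.prB.sec
  p_i a := Sec.ext fun x => S.prA_incl x _
  p_j b := Sec.ext fun x => S.prA_inclB x _
  q_i a := Sec.ext fun x => S.prB_incl x _
  q_j b := Sec.ext fun x => S.prB_inclB x _
  decomp u := Sec.ext fun x => S.decomp x _

theorem Splitting.prA_bracket (a a' : Sec A) :
    S.modSplitting.p (P.algL.bracket (S.modSplitting.i a) (S.modSplitting.i a')) =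
      P.algA.bracket a a' :=
  (congrArg S.modSplitting.p (P.incl_bracket a a')).symm.trans (S.modSplitting.p_i _)

theorem Splitting.prB_bracket (a a' : Sec A) :
    S.modSplitting.q (P.algL.bracket (S.modSplitting.i a) (S.modSplitting.i a')) = 0 :=
  (congrArg S.modSplitting.q (P.incl_bracket a a')).symm.trans (S.modSplitting.q_i _)

/-- The second sum in the Chevalley–Eilenberg differential evaluates `X` on the coderivation
extending the bracket of `A`; the minus is that of `shuf_pair`. -/
theorem bracketSum_eq_brOp (𝓐 : LieAlgebroid A) {k : ℕ} (X : Form A (Sec B) k)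
    (a : Fin (k + 1) → Sec A) :
    bracketSum 𝓐 X a = -ev 𝕂 k X (brOp 𝓐.bracket 𝓐.bracket_self (mon 𝕂 (List.ofFn a))) := by
  cases k with
  | zero =>
    rw [List.ofFn_succ, List.ofFn_zero, brOp_mon_singleton, map_zero, neg_zero]
    rfl
  | succ k =>
    rw [brOp_mon, map_neg, neg_neg, map_sum, bracketSum]
    refine Finset.sum_congr rfl fun j _ => ?_
    rw [map_sum]
    refine Finset.sum_congr rfl fun i _ => ?_
    split_ifs
    · rw [map_zsmul, ← mon_cons, ev_mon, ← onList_ofFn X, List.ofFn_cons]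
    · rw [map_zero]

section Shuffles

variable {p q r : ℕ} (X : OmegaB S p) (Y : OmegaB S q) (Z : OmegaB S r)

/-- On lists of the wrong length `X` counts as zero on the right, so `φ 0 = 0` and the vanishing of
`Form.insert` at `0` are needed. -/
theorem shuffleSum2_insert {N : Type*} [AddCommGroup N] [Module (SmoothFn 𝕂 m M) N] {k n : ℕ}
    (Y : Form A N k) (φ : Sec B →+ Sec A) (a : Fin n → Sec A) :
    shuffleSum2 p (k - 1) a (fun u v => Form.insert Y (φ (X u)) v) =
      shuf (List.ofFn a) fun u v => onList k Y (φ (onList p X u) :: v) := by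
  rw [shuffleSum2_eq_shuf]
  refine shuf_congr fun u v _ => ?_
  obtain ⟨b, rfl⟩ | hl := eq_ofFn_or p u
  · rw [onList_ofFn, onList_ofFn, onList_cons_eq_insert]
  · rw [onList_of_ne _ hl, onList_of_ne _ hl, map_zero, onList_cons_eq_insert, insert_zero]
    exact (onList_fun_zero _ _).symm

theorem shuffleSum2_insert' {N : Type*} [AddCommGroup N] [Module (SmoothFn 𝕂 m M) N] {k n : ℕ}
    (Y : Form A N k) (φ : Sec B →+ Sec A) (a : Fin n → Sec A) :
    shuffleSum2 (k - 1) p a (fun u v => Form.insert Y (φ (X v)) u) =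
      shuf (List.ofFn a) fun u v => onList k Y (φ (onList p X v) :: u) := by
  rw [shuffleSum2_eq_shuf]
  refine shuf_congr fun u v _ => ?_
  obtain ⟨b, rfl⟩ | hl := eq_ofFn_or p v
  · simp only [onList_ofFn, onList_cons_eq_insert]
  · rw [onList_of_ne _ hl, map_zero, onList_cons_eq_insert, insert_zero]
    simp only [onList_of_ne _ hl]
    exact (onList_fun_zero _ _).trans (onList_fun_zero _ _).symm

theorem formBr2_eq (a : Fin (p + q) → Sec A) :
    S.modSplitting.formBr2 (𝕂 := 𝕂) P.algL.bracket P.algL.bracket_self X Y a =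
      shuffleSum2 p q a (fun u v =>
        ∑ i : Fin p, X (Function.update u i (S.eth (Y v) (u i))))
      - shuffleSum2 p q a (fun u v =>
        ∑ j : Fin q, Y (Function.update v j (S.eth (X u) (v j))))
      + shuffleSum2 p q a (fun u v => S.brB (X u) (Y v)) := by
  -- These facts show that where `onList` replaces a form by zero, the whole term is zero.
  have h0 : ∀ a, S.eth 0 a = 0 := fun a => by simp [Splitting.eth]
  have hX : ∀ u : Fin p → Sec A, (∑ i, X (Function.update u i (S.eth 0 (u i)))) = 0 := fun u =>
    Finset.sum_eq_zero fun i _ => by rw [h0, X.map_update_zero]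
  have hY : ∀ u : Fin q → Sec A, (∑ i, Y (Function.update u i (S.eth 0 (u i)))) = 0 := fun u =>
    Finset.sum_eq_zero fun i _ => by rw [h0, Y.map_update_zero]
  have h1 : ∀ b, S.brB b 0 = 0 := fun a => by simp [Splitting.brB]
  have h2 : ∀ b, S.brB 0 b = 0 := fun a => by simp [Splitting.brB]
  refine (S.modSplitting.formBr2_apply X Y P.algL.leibniz a).trans ?_
  simp only [shuffleSum2_eq_shuf]
  refine congrArg₂ _ (congrArg₂ _ (shuf_congr fun u v _ => ?_) (shuf_congr fun u v _ => ?_))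
    (shuf_congr fun u v _ => ?_)
  · change onList p (fun w => ∑ i, X (Function.update w i (S.eth (onList q Y v) (w i)))) u = _
    obtain ⟨b, rfl⟩ | hl := eq_ofFn_or q v
    · simp only [onList_ofFn]
    · simp only [onList_of_ne _ hl, hX]
  · change onList q (fun w => ∑ i, Y (Function.update w i (S.eth (onList p X u) (w i)))) v = _
    obtain ⟨b, rfl⟩ | hl := eq_ofFn_or p u
    · simp only [onList_ofFn]
    · simp only [onList_of_ne _ hl, hY, onList_fun_zero]
  · change S.brB (onList p X u) (onList q Y v) = _
    obtain ⟨b, rfl⟩ | hl := eq_ofFn_or p u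
    · obtain ⟨b, rfl⟩ | hl := eq_ofFn_or q v
      · simp only [onList_ofFn]
      · simp only [onList_ofFn, onList_of_ne _ hl, h1]
    · simp only [onList_of_ne _ hl, h2]

theorem onList_cons_beta {u v w : List (Sec A)} :
    onList p (fun u => onList q (fun v => onList (r - 1) (Form.insert Z (S.beta (X u) (Y v))) w) v) u
      = onList r Z (S.beta (onList p X u) (onList q Y v) :: w) := by
  have h1 : ∀ b, S.beta b 0 = 0 := fun a => by simp [Splitting.beta]
  have h2 : ∀ b, S.beta 0 b = 0 := fun a => by simp [Splitting.beta]
  have h3 : onList (r - 1) (0 : (Fin (r - 1) → Sec A) → Sec B) w = 0 := onList_fun_zero _ _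
  rw [onList_cons_eq_insert]
  obtain ⟨b, rfl⟩ | hl := eq_ofFn_or p u
  · obtain ⟨b, rfl⟩ | hl := eq_ofFn_or q v
    · simp only [onList_ofFn]
    · simp only [onList_ofFn, onList_of_ne _ hl, h1, insert_zero, h3]
  · simp only [onList_of_ne _ hl, h2, insert_zero, h3]

theorem formBr3_eq (a : Fin (p + q + r - 1) → Sec A) :
    S.modSplitting.formBr3 (𝕂 := 𝕂) P.algL.bracket P.algL.bracket_self X Y Z a =
      ((-1 : ℤ) ^ (p + q + 1)) • shuffleSum3 p q (r - 1) a (fun u v w =>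
        Form.insert Z (S.beta (X u) (Y v)) w)
      + ((-1 : ℤ) ^ p) • shuffleSum3 p (q - 1) r a (fun u v w =>
        Form.insert Y (S.beta (X u) (Z w)) v)
      - shuffleSum3 (p - 1) q r a (fun u v w =>
        Form.insert X (S.beta (Y v) (Z w)) u) := by
  -- The order in which the lists are turned into tuples is immaterial; it differs between the three
  -- terms.
  have hswap : ∀ {k l : ℕ} (F : (Fin k → Sec A) → (Fin l → Sec A) → Sec B) (u v : List (Sec A)),
      onList k (fun u => onList l (F u) v) u = onList l (fun v => onList k (F · v) u) v := by
    intro k l F u v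
    obtain ⟨b, rfl⟩ | hl := eq_ofFn_or k u
    · simp only [onList_ofFn]
    · simp only [onList_of_ne _ hl, onList_fun_zero]
  refine (S.modSplitting.formBr3_apply X Y Z P.algL.leibniz a).trans ?_
  simp only [shuffleSum3_eq_shuf, ModSplitting.evCons_eq_onList]
  refine congrArg₂ _ (congrArg₂ _ (congrArg _ ?_) (congrArg _ ?_)) ?_
  · refine shuf_congr fun u x _ => shuf_congr fun v w _ => ?_
    exact (onList_cons_beta S X Y Z).symm
  · refine shuf_congr fun u x _ => shuf_congr fun v w _ => ?_
    refine (onList_cons_beta S X Z Y).symm.trans ?_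
    congr 1
    funext u
    exact (hswap _ _ _).symm
  · refine shuf_congr fun u x _ => shuf_congr fun v w _ => ?_
    refine (onList_cons_beta S Y Z X).symm.trans ?_
    rw [hswap (k := p - 1)]
    congr 1
    funext v
    exact (hswap _ _ _).symm

end Shuffles

/-- The brackets of `Ω_A(B)`. -/
def Splitting.brackets : Brackets S where
  d _ X := S.modSplitting.formD (𝕂 := 𝕂) P.algL.bracket P.algL.bracket_self X
  br2 _ _ X Y := S.modSplitting.formBr2 (𝕂 := 𝕂) P.algL.bracket P.algL.bracket_self X Y
  br3 _ _ _ X Y Z := S.modSplitting.formBr3 (𝕂 := 𝕂) P.algL.bracket P.algL.bracket_self X Y Z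
  d_apply k X a := by
    rw [S.modSplitting.formD_apply X P.algL.leibniz (hbrA := P.algA.bracket_self) S.prA_bracket,
      bracketSum_eq_brOp, sub_eq_add_neg]
    rfl
  br2_apply _ _ := formBr2_eq S
  br3_apply _ _ _ := formBr3_eq S

/-- The action maps of `Ω_A(B)`. -/
def Splitting.actionMaps : ActionMaps S where
  kappa δ := -S.modSplitting.form 𝕂 1 (derOp δ.1.1)
  act1 _ δ X := S.modSplitting.formAct1 X δ.1.1
  act2 _ _ δ X Y := S.modSplitting.formAct2 X Y δ.1.1
  kappa_apply δ a := by
    rw [AlternatingMap.neg_apply, S.modSplitting.form_derOp_apply δ.2]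
    rfl
  act1_apply _ δ X a := S.modSplitting.formAct1_apply X δ.2 a
  act2_apply i j δ X Y a := by
    have e1 := shuffleSum2_insert S X Y
      (S.prA.sec.toAddMonoidHom.comp (δ.1.1.toAddMonoidHom.comp S.inclB.sec.toAddMonoidHom)) a
    have e2 := shuffleSum2_insert' S Y X
      (S.prA.sec.toAddMonoidHom.comp (δ.1.1.toAddMonoidHom.comp S.inclB.sec.toAddMonoidHom)) a
    refine (S.modSplitting.formAct2_apply X Y δ.2 a).trans ?_
    simp only [ModSplitting.evCons_eq_onList]
    exact congrArg₂ _ (congrArg _ e1.symm) e2.symm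

theorem Splitting.encodes_brackets :
    Encodes S S.brackets (S.modSplitting.codiff P.algL.bracket P.algL.bracket_self) :=
  ⟨fun _ X => S.modSplitting.bracketOf_codiff_singleton X,
    fun _ _ X Y => S.modSplitting.bracketOf_codiff_pair X Y,
    fun _ _ _ X Y Z => S.modSplitting.bracketOf_codiff_triple X Y Z P.algL.leibniz,
    fun _ hl => S.modSplitting.bracketOf_codiff_eq_zero hl⟩

theorem Splitting.isCodifferential_codiff :
    IsCodifferential (𝕂 := 𝕂) (V := OmegaB S) (deg := fun k : ℕ => (k : ℤ) - 1)
      (S.modSplitting.codiff P.algL.bracket P.algL.bracket_self) :=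
  S.modSplitting.isCodifferential_codiff P.algL.leibniz P.algL.jacobi S.prB_bracket

/-- The action of `Der(L)` by coderivations. -/
def Splitting.derAction : Der P.algL →ₗ[𝕂] Module.End 𝕂 (SymOmega S) :=
  S.modSplitting.coder ∘ₗ LinearMap.fst 𝕂 _ _ ∘ₗ (Der P.algL).toSubmodule.subtype

theorem Splitting.isDGLAHom_derAction :
    IsDGLAHom (V := OmegaB S) (deg := fun k : ℕ => (k : ℤ) - 1)
      (S.modSplitting.codiff P.algL.bracket P.algL.bracket_self) S.derAction where
  coderivation δ := S.modSplitting.isCoderivation_coder δ.2.1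
  map_lie δ δ' := S.modSplitting.coder_lie δ.2.1 δ'.2.1
  map_d δ := S.modSplitting.gradedBracket_codiff_coder P.algL.leibniz δ.2.1 δ.2.2.2

theorem Splitting.hasActionMaps : HasActionMaps S S.actionMaps S.derAction :=
  ⟨fun δ => S.modSplitting.actionOf_coder_nil δ.1.1,
    fun δ _ X => S.modSplitting.actionOf_coder_singleton X δ.1.1,
    fun δ _ _ X Y => S.modSplitting.actionOf_coder_pair X Y δ.2.1,
    fun δ _ hl => S.modSplitting.actionOf_coder_eq_zero δ.1.1 hl⟩

end LieAlgd

namespace LieAlgd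

open GradedSym ExteriorAlgebra

/-! ### Changing one entry of a list -/

section DerList

variable {G N : Type*} [AddCommGroup N]

/-- The sum of the values of `F` on the lists obtained from `l` by applying `φ` to one entry. -/
def derList (φ : G → G) : List G → (List G → N) → N
  | [], _ => 0
  | a :: l, F => F (φ a :: l) + derList φ l fun x => F (a :: x)

variable {φ : G → G}

theorem derList_congr {l : List G} {F F' : List G → N}
    (h : ∀ x, x.length = l.length → F x = F' x) : derList φ l F = derList φ l F' := by
  induction l generalizing F F' with
  | nil => rfl
  | cons a l ih =>
    rw [derList, derList, h _ (by simp), ih fun x hx => h _ (by simp [hx])]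

theorem derList_add (l : List G) (F F' : List G → N) :
    (derList φ l fun x => F x + F' x) = derList φ l F + derList φ l F' := by
  induction l generalizing F F' with
  | nil => simp [derList]
  | cons a l ih => simp only [derList, ih]; abel

theorem map_derList {N' : Type*} [AddCommGroup N'] (f : N →+ N') (l : List G) (F : List G → N) :
    f (derList φ l F) = derList φ l fun x => f (F x) := by
  induction l generalizing F with
  | nil => simp [derList]
  | cons a l ih => simp only [derList, map_add, ih]

theorem derList_zsmul (c : ℤ) (l : List G) (F : List G → N) :
    (derList φ l fun x => c • F x) = c • derList φ l F :=
  (map_derList (zsmulAddGroupHom c) l F).symm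

theorem derList_eq_zero {l : List G} {F : List G → N} (h : ∀ x, x.length = l.length → F x = 0) :
    derList φ l F = 0 := by
  rw [derList_congr h]
  exact (map_derList (0 : N →+ N) l fun _ => 0).symm

/-- The changed entry ends up in one of the two lists, and lengths, hence signs, do not change. -/
theorem derList_shuf (l : List G) (T : List G → List G → N) :
    (derList φ l fun x => shuf x T) =
      shuf l fun u v => (derList φ u fun x => T x v) + derList φ v fun x => T u x := by
  induction l generalizing T with
  | nil => simp [derList, shuf]
  | cons a l ih =>
    have h : ∀ u v : List G, (derList φ u fun x => ((-1 : ℤ) ^ x.length) • T x (a :: v)) =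
        ((-1 : ℤ) ^ u.length) • derList φ u fun x => T x (a :: v) := fun u v => by
      rw [← derList_zsmul]
      exact derList_congr fun x hx => by rw [hx]
    simp only [derList, shuf, derList_add, ih, h, shuf_add, smul_add, derList_zsmul]
    abel

theorem sum_update_eq_derList {k : ℕ} (F : (Fin k → G) → N) (a : Fin k → G) :
    ∑ j, F (Function.update a j (φ (a j))) = derList φ (List.ofFn a) (onList k F) := by
  induction k with
  | zero => simp [derList]
  | succ k ih =>
    rw [List.ofFn_succ, derList, Fin.sum_univ_succ, ← List.ofFn_cons, onList_ofFn]
    congr 1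
    · congr 1
      refine funext fun t => Fin.cases ?_ (fun t => ?_) t <;> simp
    · simp only [onList_cons]
      have := ih (fun x => F (Fin.cons (a 0) x)) fun t => a t.succ
      rw [← this]
      refine Finset.sum_congr rfl fun t _ => congrArg F ?_
      refine funext fun t' => Fin.cases ?_ (fun t' => ?_) t'
      · simp [Function.update, (Fin.succ_ne_zero t).symm]
      · simp [Function.update, Fin.succ_inj]

end DerList

variable {𝕂 : Type} [RCLike 𝕂] {m : ℕ} {M : Type*} [TopologicalSpace M]
  [ChartedSpace (EuclideanSpace ℝ (Fin m)) M] {L A B : VBundle 𝕂 m M}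

/-! ### Wedge products and contractions on lists -/

section Lists

variable {N : Type*} [AddCommGroup N] [Module (SmoothFn 𝕂 m M) N]

theorem onList_wedge {k p : ℕ} (η : Form A (SmoothFn 𝕂 m M) k) (X : Form A N p)
    (l : List (Sec A)) :
    onList (k + p) (η.wedge X) l = shuf l fun u v => onList k η u • onList p X v := by
  obtain ⟨a, rfl⟩ | hl := eq_ofFn_or (k + p) l
  · rw [onList_ofFn]
    change TensorProduct.lid (SmoothFn 𝕂 m M) N
      ((η.domCoprod X).domDomCongr finSumFinEquiv a) = _
    rw [domCoprod_eq_shuffleSum2, shuffleSum2_eq_shuf]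
    refine (map_shuf (TensorProduct.lid (SmoothFn 𝕂 m M) N).toLinearMap.toAddMonoidHom _ _).trans ?_
    refine shuf_congr fun u v _ => ?_
    obtain ⟨b, rfl⟩ | hu := eq_ofFn_or k u
    · obtain ⟨c, rfl⟩ | hv := eq_ofFn_or p v
      · simp [onList_ofFn]
      · simp [onList_ofFn, onList_of_ne _ hv]
    · simp [onList_of_ne _ hu]
  · rw [onList_of_ne _ hl, eq_comm, ← shuf_zero l]
    refine shuf_congr fun u v huv => ?_
    by_cases hu : u.length = k
    · rw [onList_of_ne X (by omega), smul_zero]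
    · rw [onList_of_ne _ hu, zero_smul]

theorem form_ext {k : ℕ} {X Y : Form A N k} (h : ∀ l, onList k X l = onList k Y l) : X = Y :=
  AlternatingMap.ext fun a => by rw [← onList_ofFn X, h, onList_ofFn]

/-- `onList k X (a :: l)`, as a function of `a`. -/
def contract {k : ℕ} (X : Form A N k) (l : List (Sec A)) : Sec A →ₗ[SmoothFn 𝕂 m M] N where
  toFun a := onList k X (a :: l)
  map_add' a b := by
    cases k with
    | zero => simp [onList_of_ne]
    | succ k =>
      simp only [onList_cons, ← onList_add]
      congr 1
      exact funext fun x => X.toMultilinearMap.cons_add x a b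
  map_smul' f a := by
    cases k with
    | zero => simp [onList_of_ne]
    | succ k =>
      simp only [onList_cons]
      have e := map_onList (DistribSMul.toAddMonoidHom N f) k (fun x => X (Fin.cons a x)) l
      refine Eq.trans ?_ e.symm
      congr 1
      exact funext fun x => X.toMultilinearMap.cons_smul x f a

theorem contract_apply {k : ℕ} (X : Form A N k) (l : List (Sec A)) (a : Sec A) :
    contract X l a = onList k X (a :: l) := rfl

theorem contract_of_ne {k : ℕ} (X : Form A N k) {l : List (Sec A)} (h : l.length + 1 ≠ k) :
    contract X l = 0 := LinearMap.ext fun _ => onList_of_ne _ (by simpa using h)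

theorem contract_wedge {k p : ℕ} (η : Form A (SmoothFn 𝕂 m M) k) (X : Form A N p) (a : Sec A)
    (l : List (Sec A)) :
    contract (η.wedge X) l a = (shuf l fun u v => contract η u a • onList p X v) +
      shuf l fun u v => ((-1 : ℤ) ^ u.length) • (onList k η u • contract X v a) :=
  onList_wedge η X (a :: l)

/-- The vector `g u` fills a slot of `η` or of `X`. In the second case it passes the `k` arguments
of `η`, and so do the `i` entries of `u`, which gives `(-1)^(k(i+1))`. -/
theorem shuf_contract_wedge {i k p : ℕ} (η : Form A (SmoothFn 𝕂 m M) k) (X : Form A N p)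
    {g : List (Sec A) → Sec A} (hg : ∀ u, u.length ≠ i → g u = 0) (l : List (Sec A)) :
    (shuf l fun u w => contract (η.wedge X) w (g u)) =
      (shuf l fun x z => (shuf x fun u v => contract η v (g u)) • onList p X z) +
        ((-1 : ℤ) ^ (k * (i + 1))) •
          shuf l fun v y => onList k η v • shuf y fun u z => contract X z (g u) := by
  simp only [contract_wedge, shuf_add]
  congr 1
  · rw [← shuf_assoc]
    refine shuf_congr fun x z _ => ?_
    exact (map_shuf ((LinearMap.toSpanSingleton (SmoothFn 𝕂 m M) N (onList p X z)).toAddMonoidHom)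
      x _).symm
  · rw [shuf_shuf_swap, ← shuf_zsmul]
    refine shuf_congr fun v y _ => ?_
    rw [← shuf_smul, ← shuf_zsmul]
    refine shuf_congr fun u z _ => ?_
    by_cases hv : v.length = k
    · by_cases hu : u.length = i
      · rw [smul_smul, hv, hu, ← pow_add, mul_add, mul_one]
      · simp [hg u hu]
    · simp [onList_of_ne _ hv]

theorem lof_apply_eq_onList {k : ℕ} (X : Form A N k) {n : ℕ} [Module 𝕂 N]
    [SMulCommClass (SmoothFn 𝕂 m M) 𝕂 N] (a : Fin n → Sec A) :
    DirectSum.lof 𝕂 ℕ (fun k => Form A N k) k X n a = onList k X (List.ofFn a) := by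
  rw [DirectSum.lof_eq_of]
  by_cases h : k = n
  · subst h
    rw [DirectSum.of_eq_same, onList_ofFn]
  · rw [DirectSum.of_eq_of_ne _ _ _ (Ne.symm h), onList_of_ne _ (by simpa using Ne.symm h)]
    rfl

/-- The three degrees are computed with truncated subtraction, so they are not the same expression
and may even differ when a term is zero. In the direct sum it is enough to compare values on all
lists. -/
theorem lof_eq_lof_add_zsmul_lof [Module 𝕂 N] [SMulCommClass (SmoothFn 𝕂 m M) 𝕂 N] {k k' k'' : ℕ}
    {X : Form A N k} {X' : Form A N k'} {X'' : Form A N k''} {c : ℤ}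
    (h : ∀ l, onList k X l = onList k' X' l + c • onList k'' X'' l) :
    DirectSum.lof 𝕂 ℕ (fun k => Form A N k) k X =
      DirectSum.lof 𝕂 ℕ (fun k => Form A N k) k' X' +
        c • DirectSum.lof 𝕂 ℕ (fun k => Form A N k) k'' X'' := by
  refine DFinsupp.ext fun n => AlternatingMap.ext fun a => ?_
  rw [lof_apply_eq_onList, h, ← lof_apply_eq_onList, ← lof_apply_eq_onList]
  rfl

theorem onList_sub_sum_update {k : ℕ} {X X' : Form A N k} {φ : Sec A → Sec A} (T : N →+ N)
    (h : ∀ a, X' a = T (X a) - ∑ j, X (Function.update a j (φ (a j)))) (l : List (Sec A)) :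
    onList k X' l = T (onList k X l) - derList φ l (onList k X) := by
  obtain ⟨a, rfl⟩ | hl := eq_ofFn_or k l
  · rw [onList_ofFn, onList_ofFn, h, sum_update_eq_derList]
  · rw [onList_of_ne _ hl, onList_of_ne _ hl,
      derList_eq_zero fun x hx => onList_of_ne _ (by rwa [hx]), map_zero, sub_zero]

/-- The Leibniz rule for the operators `X ↦ T ∘ X - ∑ⱼ X(…, φ(aⱼ), …)` on forms. -/
theorem wedge_leibniz {k p : ℕ} {η η' : Form A (SmoothFn 𝕂 m M) k} {X X' : Form A N p}
    {Y : Form A N (k + p)} {φ : Sec A → Sec A} {s : SmoothFn 𝕂 m M →+ SmoothFn 𝕂 m M} {T : N →+ N}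
    (hT : ∀ f x, T (f • x) = s f • x + f • T x)
    (hη : ∀ a, η' a = s (η a) - ∑ j, η (Function.update a j (φ (a j))))
    (hX : ∀ a, X' a = T (X a) - ∑ j, X (Function.update a j (φ (a j))))
    (hY : ∀ a, Y a = T (η.wedge X a) - ∑ j, η.wedge X (Function.update a j (φ (a j)))) :
    Y = η'.wedge X + η.wedge X' := by
  refine form_ext fun l => ?_
  have e : onList (k + p) (η.wedge X) = fun l => shuf l fun u v => onList k η u • onList p X v :=
    funext (onList_wedge η X)
  have e' : onList (k + p) (η'.wedge X + η.wedge X') l =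
      onList (k + p) (η'.wedge X) l + onList (k + p) (η.wedge X') l := onList_add _ _ _ _
  rw [onList_sub_sum_update T hY, e', onList_wedge η' X, onList_wedge η X', e, derList_shuf,
    map_shuf, ← shuf_add, sub_eq_add_neg, ← shuf_neg, ← shuf_add]
  refine shuf_congr fun u v _ => ?_
  have h1 : (derList φ u fun x => onList k η x • onList p X v) =
      derList φ u (onList k η) • onList p X v :=
    (map_derList (LinearMap.toSpanSingleton (SmoothFn 𝕂 m M) N (onList p X v)).toAddMonoidHom
      u _).symm
  have h2 : (derList φ v fun x => onList k η u • onList p X x) =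
      onList k η u • derList φ v (onList p X) :=
    (map_derList (DistribSMul.toAddMonoidHom N (onList k η u)) v _).symm
  rw [h1, h2, hT, onList_sub_sum_update s hη, onList_sub_sum_update T hX, sub_smul, smul_sub]
  abel

end Lists

variable {P : LiePair L A} {S : Splitting P B}

/-! ### Linearity over functions and Leibniz rules -/

section Formulas

/-- The map `b ↦ pr_A δ(b)` from `Γ(B)` to `Γ(A)`. -/
def Splitting.offDiag (S : Splitting P B) (δ : DerEnd L) : Sec B →ₗ[SmoothFn 𝕂 m M] Sec A where
  toFun b := S.prA.sec (δ.1.1 (S.inclB.sec b))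
  map_add' b b' := by simp
  map_smul' f b := by
    -- The symbol term is a multiple of a section of `B`, which `pr_A` kills; so the off-diagonal
    -- part of `δ` is `R`-linear.
    have h : S.prA.sec (S.inclB.sec b) = 0 := S.modSplitting.p_j b
    rw [map_smul, δ.2, map_add, map_smul, map_smul, h, smul_zero, zero_add]
    rfl

theorem offDiag_smul (f : SmoothFn 𝕂 m M) (δ : DerEnd L) (b : Sec B) :
    S.offDiag (f • δ) b = f • S.offDiag δ b := map_smul S.prA.sec f _

theorem shuf_contract_eq_zero {N : Type*} [AddCommGroup N] [Module (SmoothFn 𝕂 m M) N] {i k : ℕ}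
    (X : OmegaB S i) (Y : Form A N k) (φ : Sec B →ₗ[SmoothFn 𝕂 m M] Sec A) {l : List (Sec A)}
    (hl : l.length ≠ i + k - 1) :
    (shuf l fun u v => contract Y v (φ (onList i X u))) = 0 := by
  rw [← shuf_zero l]
  refine shuf_congr fun u v huv => ?_
  by_cases hu : u.length = i
  · rw [contract_of_ne _ (by omega), LinearMap.zero_apply]
  · rw [onList_of_ne _ hu, map_zero, map_zero]

theorem shuf_contract_eq_zero' {N : Type*} [AddCommGroup N] [Module (SmoothFn 𝕂 m M) N] {i k : ℕ}
    (X : OmegaB S i) (Y : Form A N k) (φ : Sec B →ₗ[SmoothFn 𝕂 m M] Sec A) {l : List (Sec A)}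
    (hl : l.length ≠ k + i - 1) :
    (shuf l fun u v => contract Y u (φ (onList i X v))) = 0 := by
  rw [← shuf_zero l]
  refine shuf_congr fun u v huv => ?_
  by_cases hu : v.length = i
  · rw [contract_of_ne _ (by omega), LinearMap.zero_apply]
  · rw [onList_of_ne _ hu, map_zero, map_zero]

theorem RhoMaps.onList_rho2 (ρ : RhoMaps S) {i k : ℕ} (δ : DerEnd L) (X : OmegaB S i)
    (η : OmegaA S k) (l : List (Sec A)) :
    onList (i + k - 1) (ρ.rho2 i k δ X η) l =
      ((-1 : ℤ) ^ (i + 1)) • shuf l fun u v => contract η v (S.offDiag δ (onList i X u)) := by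
  obtain ⟨a, rfl⟩ | hl := eq_ofFn_or (i + k - 1) l
  · rw [onList_ofFn, ρ.rho2_apply]
    exact congrArg _ (shuffleSum2_insert S X η (S.offDiag δ).toAddMonoidHom a)
  · rw [onList_of_ne _ hl, shuf_contract_eq_zero X η _ hl, smul_zero]

theorem ActionMaps.onList_act2 (μ : ActionMaps S) {i j : ℕ} (δ : DerEnd L) (X : OmegaB S i)
    (Y : OmegaB S j) (l : List (Sec A)) :
    onList (i + j - 1) (μ.act2 i j δ X Y) l =
      (((-1 : ℤ) ^ (i + 1)) • shuf l fun u v => contract Y v (S.offDiag δ (onList i X u))) +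
        shuf l fun u v => contract X u (S.offDiag δ (onList j Y v)) := by
  obtain ⟨a, rfl⟩ | hl := eq_ofFn_or (i + j - 1) l
  · rw [onList_ofFn, μ.act2_apply]
    exact congrArg₂ _ (congrArg _ (shuffleSum2_insert S X Y (S.offDiag δ).toAddMonoidHom a))
      (shuffleSum2_insert' S Y X (S.offDiag δ).toAddMonoidHom a)
  · rw [onList_of_ne _ hl, shuf_contract_eq_zero X Y _ hl, shuf_contract_eq_zero' Y X _ hl,
      smul_zero, add_zero]

theorem ActionMaps.kappa_smul (μ : ActionMaps S) (f : SmoothFn 𝕂 m M) (δ : DerEnd L) :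
    μ.kappa (f • δ) = f • μ.kappa δ := by
  refine AlternatingMap.ext fun a => ?_
  rw [AlternatingMap.smul_apply, μ.kappa_apply, μ.kappa_apply, smul_neg, ← map_smul]
  rfl

theorem ActionMaps.act1_smul (μ : ActionMaps S) (f : SmoothFn 𝕂 m M) (δ : DerEnd L) {k : ℕ}
    (X : OmegaB S k) : μ.act1 k (f • δ) X = f • μ.act1 k δ X := by
  refine AlternatingMap.ext fun a => ?_
  rw [AlternatingMap.smul_apply, μ.act1_apply, μ.act1_apply, smul_add, smul_neg, Finset.smul_sum,
    ← map_smul]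
  refine congrArg₂ _ (congrArg _ (Finset.sum_congr rfl fun j _ => ?_)) rfl
  rw [← X.map_update_smul, ← map_smul]
  rfl

theorem ActionMaps.act2_smul (μ : ActionMaps S) (f : SmoothFn 𝕂 m M) (δ : DerEnd L) {i j : ℕ}
    (X : OmegaB S i) (Y : OmegaB S j) : μ.act2 i j (f • δ) X Y = f • μ.act2 i j δ X Y := by
  refine form_ext fun l => ?_
  have e : onList (i + j - 1) (f • μ.act2 i j δ X Y) l = f • onList (i + j - 1) (μ.act2 i j δ X Y) l :=
    (map_onList (DistribSMul.toAddMonoidHom (Sec B) f) _ _ _).symm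
  rw [e, μ.onList_act2, μ.onList_act2, smul_add, smul_comm f]
  simp only [offDiag_smul, map_smul, shuf_smul]

theorem RhoMaps.rho1_wedge (ρ : RhoMaps S) (δ : DerEnd L) {k l : ℕ} (η : OmegaA S k)
    (ζ : OmegaA S l) :
    ρ.rho1 (k + l) δ (η.wedge ζ) = (ρ.rho1 k δ η).wedge ζ + η.wedge (ρ.rho1 l δ ζ) :=
  wedge_leibniz (s := (δ.1.2 : SmoothFn 𝕂 m M →ₗ[𝕂] SmoothFn 𝕂 m M).toAddMonoidHom)
    (T := (δ.1.2 : SmoothFn 𝕂 m M →ₗ[𝕂] SmoothFn 𝕂 m M).toAddMonoidHom)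
    (φ := fun a => S.prA.sec (δ.1.1 (P.incl.sec a)))
    (fun f g => (δ.1.2.leibniz f g).trans (by rw [add_comm, smul_eq_mul, smul_eq_mul, mul_comm g]; rfl))
    (ρ.rho1_apply k δ η) (ρ.rho1_apply l δ ζ) (ρ.rho1_apply (k + l) δ _)

/-- This is `wedge_leibniz` for the operator `pr_B δ` on `Γ(B)`, which has the same symbol as `δ`
because `pr_B` is the identity on `B`. -/
theorem ActionMaps.act1_wedge (μ : ActionMaps S) (ρ : RhoMaps S) (δ : DerEnd L) {k p : ℕ}
    (η : OmegaA S k) (X : OmegaB S p) :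
    μ.act1 (k + p) δ (η.wedge X) = (ρ.rho1 k δ η).wedge X + η.wedge (μ.act1 p δ X) :=
  wedge_leibniz (s := (δ.1.2 : SmoothFn 𝕂 m M →ₗ[𝕂] SmoothFn 𝕂 m M).toAddMonoidHom)
    (T := S.prB.sec.toAddMonoidHom.comp (δ.1.1.toAddMonoidHom.comp S.inclB.sec.toAddMonoidHom))
    (φ := fun a => S.prA.sec (δ.1.1 (P.incl.sec a)))
    (fun f b => by
      have h : S.prB.sec (S.inclB.sec b) = b := S.modSplitting.q_j b
      change S.prB.sec (δ.1.1 (S.inclB.sec (f • b))) =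
        δ.1.2 f • b + f • S.prB.sec (δ.1.1 (S.inclB.sec b))
      rw [map_smul, δ.2, map_add, map_smul, map_smul, h])
    (ρ.rho1_apply k δ η) (fun a => (μ.act1_apply p δ X a).trans (neg_add_eq_sub _ _))
    (fun a => (μ.act1_apply (k + p) δ _ a).trans (neg_add_eq_sub _ _))

theorem RhoMaps.rho2_wedge (ρ : RhoMaps S) (δ : DerEnd L) {i k l : ℕ} (X : OmegaB S i)
    (η : OmegaA S k) (ζ : OmegaA S l) :
    inA (S := S) (ρ.rho2 i (k + l) δ X (η.wedge ζ)) =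
      inA (S := S) ((ρ.rho2 i k δ X η).wedge ζ) +
        ((-1 : ℤ) ^ (k * (i + 1))) • inA (S := S) (η.wedge (ρ.rho2 i l δ X ζ)) := by
  refine lof_eq_lof_add_zsmul_lof fun y => ?_
  rw [ρ.onList_rho2, shuf_contract_wedge η ζ
    (g := fun u => S.offDiag δ (onList i X u)) (i := i)
    (fun u hu => by rw [onList_of_ne _ hu, map_zero]), onList_wedge, onList_wedge]
  simp only [ρ.onList_rho2, smul_assoc, smul_comm _ ((-1 : ℤ) ^ (i + 1)), shuf_zsmul, smul_add]

/-- One half of the action inserts a vector in `η ∧ Y`, as in the rule for `ϱ₂`. The other inserts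
the values of `η ∧ Y` in `X`, and there the values of `η` come out by `R`-linearity of `offDiag` and
`contract`. -/
theorem ActionMaps.act2_wedge (μ : ActionMaps S) (ρ : RhoMaps S) (δ : DerEnd L) {i k j : ℕ}
    (X : OmegaB S i) (η : OmegaA S k) (Y : OmegaB S j) :
    inB (S := S) (μ.act2 i (k + j) δ X (η.wedge Y)) =
      inB (S := S) ((ρ.rho2 i k δ X η).wedge Y) +
        ((-1 : ℤ) ^ (k * (1 + i))) • inB (S := S) (η.wedge (μ.act2 i j δ X Y)) := by
  refine lof_eq_lof_add_zsmul_lof fun y => ?_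
  have h : (shuf y fun u w => contract X u (S.offDiag δ (onList (k + j) (η.wedge Y) w))) =
      ((-1 : ℤ) ^ (k * (i + 1))) • shuf y fun v z => onList k η v •
        shuf z fun u w => contract X u (S.offDiag δ (onList j Y w)) := by
    have e : ∀ u w : List (Sec A),
        contract X u (S.offDiag δ (onList (k + j) (η.wedge Y) w)) =
          shuf w fun v z => onList k η v • contract X u (S.offDiag δ (onList j Y z)) := by
      intro u w
      rw [onList_wedge]
      refine (map_shuf (contract X u ∘ₗ S.offDiag δ).toAddMonoidHom w _).trans ?_
      refine shuf_congr fun v z _ => ?_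
      exact map_smul (contract X u ∘ₗ S.offDiag δ) _ _
    simp only [e]
    rw [shuf_shuf_swap, ← shuf_zsmul]
    refine shuf_congr fun v y _ => ?_
    rw [← shuf_smul, ← shuf_zsmul]
    refine shuf_congr fun u z _ => ?_
    by_cases hv : v.length = k
    · by_cases hu : u.length + 1 = i
      · subst hu hv
        congr 1
        -- The `i - 1` remaining arguments of `X` pass the `k` arguments of `η`, and `(-1)^(k(i-1))
        -- = (-1)^(k(i+1))`.
        rw [add_assoc, mul_add, pow_add, one_add_one_eq_two, mul_comm _ 2, pow_mul (-1 : ℤ) 2]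
        norm_num
      · simp [contract_of_ne X hu]
    · simp [onList_of_ne _ hv]
  rw [μ.onList_act2, shuf_contract_wedge η Y
    (g := fun u => S.offDiag δ (onList i X u)) (i := i)
    (fun u hu => by rw [onList_of_ne _ hu, map_zero]), h, onList_wedge, onList_wedge, add_comm 1 i]
  simp only [ρ.onList_rho2, μ.onList_act2, smul_assoc, smul_comm _ ((-1 : ℤ) ^ (i + 1)), shuf_zsmul,
    smul_add, shuf_add]
  abel

end Formulas

end LieAlgd

/-! ### Existence of `ϱ₁` and `ϱ₂` from the decomposition `L ⊕ R = A ⊕ (B ⊕ R)` -/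

namespace LieAlgd

open GradedSym ExteriorAlgebra

/-- The decomposition `L ⊕ R = A ⊕ (B ⊕ R)`. -/
def ModSplitting.extend {R L A B : Type*} [CommRing R] [AddCommGroup L] [AddCommGroup A]
    [AddCommGroup B] [Module R L] [Module R A] [Module R B] (S : ModSplitting R L A B) :
    ModSplitting R (L × R) A (B × R) where
  i := LinearMap.inl R L R ∘ₗ S.i
  j := S.j.prodMap LinearMap.id
  p := S.p ∘ₗ LinearMap.fst R L R
  q := S.q.prodMap LinearMap.id
  p_i a := S.p_i a
  p_j b := S.p_j b.1
  q_i a := Prod.ext (S.q_i a) rfl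
  q_j b := Prod.ext (S.q_j b.1) rfl
  decomp u := Prod.ext (S.decomp u.1) (zero_add u.2)

variable {𝕂 : Type} [RCLike 𝕂] {m : ℕ} {M : Type*} [TopologicalSpace M]
  [ChartedSpace (EuclideanSpace ℝ (Fin m)) M] {L A B : VBundle 𝕂 m M}

/-- The action of a derivative endomorphism on `Γ(L) ⊕ C^∞(M)`. -/
def extendEnd (δ : DerEnd L) : Module.End 𝕂 (Sec L × SmoothFn 𝕂 m M) :=
  δ.1.1.prodMap (δ.1.2 : SmoothFn 𝕂 m M →ₗ[𝕂] SmoothFn 𝕂 m M)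

/-- The symbol is a derivation of `R`, so it is a derivative endomorphism of `R` with itself as
symbol. Hence the formulas for the action maps apply to `L ⊕ R`, and they show that `ϱ₁` and `ϱ₂`
take values in forms. -/
theorem extendEnd_smul (δ : DerEnd L) (f : SmoothFn 𝕂 m M) (u : Sec L × SmoothFn 𝕂 m M) :
    extendEnd δ (f • u) = δ.1.2 f • u + f • extendEnd δ u :=
  Prod.ext (δ.2 f u.1) ((δ.1.2.leibniz f u.2).trans (by
    rw [add_comm, smul_eq_mul, smul_eq_mul, mul_comm u.2]; rfl))

variable {P : LiePair L A} (S : Splitting P B)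

/-- The operators `ϱ₁` and `ϱ₂`, as components of action maps with values in `B ⊕ R`. -/
def Splitting.rhoMaps : RhoMaps S where
  rho1 _ δ η := (LinearMap.snd _ _ _).compAlternatingMap (S.modSplitting.extend.formAct1 (𝕂 := 𝕂)
    ((LinearMap.inr _ (Sec B) _).compAlternatingMap η) (extendEnd δ))
  rho2 _ _ δ X η := (LinearMap.snd _ _ _).compAlternatingMap (S.modSplitting.extend.formAct2 (𝕂 := 𝕂)
    ((LinearMap.inl _ _ (SmoothFn 𝕂 m M)).compAlternatingMap X)
    ((LinearMap.inr _ (Sec B) _).compAlternatingMap η) (extendEnd δ))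
  rho1_apply k δ η a := by
    have h := congrArg Prod.snd (S.modSplitting.extend.formAct1_apply (𝕂 := 𝕂)
      ((LinearMap.inr _ (Sec B) _).compAlternatingMap η) (extendEnd_smul δ) a)
    refine h.trans ?_
    rw [Prod.snd_add, Prod.snd_neg, Prod.snd_sum, neg_add_eq_sub]
    rfl
  rho2_apply i k δ X η a := by
    have h := congrArg Prod.snd (S.modSplitting.extend.formAct2_apply (𝕂 := 𝕂)
      ((LinearMap.inl _ _ (SmoothFn 𝕂 m M)).compAlternatingMap X)
      ((LinearMap.inr _ (Sec B) _).compAlternatingMap η) (extendEnd_smul δ) a)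
    have hX : ∀ l, onList i ((LinearMap.inl _ _ (SmoothFn 𝕂 m M)).compAlternatingMap X) l =
        (onList i X l, 0) := fun l =>
      (map_onList (LinearMap.inl _ _ (SmoothFn 𝕂 m M)).toAddMonoidHom i X l).symm
    have hη : ∀ l, onList k ((LinearMap.inr _ (Sec B) _).compAlternatingMap η) l =
        (0, onList k η l) := fun l =>
      (map_onList (LinearMap.inr (SmoothFn 𝕂 m M) (Sec B) (SmoothFn 𝕂 m M)).toAddMonoidHom k η l).symm
    -- The values of `η` have no component in `B`, so the half of the action that inserts them in
    -- `X` vanishes.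
    have h0 : ∀ f : SmoothFn 𝕂 m M, S.modSplitting.extend.p
        (extendEnd δ (S.modSplitting.extend.j ((0 : Sec B), f))) = 0 := fun f => by
      change S.prA.sec (δ.1.1 (S.inclB.sec 0)) = 0
      rw [map_zero, map_zero, map_zero]
    refine h.trans ?_
    simp only [ModSplitting.evCons_eq_onList]
    have h1 : (shuf (List.ofFn a) fun u v =>
        onList i ((LinearMap.inl _ _ (SmoothFn 𝕂 m M)).compAlternatingMap X)
        (S.modSplitting.extend.p (extendEnd δ (S.modSplitting.extend.j (onList k
          ((LinearMap.inr _ (Sec B) _).compAlternatingMap η) v))) :: u)) = 0 := by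
      rw [← shuf_zero (List.ofFn a)]
      refine shuf_congr fun u v _ => ?_
      rw [hη, h0, hX, ← contract_apply X, map_zero]
      rfl
    have h2 := shuffleSum2_insert S X η (S.offDiag δ).toAddMonoidHom a
    rw [h1, add_zero]
    refine (map_zsmul (AddMonoidHom.snd (Sec B) (SmoothFn 𝕂 m M)) _ _).trans ?_
    refine congrArg _ (Eq.trans ?_ h2.symm)
    refine (map_shuf (AddMonoidHom.snd (Sec B) (SmoothFn 𝕂 m M)) _ _).trans ?_
    refine shuf_congr fun u v _ => ?_
    rw [hX, hη]
    rfl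

end LieAlgd

end

open LieAlgd GradedSym in
theorem theorem4p2 {𝕂 : Type} [RCLike 𝕂] {m : ℕ} {M : Type*} [TopologicalSpace M]
    [ChartedSpace (EuclideanSpace ℝ (Fin m)) M] [IsManifold (𝓡 m) ∞ M] [T2Space M]
    [SecondCountableTopology M] {L A B : VBundle 𝕂 m M} (P : LiePair L A) (S : Splitting P B) :
    ∃ (b : Brackets S) (μ : ActionMaps S) (ρ : RhoMaps S),
      -- the brackets `b` make `Ω_A(B)` an `L_{≤3}` algebra, on which `Der(L)` acts through `μ`
      (∃ Q : Module.End 𝕂 (SymOmega S), IsCodifferential Q ∧ Encodes S b Q ∧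
        ∃ ψ : Der P.algL →ₗ[𝕂] Module.End 𝕂 (SymOmega S),
          IsDGLAHom Q ψ ∧ HasActionMaps S μ ψ) ∧
      -- `ϱ₁(δ)` and `ϱ₂(δ, X)` are derivations of `Ω_A`, of degrees `0` and `|X| - 1`
      (∀ (δ : DerEnd L) k l (η : OmegaA S k) (ζ : OmegaA S l),
        ρ.rho1 (k + l) δ (η.wedge ζ) =
          (ρ.rho1 k δ η).wedge ζ + η.wedge (ρ.rho1 l δ ζ)) ∧
      (∀ (δ : DerEnd L) i k l (X : OmegaB S i) (η : OmegaA S k) (ζ : OmegaA S l),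
        inA (S := S) (ρ.rho2 i (k + l) δ X (η.wedge ζ)) =
          inA (S := S) ((ρ.rho2 i k δ X η).wedge ζ) +
            ((-1 : ℤ) ^ (k * (i + 1))) • inA (S := S) (η.wedge (ρ.rho2 i l δ X ζ))) ∧
      -- (i)
      (∀ (f : SmoothFn 𝕂 m M) (δ : DerEnd L), μ.kappa (f • δ) = f • μ.kappa δ) ∧
      -- (ii)
      (∀ (f : SmoothFn 𝕂 m M) (δ : DerEnd L) k (X : OmegaB S k),
        μ.act1 k (f • δ) X = f • μ.act1 k δ X) ∧
      (∀ (δ : DerEnd L) k p (η : OmegaA S k) (X : OmegaB S p),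
        μ.act1 (k + p) δ (η.wedge X) = (ρ.rho1 k δ η).wedge X + η.wedge (μ.act1 p δ X)) ∧
      -- (iii)
      (∀ (f : SmoothFn 𝕂 m M) (δ : DerEnd L) i j (X : OmegaB S i) (Y : OmegaB S j),
        μ.act2 i j (f • δ) X Y = f • μ.act2 i j δ X Y) ∧
      (∀ (δ : DerEnd L) i k j (X : OmegaB S i) (η : OmegaA S k) (Y : OmegaB S j),
        inB (S := S) (μ.act2 i (k + j) δ X (η.wedge Y)) =
          inB (S := S) ((ρ.rho2 i k δ X η).wedge Y) +
            ((-1 : ℤ) ^ (k * (1 + i))) • inB (S := S) (η.wedge (μ.act2 i j δ X Y))) := by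
  exact ⟨S.brackets, S.actionMaps, S.rhoMaps,
    ⟨S.modSplitting.codiff P.algL.bracket P.algL.bracket_self, S.isCodifferential_codiff,
      S.encodes_brackets, S.derAction, S.isDGLAHom_derAction, S.hasActionMaps⟩,
    fun δ _ _ η ζ => S.rhoMaps.rho1_wedge δ η ζ,
    fun δ _ _ _ X η ζ => S.rhoMaps.rho2_wedge δ X η ζ,
    fun f δ => S.actionMaps.kappa_smul f δ,
    fun f δ _ X => S.actionMaps.act1_smul f δ X,
    fun δ _ _ η X => S.actionMaps.act1_wedge S.rhoMaps δ η X,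
    fun f δ _ _ X Y => S.actionMaps.act2_smul f δ X Y,
    fun δ _ _ _ X η Y => S.actionMaps.act2_wedge S.rhoMaps δ X η Y⟩
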